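/- **Setting.** For a real number $\sigma\ge 0$ let $H^\sigma=H^\sigma(\mathbb R)$ be the Sobolev space with norm $\|f\|_{H^\sigma}=\|\langle\partial_x\rangle^\sigma f\|_{L^2}$, $\langle\xi\rangle=(1+|\xi|^2)^{1/2}$; all functions $u,v$ below are $\mathbb R$-valued. Let $p\in[0,\infty)$ and let $K=\mathcal F^{-1}k(\xi)\mathcal F$ be the Fourier multiplier with a measurable symbol $k:\mathbb R\to\mathbb C$ such that, for a constant $A$ and all $\xi,\eta\in\mathbb R$, $$\operatorname{Re}k(\xi)\le 0,\qquad k(-\xi)=\overline{k(\xi)},\qquad |k(\xi)|\le A\langle\xi\rangle^p,$$ $$|(\xi+\eta)k(\xi+\eta)-\eta k(\eta)-\xi k(\xi)|\le A\big(|\xi|\langle\eta\rangle^p+|\eta|\langle\xi\rangle^p\big).$$ For $\Delta t>0$ and $T>0$ put $t_l=l\,\Delta t$, let $N$ be the largest integer with $N\Delta t\le T$, and set $$\Sigma_1=\bigcup_{l=1}^N (t_{l-1},t_l]\times\{t_{l-1}\},\qquad \Sigma_2=\bigcup_{l=1}^N [t_{l-1},t_l]\times(t_{l-1},t_l],\qquad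 \Pi_G^{(N)}=\{(0,0)\}\cup\Sigma_1\cup\Sigma_2 .$$ The Godunov splitting solution with initial value $u_0$ is a function $v=v(t,\tau)\in C(\Pi_G^{(N)}:H^s)$ with $$\partial_t v+vv_x=0\ \text{ for }(t,\tau)\in\Sigma_1,\qquad \partial_\tau v-Kv=0\ \text{ for }(t,\tau)\in\Sigma_2,\qquad v(0,0)=u_0. \tag{G}$$ Here and below, derivatives in $t$ and $\tau$ are derivatives of $L^2$-valued functions, one-sided at the boundary of the domain. **Theorem 1.1.** Let $p\ge 0$, $T>0$, $s>3/2+\max\{1,p\}$ and $C_0>0$. There exist $\overline{\Delta t}>0$ and $C>0$, depending only on $C_0,s,p,T$ and the constant $A$, such that the following holds for every symbol $k$ as above. Let $u\in C([0,T]:H^s)$ satisfy $$u_t+uu_x-Ku=0\ \text{ on }[0,T],\qquad u(0)=u_0,\qquad \sup_{t\in[0,T]}\|u(t)\|_{H^s}\le C_0 .$$ Then for every $\Delta t\in(0,\overline{\Delta t}]$ there exists a unique solution $v\in C(\Pi_G^{(N)}:H^s)$ of (G), and $$\sup_{t\in[0,N\Delta t]}\|v(t,t)-u(t)\|_{H^{s-\max\{1,p\}}}\le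 C\,\Delta t .$$ The same is true when (G) is replaced by the problem with the two substeps in reversed order, $$\partial_t v-Kv=0\ \text{ on }\Sigma_1,\qquad \partial_\tau v+vv_x=0\ \text{ on }\Sigma_2,\qquad v(0,0)=u_0 .$$ -/

import Mathlib

namespace GodunovSplitting

open MeasureTheory Filter Topology Set
open scoped FourierTransform ENNReal ComplexConjugate

noncomputable section

/-- `L²(ℝ)` with complex values. -/
abbrev L2 : Type := Lp ℂ 2 (volume : Measure ℝ)

/-- The Japanese bracket `⟨ξ⟩ = (1 + |ξ|²)^{1/2}`. -/
def japanese (ξ : ℝ) : ℝ := Real.sqrt (1 + ξ ^ 2)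

/-- The `H^s` norm `‖⟨∂ₓ⟩^s f‖_{L²}`, with value `∞` when `f ∉ H^s`. Mathlib's Fourier transform
on `L²` has the kernel `e^{-2πixξ}`, so its variable `ξ` corresponds to the frequency `2πξ`. -/
def sobolevNorm (s : ℝ) (f : L2) : ℝ≥0∞ :=
  eLpNorm (fun ξ : ℝ => ((japanese (2 * Real.pi * ξ) ^ s : ℝ) : ℂ) * (𝓕 f : L2) ξ) 2 volume

/-- The real-valued elements of `H^s(ℝ)`, for `s ≥ 0`. -/
def realSobolev (s : ℝ) : Set L2 :=
  {f | sobolevNorm s f < ∞ ∧ ∀ᵐ x : ℝ, (f x).im = 0}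

/-- `w ∈ C(D : H^s)`: real-valued `H^s` functions that depend continuously, in the norm of `H^s`,
on the parameter in `D`. -/
def ContinuousInSobolev {X : Type*} [TopologicalSpace X] (s : ℝ) (D : Set X) (w : X → L2) : Prop :=
  (∀ P ∈ D, w P ∈ realSobolev s) ∧
    ∀ P ∈ D, Tendsto (fun Q => sobolevNorm s (w Q - w P)) (𝓝[D] P) (𝓝 0)

open Classical in
/-- The Fourier multiplier `f ↦ ℱ⁻¹[m ℱ f]` on its maximal domain in `L²`, that is for `f ∈ L²`
with `m ℱ f ∈ L²` (and `0` for the remaining `f`, which do not occur below: a symbol of growth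
order `p` maps `H^p` into `L²`). -/
def fourierMultiplier (m : ℝ → ℂ) (f : L2) : L2 :=
  if h : MemLp (fun ξ : ℝ => m (2 * Real.pi * ξ) * (𝓕 f : L2) ξ) 2 volume then
    𝓕⁻ (h.toLp _ : L2)
  else 0

/-- The derivative `f ↦ f_x`, the Fourier multiplier with symbol `iξ`. -/
def derivX (f : L2) : L2 := fourierMultiplier (fun ξ => Complex.I * (ξ : ℂ)) f

open Classical in
/-- The nonlinearity `f ↦ f f_x` as an element of `L²` (and `0` if the pointwise product is not
square integrable, which does not occur for `f ∈ H^s` with `s ≥ 1`). -/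
def advection (f : L2) : L2 :=
  if h : MemLp (fun x : ℝ => f x * derivX f x) 2 volume then h.toLp _ else 0

/-- The standing assumptions on the symbol `k`, with growth order `p` and implicit constant `A`. -/
structure IsAdmissibleSymbol (p A : ℝ) (k : ℝ → ℂ) : Prop where
  measurable : Measurable k
  re_nonpos : ∀ ξ, (k ξ).re ≤ 0
  neg_eq_conj : ∀ ξ, k (-ξ) = conj (k ξ)
  growth : ∀ ξ, ‖k ξ‖ ≤ A * japanese ξ ^ p
  commutator : ∀ ξ η : ℝ,
    ‖((ξ + η : ℝ) : ℂ) * k (ξ + η) - (η : ℂ) * k η - (ξ : ℂ) * k ξ‖ ≤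
      A * (|ξ| * japanese η ^ p + |η| * japanese ξ ^ p)

/-- `u ∈ C([0,T] : H^s)` is a real-valued solution of `u_t + u u_x - K u = 0`, `u(0) = u₀`. The
time derivative is that of the `L²`-valued function `u`, one-sided at the endpoints. -/
structure IsExactSolution (k : ℝ → ℂ) (s T : ℝ) (u₀ : L2) (u : ℝ → L2) : Prop where
  continuous : ContinuousInSobolev s (Icc 0 T) u
  equation : ∀ t ∈ Icc 0 T,
    HasDerivWithinAt u (fourierMultiplier k (u t) - advection (u t)) (Icc 0 T) t
  initial : u 0 = u₀

/-- `N(Δt, T)`, the largest integer `N` with `N Δt ≤ T` (for `Δt > 0`, `T ≥ 0`). -/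
def numSteps (Δt T : ℝ) : ℕ := ⌊T / Δt⌋₊

/-- `Ω₁^{(l)} = (t_{l-1}, t_l] × {t_{l-1}}` with `t_l = l Δt`. -/
def Omega1 (Δt : ℝ) (l : ℕ) : Set (ℝ × ℝ) :=
  Ioc (((l : ℝ) - 1) * Δt) (l * Δt) ×ˢ {((l : ℝ) - 1) * Δt}

/-- `Ω₂^{(l)} = [t_{l-1}, t_l] × (t_{l-1}, t_l]`. -/
def Omega2 (Δt : ℝ) (l : ℕ) : Set (ℝ × ℝ) :=
  Icc (((l : ℝ) - 1) * Δt) (l * Δt) ×ˢ Ioc (((l : ℝ) - 1) * Δt) (l * Δt)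

/-- `Σ₁^{(n)}`, the union of the `Ω₁^{(l)}` with `1 ≤ l ≤ n`. -/
def Sigma1 (Δt : ℝ) (n : ℕ) : Set (ℝ × ℝ) := ⋃ l ∈ Icc 1 n, Omega1 Δt l

/-- `Σ₂^{(n)}`, the union of the `Ω₂^{(l)}` with `1 ≤ l ≤ n`. -/
def Sigma2 (Δt : ℝ) (n : ℕ) : Set (ℝ × ℝ) := ⋃ l ∈ Icc 1 n, Omega2 Δt l

/-- `Π^{(n)} = Σ₁^{(n)} ∪ Σ₂^{(n)}` together with the point `(0, 0)` that carries the initial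
value: for `n ≥ 1` this is the union of the closed squares `[t_{l-1}, t_l]²`, `1 ≤ l ≤ n`. -/
def Domain (Δt : ℝ) (n : ℕ) : Set (ℝ × ℝ) := {(0, 0)} ∪ (Sigma1 Δt n ∪ Sigma2 Δt n)

/-- `v ∈ C(Π^{(n)} : H^s)` is real-valued and solves `∂_t v = A(v)` on `Σ₁^{(n)}`,
`∂_τ v = B(v)` on `Σ₂^{(n)}`, `v(0,0) = u₀`. The derivatives are those of `L²`-valued functions,
taken within `Π^{(n)}` (one-sided at its boundary). -/
structure IsSplittingSolution (A B : L2 → L2) (s Δt : ℝ) (n : ℕ) (u₀ : L2) (v : ℝ × ℝ → L2) :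
    Prop where
  continuous : ContinuousInSobolev s (Domain Δt n) v
  first : ∀ t τ, (t, τ) ∈ Sigma1 Δt n →
    HasDerivWithinAt (fun t' => v (t', τ)) (A (v (t, τ))) {t' | (t', τ) ∈ Domain Δt n} t
  second : ∀ t τ, (t, τ) ∈ Sigma2 Δt n →
    HasDerivWithinAt (fun τ' => v (t, τ')) (B (v (t, τ))) {τ' | (t, τ') ∈ Domain Δt n} τ
  initial : v (0, 0) = u₀

/-- The splitting with substeps `A`, then `B` has a solution `v`, it is unique on the domain, and
`sup_{t ∈ [0, n Δt]} ‖v(t,t) - u(t)‖_{H^r} ≤ ε`. -/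
def UniquelySolvableWithError (A B : L2 → L2) (s r Δt : ℝ) (n : ℕ) (u₀ : L2) (u : ℝ → L2)
    (ε : ℝ) : Prop :=
  ∃ v : ℝ × ℝ → L2, IsSplittingSolution A B s Δt n u₀ v ∧
    (∀ w, IsSplittingSolution A B s Δt n u₀ w → EqOn w v (Domain Δt n)) ∧
    (⨆ t ∈ Icc (0 : ℝ) (n * Δt), sobolevNorm r (v (t, t) - u t)) ≤ ENNReal.ofReal ε

end

end GodunovSplitting

/-! Each splitting step is compared with the exact evolution by an energy estimate, and the local
error is a commutator. Let B be Burgers' flow and b = B(t)f. Then z(t) = e^{tK}b solves z_t + z z_x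
- Kz = F with F = (e^{tK}b)(e^{tK}b)_x - e^{tK}(b b_x). On the Fourier side, after symmetrising in
the two frequencies, F is bilinear in b with symbol (i/2)(ξ+η)(e^{t(k(ξ)+k(η))} - e^{tk(ξ+η)}).
Because Re k ≤ 0 and exp is 1-Lipschitz on the left half-plane, the hypotheses on k bound this
symbol by a multiple of t(⟨ξ⟩⟨η⟩^p + ⟨η⟩⟨ξ⟩^p). So F is O(t) in H^r, r = s - max{1,p}, as long as b
is bounded in H^s (`wnorm_kComm_le`).

The difference D = z - u satisfies D_t = KD - (z D_x + D u_x) + F. The operator K is dissipative,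
the transport term z D_x loses no derivative in the energy, and D u_x costs the H^{r+1} norm of u,
available since r + 1 ≤ s. Over one step the error is multiplied by 1 + κΔt and increased by O(Δt²)
(`wnorm_difference_le`, `wnorm_kFlow_burgers_sub_le`); summing over at most T/Δt steps gives O(Δt).

The constants require the numerical solution to stay bounded in H^s. Burgers' flow lets the H^s norm
grow at a rate given by the L¹ norm of the transform of the x-derivative, which the H^r norm
controls because r > 3/2. A bootstrap closes the argument (`IsOneStepMethod.iterates_bound`): an
error below C₀ keeps the H^r norm below 2C₀, this gives an exponential H^s bound, and that bound
gives the next error estimate.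

For the reversed order, θ is frozen and e^{θK}B(t)f is compared with B(t)e^{θK}f. They solve
Burgers' equation with and without the same commutator as forcing, so the two orders differ by
O(Δt²) per step (`wnorm_burgers_kFlow_sub_le`).

Everything takes place on the Fourier side, where f f_x is a convolution. A single symbol
inequality, `IsWeight.symbol_le`, for all even, monotone, polynomially bounded weights yields the
growth of Sobolev norms, the bounds on the Galerkin approximations that produce Burgers' flow
(`exists_burgers`), and the tightness of high frequencies that upgrades continuity in L² to
continuity in H^s. The splitting solution is glued from the flows on the squares; uniqueness follows
from L² estimates on each substep. -/

namespace GodunovSplitting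

open MeasureTheory Filter Topology Set
open scoped FourierTransform ENNReal ComplexConjugate

/-! ### Fourier weights and the symbol inequality behind the energy estimates -/

noncomputable section

/-- The Japanese bracket of the frequency `2πξ`. -/
def bracket (ξ : ℝ) : ℝ := japanese (2 * Real.pi * ξ)

lemma one_le_bracket (ξ : ℝ) : 1 ≤ bracket ξ := by
  unfold bracket japanese
  rw [Real.one_le_sqrt]
  nlinarith [sq_nonneg (2 * Real.pi * ξ)]

lemma bracket_pos (ξ : ℝ) : 0 < bracket ξ := lt_of_lt_of_le one_pos (one_le_bracket ξ)

lemma abs_le_bracket (ξ : ℝ) : |2 * Real.pi * ξ| ≤ bracket ξ := by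
  unfold bracket japanese
  apply Real.abs_le_sqrt
  linarith

lemma continuous_bracket : Continuous bracket := by
  unfold bracket japanese
  fun_prop

lemma bracket_sq (ξ : ℝ) : bracket ξ ^ 2 = 1 + (2 * Real.pi * ξ) ^ 2 := by
  unfold bracket japanese
  rw [Real.sq_sqrt (by positivity)]

lemma bracket_mono {ξ η : ℝ} (h : |ξ| ≤ |η|) : bracket ξ ≤ bracket η := by
  unfold bracket japanese
  apply Real.sqrt_le_sqrt
  have := sq_le_sq.2 h
  have h2 : 0 ≤ (2 * Real.pi) ^ 2 := by positivity
  nlinarith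

lemma abs_mul_bracket_le {ξ η : ℝ} (h : |ξ| ≤ |η|) : |ξ| * bracket η ≤ |η| * bracket ξ := by
  have hp := (bracket_pos ξ).le
  refine abs_le_of_sq_le_sq' ?_ (by positivity) |>.2
  rw [mul_pow, mul_pow, bracket_sq, bracket_sq, sq_abs, sq_abs]
  have := sq_le_sq.2 h
  nlinarith

lemma bracket_rpow_mono {ξ η s : ℝ} (hs : 0 ≤ s) (h : |ξ| ≤ |η|) :
    bracket ξ ^ s ≤ bracket η ^ s :=
  Real.rpow_le_rpow (bracket_pos ξ).le (bracket_mono h) hs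

lemma measurable_bracket_rpow (s : ℝ) : Measurable fun ξ => bracket ξ ^ s :=
  continuous_bracket.measurable.pow_const s

lemma bracket_rpow_pos (ξ s : ℝ) : 0 < bracket ξ ^ s := Real.rpow_pos_of_pos (bracket_pos ξ) s

lemma one_le_bracket_rpow (ξ : ℝ) {s : ℝ} (hs : 0 ≤ s) : 1 ≤ bracket ξ ^ s :=
  Real.one_le_rpow (one_le_bracket ξ) hs

lemma bracket_rpow_le (ξ : ℝ) {s t : ℝ} (h : s ≤ t) : bracket ξ ^ s ≤ bracket ξ ^ t :=
  Real.rpow_le_rpow_of_exponent_le (one_le_bracket ξ) h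

/-- Even Fourier weights that are nondecreasing in `|ξ|` and grow at most like `|ξ| ^ m`, in the
sense that `ω(ξ) / |ξ| ^ m` is nonincreasing in `|ξ|`. -/
structure IsWeight (m : ℕ) (ω : ℝ → ℝ) : Prop where
  measurable : Measurable ω
  nonneg : ∀ ξ, 0 ≤ ω ξ
  mono : ∀ ξ η, |ξ| ≤ |η| → ω ξ ≤ ω η
  growth : ∀ ξ η, |ξ| ≤ |η| → |ξ| ^ m * ω η ≤ |η| ^ m * ω ξ

namespace IsWeight

variable {m : ℕ} {ω : ℝ → ℝ}

/-- Truncation stays in the class with the same `m`. Energy estimates can therefore be run with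
bounded weights, whose energies are finite and differentiable along any differentiable L²-valued
curve, with constants independent of the truncation level. -/
lemma min_const (h : IsWeight m ω) {c : ℝ} (hc : 0 ≤ c) : IsWeight m fun ξ => min (ω ξ) c where
  measurable := h.measurable.min measurable_const
  nonneg ξ := le_min (h.nonneg ξ) hc
  mono ξ η hle := min_le_min_right c (h.mono ξ η hle)
  growth ξ η hle := by
    rw [mul_min_of_nonneg _ _ (by positivity), mul_min_of_nonneg _ _ (by positivity)]
    exact min_le_min (h.growth ξ η hle) (by gcongr)

lemma mul {n : ℕ} {ω' : ℝ → ℝ} (h : IsWeight m ω) (h' : IsWeight n ω') :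
    IsWeight (m + n) fun ξ => ω ξ * ω' ξ where
  measurable := h.measurable.mul h'.measurable
  nonneg ξ := mul_nonneg (h.nonneg ξ) (h'.nonneg ξ)
  mono ξ η hle := mul_le_mul (h.mono ξ η hle) (h'.mono ξ η hle) (h'.nonneg ξ) (h.nonneg η)
  growth ξ η hle := by
    have h1 := h.growth ξ η hle
    have h2 := h'.growth ξ η hle
    calc |ξ| ^ (m + n) * (ω η * ω' η) = (|ξ| ^ m * ω η) * (|ξ| ^ n * ω' η) := by ring
      _ ≤ (|η| ^ m * ω ξ) * (|η| ^ n * ω' ξ) :=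
        mul_le_mul h1 h2 (mul_nonneg (by positivity) (h'.nonneg η))
          (mul_nonneg (by positivity) (h.nonneg ξ))
      _ = _ := by ring

lemma even (h : IsWeight m ω) (ξ : ℝ) : ω (-ξ) = ω ξ :=
  le_antisymm (h.mono _ _ (by simp)) (h.mono _ _ (by simp))

/-- The quotient `|ξ| / bracket ξ` is nondecreasing in `|ξ|`, hence so is its power `s`; the
leftover factor `|ξ| ^ (m - s)` is nondecreasing because `s ≤ m`. -/
lemma bracket_rpow {s : ℝ} (hs : 0 ≤ s) (hm : s ≤ m) : IsWeight m fun ξ => bracket ξ ^ s where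
  measurable := measurable_bracket_rpow s
  nonneg ξ := (bracket_rpow_pos ξ s).le
  mono ξ η h := bracket_rpow_mono hs h
  growth ξ η h := by
    have h1 := Real.rpow_le_rpow (mul_nonneg (abs_nonneg ξ) (bracket_pos η).le)
      (abs_mul_bracket_le h) hs
    rw [Real.mul_rpow (abs_nonneg _) (bracket_pos _).le,
      Real.mul_rpow (abs_nonneg _) (bracket_pos _).le] at h1
    have h2 := Real.rpow_le_rpow (abs_nonneg ξ) h (sub_nonneg.2 hm)
    rcases (abs_nonneg ξ).eq_or_lt with h0 | h0
    · rcases Nat.eq_zero_or_pos m with rfl | hm0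
      · have : s = 0 := le_antisymm (by simpa using hm) hs
        simp [this]
      · rw [← h0, zero_pow hm0.ne', zero_mul]
        exact mul_nonneg (by positivity) (bracket_rpow_pos ξ s).le
    · have h0' := h0.trans_le h
      have e : ∀ x : ℝ, 0 < x → x ^ m = x ^ ((m : ℝ) - s) * x ^ s := fun x hx => by
        rw [← Real.rpow_add hx, sub_add_cancel, Real.rpow_natCast]
      rw [e _ h0, e _ h0', mul_assoc, mul_assoc]
      exact mul_le_mul h2 h1 (by have := bracket_rpow_pos η s; positivity) (by positivity)

lemma min_one_abs_div {R : ℝ} (hR : 0 < R) : IsWeight 1 fun ξ => min (|ξ| / R) 1 := by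
  refine min_const (ω := fun ξ => |ξ| / R) ⟨by fun_prop, fun ξ => by positivity, fun ξ η h => by
    gcongr, fun ξ η h => le_of_eq (by ring)⟩ zero_le_one

lemma le_two_pow_mul (h : IsWeight m ω) {ξ η : ℝ} (hle : |ξ| ≤ 2 * |η|) :
    ω ξ ≤ 2 ^ m * ω η := by
  rcases le_total |ξ| |η| with h1 | h1
  · calc ω ξ ≤ ω η := h.mono _ _ h1
      _ ≤ 2 ^ m * ω η := le_mul_of_one_le_left (h.nonneg _) (one_le_pow₀ (by norm_num))
  · rcases (abs_nonneg η).eq_or_lt with h0 | h0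
    · have : ω ξ = ω η := le_antisymm (h.mono _ _ (by linarith)) (h.mono _ _ h1)
      rw [this]
      exact le_mul_of_one_le_left (h.nonneg _) (one_le_pow₀ (by norm_num))
    · have h2 := h.growth _ _ h1
      have h3 : |ξ| ^ m ≤ 2 ^ m * |η| ^ m := by
        rw [← mul_pow]; gcongr
      have h4 : |η| ^ m * ω ξ ≤ |η| ^ m * (2 ^ m * ω η) := by
        calc _ ≤ _ := h2
          _ ≤ (2 ^ m * |η| ^ m) * ω η := mul_le_mul_of_nonneg_right h3 (h.nonneg _)
          _ = _ := by ring
      exact le_of_mul_le_mul_left h4 (by positivity)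

lemma le_add (h : IsWeight m ω) (ξ η : ℝ) : ω ξ ≤ 2 ^ m * (ω (ξ - η) + ω η) := by
  have hc : (0 : ℝ) ≤ 2 ^ m := by positivity
  have ha : |ξ| ≤ |ξ - η| + |η| := by simpa using abs_add_le (ξ - η) η
  rcases le_total |ξ - η| |η| with h1 | h1
  · have := h.le_two_pow_mul (ξ := ξ) (η := η) (by linarith)
    nlinarith [mul_nonneg hc (h.nonneg (ξ - η))]
  · have := h.le_two_pow_mul (ξ := ξ) (η := ξ - η) (by linarith)
    nlinarith [mul_nonneg hc (h.nonneg η)]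

/-- A substitute for the derivative bound `|η| ω'(η) ≤ m ω(η)`: the growth condition gives `ω ξ ≥
(|ξ| / |η|) ^ m * ω η`, and Bernoulli's inequality makes the power linear. No differentiability of
the weight is needed, so truncated weights are covered. -/
lemma le_mul_of_abs_le (h : IsWeight m ω) {ξ η : ℝ} (hle : |ξ| ≤ |η|) :
    |η| * (ω η - ω ξ) ≤ m * |ξ - η| * ω η := by
  rcases (abs_nonneg η).eq_or_lt with h0 | h0
  · rw [← h0, zero_mul]
    exact mul_nonneg (by positivity) (h.nonneg _)
  · have hd : |η| - |ξ| ≤ |ξ - η| := by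
      rw [abs_sub_comm]; exact abs_sub_abs_le_abs_sub η ξ
    have hb := one_add_mul_le_pow (a := |ξ| / |η| - 1) (by
      have : 0 ≤ |ξ| / |η| := by positivity
      linarith) m
    rw [add_sub_cancel, div_pow] at hb
    have h1 : (|ξ| ^ m / |η| ^ m) * ω η ≤ ω ξ := by
      rw [div_mul_eq_mul_div, div_le_iff₀ (by positivity), mul_comm (ω ξ)]
      exact h.growth _ _ hle
    have h2 := (mul_le_mul_of_nonneg_right hb (h.nonneg η)).trans h1
    have h3 : ω η - ω ξ ≤ m * (1 - |ξ| / |η|) * ω η := by linarith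
    have h4 := mul_le_mul_of_nonneg_left h3 h0.le
    have h5 : |η| * (m * (1 - |ξ| / |η|) * ω η) = m * (|η| - |ξ|) * ω η := by
      field_simp
    rw [h5] at h4
    refine h4.trans ?_
    exact mul_le_mul_of_nonneg_right (by gcongr) (h.nonneg _)

/-- The constant of the symmetrised energy estimate. -/
def _root_.GodunovSplitting.energyConst (m : ℕ) : ℝ := (2 * m + 1) * 2 ^ m

lemma _root_.GodunovSplitting.energyConst_nonneg (m : ℕ) : 0 ≤ energyConst m := by
  unfold energyConst; positivity

/-- If `|η| ≤ 2 |ξ - η|`, both `ω ξ` and `ω η` are dominated by `ω (ξ - η)` and the two terms are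
estimated separately. Otherwise `ω ξ` and `ω η` are comparable, and `ω η ^ 2 - ω ξ ^ 2` gains the
factor `|ξ - η| / |η|` from `le_mul_of_abs_le`; this case fixes the constant `(2 * m + 1) * 2 ^ m`.
-/
lemma symbol_le_of_abs_le (h : IsWeight m ω) {ξ η : ℝ} (hle : |ξ| ≤ |η|) :
    |η * ω ξ ^ 2 - ξ * ω η ^ 2| ≤ energyConst m *
      (|ξ - η| * (ω ξ * ω η) + |η| * (ω ξ * ω (ξ - η)) + |ξ| * (ω η * ω (ξ - η))) := by
  have hx := h.nonneg ξ
  have he := h.nonneg η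
  have hr := h.nonneg (ξ - η)
  have hm := h.mono _ _ hle
  have hc : (2 : ℝ) ^ m ≤ energyConst m := by
    unfold energyConst
    exact le_mul_of_one_le_left (by positivity) (by linarith [(Nat.cast_nonneg m : (0 : ℝ) ≤ m)])
  have htri : |η| ≤ |ξ - η| + |ξ| := by
    have := abs_sub_abs_le_abs_sub η ξ
    rw [abs_sub_comm ξ η]; linarith
  rcases le_total (|η|) (2 * |ξ - η|) with hcase | hcase
  · have h1 := h.le_two_pow_mul hcase
    have h2 := hm.trans h1
    calc |η * ω ξ ^ 2 - ξ * ω η ^ 2| ≤ |η| * ω ξ ^ 2 + |ξ| * ω η ^ 2 := by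
          refine (abs_sub _ _).trans (le_of_eq ?_)
          rw [abs_mul, abs_mul, abs_of_nonneg (sq_nonneg (ω ξ)), abs_of_nonneg (sq_nonneg (ω η))]
      _ ≤ |η| * (ω ξ * (2 ^ m * ω (ξ - η))) + |ξ| * (ω η * (2 ^ m * ω (ξ - η))) := by
          rw [sq, sq]; gcongr
      _ = 2 ^ m * (|η| * (ω ξ * ω (ξ - η)) + |ξ| * (ω η * ω (ξ - η))) := by ring
      _ ≤ energyConst m *
          (|ξ - η| * (ω ξ * ω η) + |η| * (ω ξ * ω (ξ - η)) + |ξ| * (ω η * ω (ξ - η))) := by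
          refine mul_le_mul hc ?_ (by positivity) (energyConst_nonneg m)
          have : 0 ≤ |ξ - η| * (ω ξ * ω η) := by positivity
          linarith
  · have h1 : ω η ≤ 2 ^ m * ω ξ := h.le_two_pow_mul (by linarith)
    have h2 := h.le_mul_of_abs_le hle
    have hsplit : η * ω ξ ^ 2 - ξ * ω η ^ 2
        = -(η * ((ω η - ω ξ) * (ω η + ω ξ)) + (ξ - η) * ω η ^ 2) := by ring
    calc |η * ω ξ ^ 2 - ξ * ω η ^ 2|
        ≤ |η| * (ω η - ω ξ) * (ω η + ω ξ) + |ξ - η| * ω η ^ 2 := by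
          rw [hsplit, abs_neg]
          refine (abs_add_le _ _).trans (le_of_eq ?_)
          rw [abs_mul, abs_mul (ξ - η), abs_of_nonneg (sq_nonneg (ω η)),
            abs_of_nonneg (mul_nonneg (sub_nonneg.2 hm) (add_nonneg he hx)), mul_assoc]
      _ ≤ (m * |ξ - η| * ω η) * (2 * ω η) + |ξ - η| * ω η ^ 2 := by
          gcongr
          linarith
      _ = (2 * m + 1) * |ξ - η| * ω η * ω η := by ring
      _ ≤ (2 * m + 1) * |ξ - η| * ω η * (2 ^ m * ω ξ) := by gcongr
      _ = energyConst m * (|ξ - η| * (ω ξ * ω η)) := by unfold energyConst; ring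
      _ ≤ _ := by
          refine mul_le_mul_of_nonneg_left ?_ (energyConst_nonneg m)
          have h3 : 0 ≤ |η| * (ω ξ * ω (ξ - η)) := by positivity
          have h4 : 0 ≤ |ξ| * (ω η * ω (ξ - η)) := by positivity
          linarith

lemma symbol_le (h : IsWeight m ω) (ξ η : ℝ) :
    |η * ω ξ ^ 2 - ξ * ω η ^ 2| ≤ energyConst m *
      (|ξ - η| * (ω ξ * ω η) + |η| * (ω ξ * ω (ξ - η)) + |ξ| * (ω η * ω (ξ - η))) := by
  rcases le_total |ξ| |η| with hle | hle
  · exact h.symbol_le_of_abs_le hle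
  · have := h.symbol_le_of_abs_le hle
    rw [abs_sub_comm] at this
    refine this.trans (le_of_eq ?_)
    have e : ω (η - ξ) = ω (ξ - η) := by rw [← h.even]; ring_nf
    rw [abs_sub_comm η ξ, e]
    ring

end IsWeight

end

/-! ### Convolution estimates for nonnegative functions -/

noncomputable section

/-- The `L²` norm of an `ℝ≥0∞`-valued function. -/
def norm2 (f : ℝ → ℝ≥0∞) : ℝ≥0∞ := (∫⁻ x, f x ^ (2 : ℝ)) ^ (1 / 2 : ℝ)

/-- The convolution of `ℝ≥0∞`-valued functions. -/
def lconv (f g : ℝ → ℝ≥0∞) (ξ : ℝ) : ℝ≥0∞ := ∫⁻ η, f (ξ - η) * g η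

lemma norm2_mono {f g : ℝ → ℝ≥0∞} (h : ∀ x, f x ≤ g x) : norm2 f ≤ norm2 g := by
  unfold norm2
  gcongr with x
  exact h x

lemma norm2_mono_ae {f g : ℝ → ℝ≥0∞} (h : ∀ᵐ x, f x ≤ g x) : norm2 f ≤ norm2 g := by
  unfold norm2
  refine ENNReal.rpow_le_rpow (lintegral_mono_ae ?_) (by norm_num)
  filter_upwards [h] with x hx
  gcongr

lemma norm2_add_le {f g : ℝ → ℝ≥0∞} (hf : Measurable f) (hg : Measurable g) :
    norm2 (fun x => f x + g x) ≤ norm2 f + norm2 g :=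
  ENNReal.lintegral_Lp_add_le hf.aemeasurable hg.aemeasurable (by norm_num)

lemma norm2_sq (f : ℝ → ℝ≥0∞) : norm2 f ^ (2 : ℝ) = ∫⁻ x, f x ^ (2 : ℝ) := by
  unfold norm2
  rw [← ENNReal.rpow_mul]; norm_num

lemma norm2_const_mul {f : ℝ → ℝ≥0∞} (hf : Measurable f) (c : ℝ≥0∞) :
    norm2 (fun x => c * f x) = c * norm2 f := by
  unfold norm2
  simp_rw [ENNReal.mul_rpow_of_nonneg _ _ (by norm_num : (0 : ℝ) ≤ 2)]
  rw [lintegral_const_mul _ (hf.pow_const _), ENNReal.mul_rpow_of_nonneg _ _ (by norm_num),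
    ← ENNReal.rpow_mul]
  norm_num

lemma lintegral_mul_le_norm2 {f g : ℝ → ℝ≥0∞} (hf : Measurable f) (hg : Measurable g) :
    ∫⁻ x, f x * g x ≤ norm2 f * norm2 g :=
  ENNReal.lintegral_mul_le_Lp_mul_Lq volume Real.HolderConjugate.two_two hf.aemeasurable
    hg.aemeasurable

lemma norm2_eq_eLpNorm (f : ℝ → ℂ) : norm2 (fun x => ‖f x‖ₑ) = eLpNorm f 2 volume := by
  rw [eLpNorm_eq_lintegral_rpow_enorm_toReal (by norm_num) (by norm_num)]
  simp [norm2]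

lemma measurable_lconv {f g : ℝ → ℝ≥0∞} (hf : Measurable f) (hg : Measurable g) :
    Measurable (lconv f g) := by
  unfold lconv
  apply Measurable.lintegral_prod_right'
    (f := fun p : ℝ × ℝ => f (p.1 - p.2) * g p.2)
  fun_prop

lemma lconv_comm (f g : ℝ → ℝ≥0∞) : lconv f g = lconv g f := by
  ext ξ
  unfold lconv
  rw [← lintegral_sub_left_eq_self _ ξ]
  simp [mul_comm]

lemma lconv_le_norm2 {f g : ℝ → ℝ≥0∞} (hf : Measurable f) (hg : Measurable g) (ξ : ℝ) :
    lconv f g ξ ≤ norm2 f * norm2 g := by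
  have h := lintegral_mul_le_norm2 (f := fun η => f (ξ - η)) (by fun_prop) hg
  refine h.trans (le_of_eq ?_)
  congr 1
  unfold norm2
  rw [lintegral_sub_left_eq_self (fun x => f x ^ (2 : ℝ)) ξ]

/-- Young's inequality `L¹ * L² → L²`. -/
lemma norm2_lconv_le {f g : ℝ → ℝ≥0∞} (hf : Measurable f) (hg : Measurable g) :
    norm2 (lconv f g) ≤ (∫⁻ x, f x) * norm2 g := by
  have hpt : ∀ ξ, lconv f g ξ ^ (2 : ℝ)
      ≤ (∫⁻ x, f x) * ∫⁻ η, f (ξ - η) * g η ^ (2 : ℝ) := by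
    intro ξ
    have hfξ : Measurable fun η => f (ξ - η) := by fun_prop
    -- Cauchy–Schwarz with `f` split into two square roots: one factor of the mass of `f` comes out
    -- here, the other after Tonelli.
    have h := lintegral_mul_le_norm2 (f := fun η => f (ξ - η) ^ (1 / 2 : ℝ))
      (g := fun η => f (ξ - η) ^ (1 / 2 : ℝ) * g η) (by fun_prop) (by fun_prop)
    have e1 : ∀ η, f (ξ - η) ^ (1 / 2 : ℝ) * (f (ξ - η) ^ (1 / 2 : ℝ) * g η)
        = f (ξ - η) * g η := fun η => by
      rw [← mul_assoc, ← ENNReal.rpow_add_of_nonneg _ _ (by norm_num) (by norm_num)]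
      norm_num
    simp_rw [e1] at h
    have h2 := ENNReal.rpow_le_rpow h (by norm_num : (0 : ℝ) ≤ 2)
    rw [ENNReal.mul_rpow_of_nonneg _ _ (by norm_num), norm2_sq, norm2_sq] at h2
    refine h2.trans (le_of_eq ?_)
    simp_rw [ENNReal.mul_rpow_of_nonneg _ _ (by norm_num : (0 : ℝ) ≤ 2), ← ENNReal.rpow_mul]
    norm_num
    rw [lintegral_sub_left_eq_self f ξ]
  have hswap : ∫⁻ ξ, ∫⁻ η, f (ξ - η) * g η ^ (2 : ℝ) = (∫⁻ x, f x) * ∫⁻ x, g x ^ (2 : ℝ) := by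
    rw [lintegral_lintegral_swap (by fun_prop)]
    have : ∀ η, ∫⁻ ξ, f (ξ - η) * g η ^ (2 : ℝ) = (∫⁻ x, f x) * g η ^ (2 : ℝ) := fun η => by
      rw [lintegral_mul_const _ (by fun_prop), lintegral_sub_right_eq_self f η]
    simp_rw [this]
    rw [lintegral_const_mul _ (by fun_prop)]
  have hfin : (∫⁻ ξ, lconv f g ξ ^ (2 : ℝ)) ≤ ((∫⁻ x, f x) * norm2 g) ^ (2 : ℝ) := by
    calc _ ≤ ∫⁻ ξ, (∫⁻ x, f x) * ∫⁻ η, f (ξ - η) * g η ^ (2 : ℝ) := lintegral_mono hpt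
      _ = (∫⁻ x, f x) * ((∫⁻ x, f x) * ∫⁻ x, g x ^ (2 : ℝ)) := by
          rw [lintegral_const_mul, hswap]
          apply Measurable.lintegral_prod_right'
            (f := fun p : ℝ × ℝ => f (p.1 - p.2) * g p.2 ^ (2 : ℝ))
          fun_prop
      _ = _ := by
          rw [ENNReal.mul_rpow_of_nonneg _ _ (by norm_num), norm2_sq, ← mul_assoc]
          congr 1
          rw [ENNReal.rpow_ofNat, sq]
  calc norm2 (lconv f g) ≤ (((∫⁻ x, f x) * norm2 g) ^ (2 : ℝ)) ^ (1 / 2 : ℝ) := by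
        unfold norm2 at hfin ⊢; gcongr
    _ = _ := by rw [← ENNReal.rpow_mul]; norm_num

/-- The product estimate in weighted `L²` spaces on the Fourier side. -/
lemma IsWeight.norm2_mul_lconv_le {m : ℕ} {ω : ℝ → ℝ} (h : IsWeight m ω) {f g : ℝ → ℝ≥0∞}
    (hf : Measurable f) (hg : Measurable g) :
    norm2 (fun ξ => ENNReal.ofReal (ω ξ) * lconv f g ξ) ≤
      2 ^ m * (norm2 (fun ξ => ENNReal.ofReal (ω ξ) * f ξ) * (∫⁻ ξ, g ξ) +
        (∫⁻ ξ, f ξ) * norm2 (fun ξ => ENNReal.ofReal (ω ξ) * g ξ)) := by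
  have hω := h.measurable
  have hF : Measurable fun ξ => ENNReal.ofReal (ω ξ) * f ξ := by fun_prop
  have hG : Measurable fun ξ => ENNReal.ofReal (ω ξ) * g ξ := by fun_prop
  have hpt : ∀ ξ, ENNReal.ofReal (ω ξ) * lconv f g ξ ≤
      2 ^ m * (lconv (fun ξ => ENNReal.ofReal (ω ξ) * f ξ) g ξ +
        lconv f (fun ξ => ENNReal.ofReal (ω ξ) * g ξ) ξ) := by
    intro ξ
    unfold lconv
    rw [← lintegral_add_left (by fun_prop), ← lintegral_const_mul _ (by fun_prop),
      ← lintegral_const_mul _ (by fun_prop)]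
    refine lintegral_mono fun η => ?_
    have h1 : ENNReal.ofReal (ω ξ)
        ≤ 2 ^ m * (ENNReal.ofReal (ω (ξ - η)) + ENNReal.ofReal (ω η)) := by
      rw [← ENNReal.ofReal_add (h.nonneg _) (h.nonneg _)]
      have h2 : (2 : ℝ≥0∞) ^ m = ENNReal.ofReal (2 ^ m) := by
        rw [ENNReal.ofReal_pow (by norm_num)]; norm_num
      rw [h2, ← ENNReal.ofReal_mul (by positivity)]
      exact ENNReal.ofReal_le_ofReal (h.le_add ξ η)
    calc ENNReal.ofReal (ω ξ) * (f (ξ - η) * g η)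
        ≤ (2 ^ m * (ENNReal.ofReal (ω (ξ - η)) + ENNReal.ofReal (ω η))) * (f (ξ - η) * g η) := by
          gcongr
      _ = _ := by ring
  refine (norm2_mono hpt).trans ?_
  rw [norm2_const_mul (f := fun ξ => lconv (fun ξ => ENNReal.ofReal (ω ξ) * f ξ) g ξ +
    lconv f (fun ξ => ENNReal.ofReal (ω ξ) * g ξ) ξ)
    ((measurable_lconv hF hg).add (measurable_lconv hf hG))]
  gcongr
  refine (norm2_add_le (measurable_lconv hF hg) (measurable_lconv hf hG)).trans ?_
  gcongr
  · rw [lconv_comm, mul_comm]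
    exact norm2_lconv_le hg hF
  · exact norm2_lconv_le hf hG

end

/-! ### The L² Fourier transform: products and reality -/

noncomputable section

open Classical in
/-- The element of `L²` given by a function, and `0` if the function is not square integrable. -/
def ofFun (F : ℝ → ℂ) : L2 := if h : MemLp F 2 volume then h.toLp F else 0

lemma ofFun_coe {F : ℝ → ℂ} (h : MemLp F 2 volume) : (ofFun F : ℝ → ℂ) =ᵐ[volume] F := by
  rw [ofFun, dif_pos h]
  exact h.coeFn_toLp

lemma ofFun_eq_iff {F : ℝ → ℂ} (h : MemLp F 2 volume) (U : L2) :
    ofFun F = U ↔ F =ᵐ[volume] U := by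
  constructor
  · rintro rfl
    exact (ofFun_coe h).symm
  · intro h2
    exact Lp.ext ((ofFun_coe h).trans h2)

lemma fourierMultiplier_eq (m : ℝ → ℂ) (f : L2) :
    fourierMultiplier m f = 𝓕⁻ (ofFun fun ξ => m (2 * Real.pi * ξ) * (𝓕 f : L2) ξ) := by
  unfold fourierMultiplier ofFun
  split_ifs with h
  · rfl
  · exact (map_zero (Lp.fourierTransformₗᵢ ℝ ℂ).symm).symm

lemma fourier_fourierMultiplier (m : ℝ → ℂ) (f : L2) :
    𝓕 (fourierMultiplier m f) = ofFun fun ξ => m (2 * Real.pi * ξ) * (𝓕 f : L2) ξ := by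
  rw [fourierMultiplier_eq, FourierTransform.fourier_fourierInv_eq]

/-- The convolution of complex functions. -/
def conv (U V : ℝ → ℂ) (ξ : ℝ) : ℂ := ∫ η, U (ξ - η) * V η

lemma conv_comm (U V : ℝ → ℂ) : conv U V = conv V U := by
  ext ξ
  unfold conv
  rw [← integral_sub_left_eq_self _ volume ξ]
  simp [mul_comm]

lemma stronglyMeasurable_conv {U V : ℝ → ℂ} (hU : Measurable U) (hV : Measurable V) :
    StronglyMeasurable (conv U V) := by
  unfold conv
  apply StronglyMeasurable.integral_prod_right'
    (f := fun p : ℝ × ℝ => U (p.1 - p.2) * V p.2)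
  exact Measurable.stronglyMeasurable (by fun_prop)

lemma enorm_conv_le (U V : ℝ → ℂ) (ξ : ℝ) :
    ‖conv U V ξ‖ₑ ≤ lconv (fun ξ => ‖U ξ‖ₑ) (fun ξ => ‖V ξ‖ₑ) ξ := by
  refine (enorm_integral_le_lintegral_enorm _).trans (le_of_eq ?_)
  simp [lconv]

lemma memLp_two_of_norm2 {F : ℝ → ℂ} (hF : AEStronglyMeasurable F volume)
    (h : norm2 (fun ξ => ‖F ξ‖ₑ) < ∞) : MemLp F 2 volume :=
  ⟨hF, by rwa [← norm2_eq_eLpNorm]⟩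

/-- Both sides are locally integrable and pair equally with smooth compactly supported functions:
the L² transform is compatible with that of tempered distributions, and the integral transform moves
across the pairing by Fubini. -/
lemma fourierInv_toLp {F : ℝ → ℂ} (h1 : Integrable F) (h2 : MemLp F 2 volume) :
    ((𝓕⁻ (h2.toLp F : L2) : L2) : ℝ → ℂ) =ᵐ[volume] 𝓕⁻ F := by
  have hcont : Continuous (𝓕⁻ F) := by
    simpa using! VectorFourier.fourierIntegral_continuous (L := -innerₗ ℝ)
      Real.continuous_fourierChar (by simpa using! continuous_inner.neg) h1
  apply ae_eq_of_integral_contDiff_smul_eq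
  · exact (Lp.memLp _).locallyIntegrable (by norm_num)
  · exact hcont.locallyIntegrable
  · intro g hg hc
    have hg1 : HasCompactSupport fun x => (g x : ℂ) := hc.comp_left (g := fun r : ℝ => (r : ℂ)) rfl
    have hg2 : ContDiff ℝ ((⊤ : ℕ∞) : WithTop ℕ∞) fun x => (g x : ℂ) := Complex.ofRealCLM.contDiff.comp hg
    set φ := hg1.toSchwartzMap hg2 with hφ
    have hφa : ∀ x, φ x = g x := fun x => rfl
    have e := congrArg (fun T => T φ) (Lp.fourierInv_toTemperedDistribution_eq (h2.toLp F))
    simp only [TemperedDistribution.fourierInv_apply, Lp.toTemperedDistribution_apply] at e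
    have e2 : ∫ x, 𝓕⁻ φ x • F x = ∫ x, φ x • 𝓕⁻ F x := by
      have := VectorFourier.integral_fourierIntegral_smul_eq_flip (L := -innerₗ ℝ)
        Real.continuous_fourierChar (by simpa using! continuous_inner.neg)
        (φ.integrable (μ := volume)) h1
      simpa [Real.fourierInv_eq, VectorFourier.fourierIntegral, SchwartzMap.fourierInv_coe,
        mul_comm] using this
    have e3 : ∫ x, 𝓕⁻ φ x • (h2.toLp F : L2) x = ∫ x, 𝓕⁻ φ x • F x := by
      apply integral_congr_ae
      filter_upwards [h2.coeFn_toLp] with x hx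
      rw [hx]
    rw [e3, e2] at e
    simp only [hφa] at e
    simpa using e.symm

lemma integrable_conv {F G : ℝ → ℂ} (hF : Integrable F) (hG : Integrable G) :
    Integrable (conv F G) := by
  have := hG.integrable_convolution (ContinuousLinearMap.mul ℂ ℂ) hF
  refine this.congr (Eventually.of_forall fun x => ?_)
  simp [MeasureTheory.convolution, conv, mul_comm]

lemma fourierInv_conv {F G : ℝ → ℂ} (hF : Integrable F) (hG : Integrable G) (x : ℝ) :
    𝓕⁻ (conv F G) x = 𝓕⁻ F x * 𝓕⁻ G x := by
  have h := Real.fourier_mul_convolution_eq hG hF (-x)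
  have e : conv F G = MeasureTheory.convolution G F (ContinuousLinearMap.mul ℂ ℂ) := by
    ext y
    simp [MeasureTheory.convolution, conv, mul_comm]
  simp only [Real.fourierInv_eq_fourier_neg]
  rw [mul_comm, ← h, e]

/-- The symmetry of the Fourier transforms of real functions. -/
def Herm (U : ℝ → ℂ) : Prop := ∀ᵐ ξ, U (-ξ) = conj (U ξ)

lemma ae_neg {P : ℝ → Prop} (h : ∀ᵐ ξ : ℝ, P ξ) : ∀ᵐ ξ : ℝ, P (-ξ) :=
  (Measure.measurePreserving_neg (volume : Measure ℝ)).quasiMeasurePreserving.ae h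

lemma memLp_conj_neg {F : ℝ → ℂ} {p : ℝ≥0∞} (h : MemLp F p volume) :
    MemLp (fun ξ => conj (F (-ξ))) p volume := by
  have h1 := h.comp_measurePreserving (Measure.measurePreserving_neg (volume : Measure ℝ))
  exact h1.star

lemma fourierInv_conj_neg (F : ℝ → ℂ) (x : ℝ) :
    𝓕⁻ (fun ξ => conj (F (-ξ))) x = conj (𝓕⁻ F x) := by
  rw [Real.fourierInv_eq', Real.fourierInv_eq', ← integral_conj, ← integral_neg_eq_self]
  congr 1
  ext ξ
  simp [← Complex.exp_conj, Complex.conj_ofNat]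

/-- Conjugation of `f` corresponds to `ξ ↦ conj (U (-ξ))` on the Fourier side, and a function is
real exactly when it equals its conjugate. Integrability of the transform gives access to the
pointwise inversion formula. -/
lemma im_eq_zero_iff_herm (f : L2) (h1 : Integrable (𝓕 f : L2)) :
    (∀ᵐ x : ℝ, (f x).im = 0) ↔ Herm (𝓕 f : L2) := by
  set U : L2 := 𝓕 f with hU
  have hf : f = 𝓕⁻ U := by rw [hU, FourierTransform.fourierInv_fourier_eq]
  have h2 : MemLp U 2 volume := Lp.memLp U
  have hfx : (f : ℝ → ℂ) =ᵐ[volume] 𝓕⁻ (U : ℝ → ℂ) := by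
    have := fourierInv_toLp h1 h2
    rw [Lp.toLp_coeFn] at this
    rwa [hf]
  have h1' : Integrable fun ξ => conj (U (-ξ)) := by
    rw [← memLp_one_iff_integrable] at h1 ⊢
    exact memLp_conj_neg h1
  have h2' := memLp_conj_neg h2
  have hS := fourierInv_toLp h1' h2'
  have hSf : ((𝓕⁻ (h2'.toLp _ : L2) : L2) : ℝ → ℂ) =ᵐ[volume] fun x => conj (f x) := by
    filter_upwards [hS, hfx] with x hx hx2
    rw [hx, hx2, fourierInv_conj_neg]
  have key : (∀ᵐ x : ℝ, (f x).im = 0) ↔ (𝓕⁻ (h2'.toLp _ : L2) : L2) = f := by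
    constructor
    · intro h
      apply Lp.ext
      filter_upwards [hSf, h] with x hx hx2
      rw [hx, Complex.conj_eq_iff_im.2 hx2]
    · intro h
      rw [h] at hSf
      filter_upwards [hSf] with x hx
      exact Complex.conj_eq_iff_im.1 hx.symm
  rw [key]
  constructor
  · intro h
    have : (h2'.toLp _ : L2) = U := by
      calc (h2'.toLp _ : L2) = 𝓕 (𝓕⁻ (h2'.toLp _ : L2) : L2) :=
            (FourierTransform.fourier_fourierInv_eq _).symm
        _ = U := by rw [h]
    have h3 := h2'.coeFn_toLp
    rw [this] at h3
    have h4 := ae_neg h3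
    filter_upwards [h4] with ξ hξ
    rw [hξ, neg_neg]
  · intro h
    have : (h2'.toLp _ : L2) = U := by
      apply Lp.ext
      filter_upwards [h2'.coeFn_toLp, ae_neg h] with ξ h3 h4
      rw [h3, ← h4, neg_neg]
    rw [this, ← hf]

end

/-! ### Weighted norms and the nonlinearity on the Fourier side -/

noncomputable section

/-- The weighted `L²` norm `‖ω U‖`. -/
def wnorm (ω : ℝ → ℝ) (U : ℝ → ℂ) : ℝ≥0∞ := norm2 fun ξ => ENNReal.ofReal (ω ξ) * ‖U ξ‖ₑ

/-- The weighted `L¹` norm `∫ ω |U|`. -/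
def lnorm (ω : ℝ → ℝ) (U : ℝ → ℂ) : ℝ≥0∞ := ∫⁻ ξ, ENNReal.ofReal (ω ξ) * ‖U ξ‖ₑ

/-- The weight of the Sobolev space `H^s`. -/
def bw (s : ℝ) (ξ : ℝ) : ℝ := bracket ξ ^ s

lemma measurable_bw (s : ℝ) : Measurable (bw s) := measurable_bracket_rpow s

lemma bw_pos (s ξ : ℝ) : 0 < bw s ξ := bracket_rpow_pos ξ s

lemma bw_mono {s t : ℝ} (h : s ≤ t) (ξ : ℝ) : bw s ξ ≤ bw t ξ := bracket_rpow_le ξ h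

lemma one_le_bw {s : ℝ} (hs : 0 ≤ s) (ξ : ℝ) : 1 ≤ bw s ξ := one_le_bracket_rpow ξ hs

lemma bw_add (s t ξ : ℝ) : bw (s + t) ξ = bw s ξ * bw t ξ := Real.rpow_add (bracket_pos ξ) s t

lemma bw_one : bw 1 = bracket := by ext ξ; simp [bw]

lemma isWeight_bw {m : ℕ} {s : ℝ} (hs : 0 ≤ s) (hm : s ≤ m) : IsWeight m (bw s) :=
  IsWeight.bracket_rpow hs hm

lemma sobolevNorm_eq (s : ℝ) (f : L2) : sobolevNorm s f = wnorm (bw s) (𝓕 f : L2) := by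
  unfold sobolevNorm wnorm
  rw [← norm2_eq_eLpNorm]
  congr 1
  ext ξ
  rw [enorm_mul]
  congr 1
  change ‖((bw s ξ : ℝ) : ℂ)‖ₑ = _
  rw [← ofReal_norm, Complex.norm_real, Real.norm_of_nonneg (bw_pos s ξ).le]

section wnorm

variable {ω ω' : ℝ → ℝ}

lemma wnorm_congr {U V : ℝ → ℂ} (h : U =ᵐ[volume] V) : wnorm ω U = wnorm ω V := by
  apply le_antisymm
  · exact norm2_mono_ae (h.mono fun ξ hξ => by rw [hξ])
  · exact norm2_mono_ae (h.mono fun ξ hξ => by rw [hξ])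

lemma wnorm_mono (h : ∀ ξ, ω ξ ≤ ω' ξ) (U : ℝ → ℂ) : wnorm ω U ≤ wnorm ω' U :=
  norm2_mono fun ξ => by gcongr; exact h ξ

lemma wnorm_le_of_enorm_le {U V : ℝ → ℂ} (h : ∀ ξ, ‖U ξ‖ₑ ≤ ‖V ξ‖ₑ) : wnorm ω U ≤ wnorm ω V :=
  norm2_mono fun ξ => by gcongr; exact h ξ

lemma wnorm_neg (U : L2) : wnorm ω (-U : L2) = wnorm ω U := by
  rw [wnorm_congr (Lp.coeFn_neg U)]
  simp [wnorm]

lemma wnorm_add_le (hω : Measurable ω) (U V : L2) :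
    wnorm ω (U + V : L2) ≤ wnorm ω U + wnorm ω V := by
  have hU := (Lp.stronglyMeasurable U).measurable
  have hV := (Lp.stronglyMeasurable V).measurable
  rw [wnorm_congr (Lp.coeFn_add U V)]
  refine le_trans ?_ (norm2_add_le (by fun_prop) (by fun_prop))
  refine norm2_mono fun ξ => ?_
  rw [← mul_add]
  gcongr
  exact enorm_add_le _ _

lemma wnorm_sub_le (hω : Measurable ω) (U V : L2) :
    wnorm ω (U - V : L2) ≤ wnorm ω U + wnorm ω V := by
  rw [sub_eq_add_neg, ← wnorm_neg V]
  exact wnorm_add_le hω U (-V)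

lemma wnorm_one (U : L2) : wnorm (fun _ => 1) U = ‖U‖ₑ := by
  rw [Lp.enorm_def, ← norm2_eq_eLpNorm]
  simp [wnorm]

lemma enorm_le_wnorm_bw {s : ℝ} (hs : 0 ≤ s) (U : L2) : ‖U‖ₑ ≤ wnorm (bw s) U := by
  rw [← wnorm_one]
  exact wnorm_mono (one_le_bw hs) U

lemma wnorm_const (c : ℝ) (U : L2) :
    wnorm (fun _ => c) U = ENNReal.ofReal c * ‖U‖ₑ := by
  have hU := (Lp.stronglyMeasurable U).measurable
  rw [← wnorm_one, wnorm, norm2_const_mul (by fun_prop)]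
  simp [wnorm]

lemma wnorm_bw_mono {s t : ℝ} (h : s ≤ t) (U : ℝ → ℂ) : wnorm (bw s) U ≤ wnorm (bw t) U :=
  wnorm_mono (bw_mono h) U

end wnorm

/-- The constant of the embedding of a weighted `L²` space into a weighted `L¹` space. -/
def embConst (d : ℝ) : ℝ≥0∞ := norm2 fun ξ => ENNReal.ofReal (bw (-d) ξ)

lemma embConst_lt_top {d : ℝ} (hd : 1 / 2 < d) : embConst d < ∞ := by
  unfold embConst norm2
  apply ENNReal.rpow_lt_top_of_nonneg (by norm_num)
  have h1 := integrable_rpow_neg_one_add_norm_sq (E := ℝ) (μ := volume) (r := 2 * d)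
    (by simp; linarith)
  have h2 := h1.comp_mul_left' (R := 2 * Real.pi) (by positivity)
  have h3 := h2.lintegral_lt_top
  refine (lt_of_le_of_lt (le_of_eq ?_) h3).ne
  refine lintegral_congr fun ξ => ?_
  rw [ENNReal.ofReal_rpow_of_nonneg (bw_pos _ _).le (by norm_num)]
  congr 1
  simp only [bw, bracket, japanese, Real.norm_eq_abs, sq_abs]
  rw [Real.sqrt_eq_rpow, ← Real.rpow_mul (by positivity), ← Real.rpow_mul (by positivity)]
  congr 1
  ring

/-- Cauchy–Schwarz against `bracket ^ (a - b)`. No condition on the exponents is needed because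
`embConst` may be infinite; it is finite once `b - a > 1 / 2`. -/
lemma lnorm_bw_le (a b : ℝ) {U : ℝ → ℂ} (hU : Measurable U) :
    lnorm (bw a) U ≤ embConst (b - a) * wnorm (bw b) U := by
  have hb := measurable_bw b
  have hd := measurable_bw (-(b - a))
  refine le_trans (le_of_eq ?_) (lintegral_mul_le_norm2 (f := fun ξ =>
    ENNReal.ofReal (bw (-(b - a)) ξ)) (g := fun ξ => ENNReal.ofReal (bw b ξ) * ‖U ξ‖ₑ)
    (by fun_prop) (by fun_prop))
  refine lintegral_congr fun ξ => ?_
  rw [← mul_assoc, ← ENNReal.ofReal_mul (bw_pos _ _).le, ← bw_add]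
  ring_nf

/-- The Fourier side of the derivative. -/
def dfun (U : ℝ → ℂ) (ξ : ℝ) : ℂ := Complex.I * ((2 * Real.pi * ξ : ℝ) : ℂ) * U ξ

lemma measurable_dfun {U : ℝ → ℂ} (hU : Measurable U) : Measurable (dfun U) := by
  unfold dfun; fun_prop

lemma enorm_dfun (U : ℝ → ℂ) (ξ : ℝ) :
    ‖dfun U ξ‖ₑ = ENNReal.ofReal |2 * Real.pi * ξ| * ‖U ξ‖ₑ := by
  unfold dfun
  rw [enorm_mul, enorm_mul, ← ofReal_norm (Complex.I), Complex.norm_I, ← ofReal_norm (Complex.ofReal _),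
    Complex.norm_real]
  simp

lemma enorm_dfun_le (U : ℝ → ℂ) (ξ : ℝ) :
    ‖dfun U ξ‖ₑ ≤ ENNReal.ofReal (bw 1 ξ) * ‖U ξ‖ₑ := by
  rw [enorm_dfun, bw_one]
  gcongr
  exact abs_le_bracket ξ

lemma wnorm_dfun_le {ω : ℝ → ℝ} (h0 : ∀ ξ, 0 ≤ ω ξ) (U : ℝ → ℂ) :
    wnorm ω (dfun U) ≤ wnorm (fun ξ => ω ξ * bw 1 ξ) U := by
  refine norm2_mono fun ξ => ?_
  rw [ENNReal.ofReal_mul (h0 ξ), mul_assoc]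
  gcongr
  exact enorm_dfun_le U ξ

lemma lintegral_enorm_dfun_le (U : ℝ → ℂ) : ∫⁻ ξ, ‖dfun U ξ‖ₑ ≤ lnorm (bw 1) U :=
  lintegral_mono fun ξ => enorm_dfun_le U ξ

lemma lintegral_enorm_le (U : ℝ → ℂ) : ∫⁻ ξ, ‖U ξ‖ₑ ≤ lnorm (bw 1) U :=
  lintegral_mono fun ξ => le_mul_of_one_le_left' (by
    rw [← ENNReal.ofReal_one]; exact ENNReal.ofReal_le_ofReal (one_le_bw zero_le_one ξ))

/-- The Fourier side of `f ↦ f g_x`. -/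
def adv (U V : L2) : L2 := ofFun (conv U (dfun V))

lemma measurable_coe (U : L2) : Measurable (U : ℝ → ℂ) := (Lp.stronglyMeasurable U).measurable

lemma norm2_coe (U : L2) : norm2 (fun ξ => ‖U ξ‖ₑ) = ‖U‖ₑ := by
  rw [norm2_eq_eLpNorm, Lp.enorm_def]

lemma wnorm_conv_le {m : ℕ} {ω : ℝ → ℝ} (h : IsWeight m ω) {U V : ℝ → ℂ} (hU : Measurable U)
    (hV : Measurable V) : wnorm ω (conv U V) ≤
      2 ^ m * (wnorm ω U * (∫⁻ ξ, ‖V ξ‖ₑ) + (∫⁻ ξ, ‖U ξ‖ₑ) * wnorm ω V) := by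
  refine le_trans ?_ (h.norm2_mul_lconv_le hU.enorm hV.enorm)
  refine norm2_mono fun ξ => ?_
  gcongr
  exact enorm_conv_le U V ξ

lemma norm2_conv_le {U V : ℝ → ℂ} (hU : Measurable U) (hV : Measurable V) :
    norm2 (fun ξ => ‖conv U V ξ‖ₑ) ≤ (∫⁻ ξ, ‖U ξ‖ₑ) * norm2 (fun ξ => ‖V ξ‖ₑ) :=
  (norm2_mono fun ξ => enorm_conv_le U V ξ).trans (norm2_lconv_le hU.enorm hV.enorm)

lemma norm2_dfun_le (U : ℝ → ℂ) : norm2 (fun ξ => ‖dfun U ξ‖ₑ) ≤ wnorm (bw 1) U :=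
  norm2_mono fun ξ => enorm_dfun_le U ξ

/-- Membership in `H²`, on the Fourier side. -/
def IsH2 (U : ℝ → ℂ) : Prop := wnorm (bw 2) U < ∞

lemma IsH2.lnorm_lt_top {U : ℝ → ℂ} (hU : Measurable U) (h : IsH2 U) : lnorm (bw 1) U < ∞ := by
  refine (lnorm_bw_le 1 2 hU).trans_lt (ENNReal.mul_lt_top (embConst_lt_top (by norm_num)) h)

lemma IsH2.wnorm_one_lt_top {U : ℝ → ℂ} (h : IsH2 U) : wnorm (bw 1) U < ∞ :=
  (wnorm_bw_mono (by norm_num) U).trans_lt h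

lemma IsH2.sub {U V : L2} (hU : IsH2 U) (hV : IsH2 V) : IsH2 (U - V : L2) :=
  (wnorm_sub_le (measurable_bw 2) U V).trans_lt (ENNReal.add_lt_top.2 ⟨hU, hV⟩)

lemma IsH2.integrable {U : L2} (h : IsH2 U) : Integrable U :=
  ⟨(Lp.aestronglyMeasurable U), (lintegral_enorm_le U).trans_lt (h.lnorm_lt_top (measurable_coe U))⟩

lemma IsH2.integrable_dfun {U : L2} (h : IsH2 U) : Integrable (dfun U) :=
  ⟨(measurable_dfun (measurable_coe U)).aestronglyMeasurable,
    (lintegral_enorm_dfun_le U).trans_lt (h.lnorm_lt_top (measurable_coe U))⟩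

lemma IsH2.memLp_dfun {U : L2} (h : IsH2 U) : MemLp (dfun U) 2 volume :=
  memLp_two_of_norm2 (measurable_dfun (measurable_coe U)).aestronglyMeasurable
    ((norm2_dfun_le U).trans_lt h.wnorm_one_lt_top)

lemma memLp_conv_dfun {U V : L2} (hU : IsH2 U) (hV : IsH2 V) :
    MemLp (conv U (dfun V)) 2 volume := by
  have mU := measurable_coe U
  have mV := measurable_dfun (measurable_coe V)
  refine memLp_two_of_norm2 (stronglyMeasurable_conv mU mV).aestronglyMeasurable ?_
  refine (norm2_conv_le mU mV).trans_lt (ENNReal.mul_lt_top ?_ ?_)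
  · exact (lintegral_enorm_le U).trans_lt (hU.lnorm_lt_top mU)
  · exact (norm2_dfun_le V).trans_lt hV.wnorm_one_lt_top

lemma adv_coe {U V : L2} (hU : IsH2 U) (hV : IsH2 V) :
    (adv U V : ℝ → ℂ) =ᵐ[volume] conv U (dfun V) := ofFun_coe (memLp_conv_dfun hU hV)

lemma wnorm_adv_le {m : ℕ} {ω : ℝ → ℝ} (h : IsWeight m ω) {U V : L2} (hU : IsH2 U)
    (hV : IsH2 V) : wnorm ω (adv U V) ≤ 2 ^ m * (wnorm ω U * lnorm (bw 1) V +
      lnorm (bw 1) U * wnorm (fun ξ => ω ξ * bw 1 ξ) V) := by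
  rw [wnorm_congr (adv_coe hU hV)]
  refine (wnorm_conv_le h (measurable_coe U) (measurable_dfun (measurable_coe V))).trans ?_
  gcongr
  · exact lintegral_enorm_dfun_le V
  · exact lintegral_enorm_le U
  · exact wnorm_dfun_le h.nonneg V

/-- Young's inequality with the derivative of `V` in L². In `enorm_adv_le_right` the derivative sits
in L¹ instead, so that only the L² norm of `U` enters. -/
lemma enorm_adv_le_left {U V : L2} (hU : IsH2 U) (hV : IsH2 V) :
    ‖adv U V‖ₑ ≤ lnorm (bw 1) U * wnorm (bw 1) V := by
  rw [← wnorm_one, wnorm_congr (adv_coe hU hV)]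
  simp only [wnorm, ENNReal.ofReal_one, one_mul]
  refine (norm2_conv_le (measurable_coe U) (measurable_dfun (measurable_coe V))).trans ?_
  gcongr
  · exact lintegral_enorm_le U
  · exact norm2_dfun_le V

lemma enorm_adv_le_right {U V : L2} (hU : IsH2 U) (hV : IsH2 V) :
    ‖adv U V‖ₑ ≤ lnorm (bw 1) V * ‖U‖ₑ := by
  rw [← wnorm_one, wnorm_congr (adv_coe hU hV), ← norm2_coe]
  simp only [wnorm, ENNReal.ofReal_one, one_mul]
  rw [conv_comm]
  refine (norm2_conv_le (measurable_dfun (measurable_coe V)) (measurable_coe U)).trans ?_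
  gcongr
  exact lintegral_enorm_dfun_le V

lemma integrable_conv_integrand {U V : ℝ → ℂ} (hU : MemLp U 2 volume) (hV : MemLp V 2 volume)
    (ξ : ℝ) : Integrable fun η => U (ξ - η) * V η := by
  have h1 : MemLp (fun η => U (ξ - η)) 2 volume :=
    hU.comp_measurePreserving (Measure.measurePreserving_sub_left volume ξ)
  exact h1.integrable_mul hV

lemma conv_congr_left {U U' : ℝ → ℂ} (h : U =ᵐ[volume] U') (V : ℝ → ℂ) :
    conv U V = conv U' V := by
  ext ξ
  refine integral_congr_ae ?_
  have := (Measure.measurePreserving_sub_left (volume : Measure ℝ) ξ).quasiMeasurePreserving.ae h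
  filter_upwards [this] with η hη
  rw [hη]

lemma conv_congr_right (U : ℝ → ℂ) {V V' : ℝ → ℂ} (h : V =ᵐ[volume] V') :
    conv U V = conv U V' := by
  rw [conv_comm, conv_congr_left h, conv_comm]

lemma adv_sub_left {U U' V : L2} (hU : IsH2 U) (hU' : IsH2 U') (hV : IsH2 V) :
    adv (U - U') V = adv U V - adv U' V := by
  apply Lp.ext
  filter_upwards [adv_coe (hU.sub hU') hV, adv_coe hU hV, adv_coe hU' hV,
    Lp.coeFn_sub (adv U V) (adv U' V)] with ξ h1 h2 h3 h4
  rw [h1, h4, Pi.sub_apply, h2, h3, conv_congr_left (Lp.coeFn_sub U U')]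
  unfold conv
  rw [← integral_sub (integrable_conv_integrand (Lp.memLp U) hV.memLp_dfun ξ)
    (integrable_conv_integrand (Lp.memLp U') hV.memLp_dfun ξ)]
  simp [sub_mul]

lemma adv_sub_right {U V V' : L2} (hU : IsH2 U) (hV : IsH2 V) (hV' : IsH2 V') :
    adv U (V - V') = adv U V - adv U V' := by
  apply Lp.ext
  filter_upwards [adv_coe hU (hV.sub hV'), adv_coe hU hV, adv_coe hU hV',
    Lp.coeFn_sub (adv U V) (adv U V')] with ξ h1 h2 h3 h4
  have h5 : dfun (V - V' : L2) =ᵐ[volume] fun ξ => dfun V ξ - dfun V' ξ := by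
    filter_upwards [Lp.coeFn_sub V V'] with ξ hξ
    simp only [dfun, hξ, Pi.sub_apply, mul_sub]
  rw [h1, h4, Pi.sub_apply, h2, h3, conv_congr_right _ h5]
  unfold conv
  rw [← integral_sub (integrable_conv_integrand (Lp.memLp U) hV.memLp_dfun ξ)
    (integrable_conv_integrand (Lp.memLp U) hV'.memLp_dfun ξ)]
  simp [mul_sub]

/-- The splitting used in all difference estimates: in the first term the difference is transported
by `U`, which costs no derivative in the energy; in the second only `V` is differentiated. -/
lemma adv_self_sub {U V : L2} (hU : IsH2 U) (hV : IsH2 V) :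
    adv U U - adv V V = adv U (U - V) + adv (U - V) V := by
  rw [adv_sub_left hU hV hV, adv_sub_right hU hU hV]
  abel

lemma fourier_derivX {f : L2} (h : IsH2 (𝓕 f : L2)) :
    (𝓕 (derivX f) : L2) = h.memLp_dfun.toLp _ := by
  unfold derivX
  rw [fourier_fourierMultiplier]
  refine (dif_pos h.memLp_dfun).trans rfl

/-- The nonlinearity on the Fourier side. -/
lemma fourier_advection {f : L2} (h : IsH2 (𝓕 f : L2)) :
    𝓕 (advection f) = adv (𝓕 f) (𝓕 f) := by
  set U : L2 := 𝓕 f with hU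
  have hf : f = 𝓕⁻ U := by rw [hU, FourierTransform.fourierInv_fourier_eq]
  have h2 : MemLp U 2 volume := Lp.memLp U
  have hfx : (f : ℝ → ℂ) =ᵐ[volume] 𝓕⁻ (U : ℝ → ℂ) := by
    have := fourierInv_toLp h.integrable h2
    rw [Lp.toLp_coeFn] at this
    rwa [hf]
  have hdx : (derivX f : ℝ → ℂ) =ᵐ[volume] 𝓕⁻ (dfun U) := by
    have := fourierInv_toLp h.integrable_dfun h.memLp_dfun
    rwa [← fourier_derivX h, FourierTransform.fourierInv_fourier_eq] at this
  have hc := memLp_conv_dfun h h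
  have hprod : (fun x => f x * derivX f x) =ᵐ[volume] ((𝓕⁻ (adv U U) : L2) : ℝ → ℂ) := by
    have h3 := fourierInv_toLp (integrable_conv h.integrable h.integrable_dfun) hc
    have h4 : adv U U = hc.toLp _ := dif_pos hc
    rw [h4]
    filter_upwards [h3, hfx, hdx] with x hx hx1 hx2
    rw [hx, hx1, hx2, fourierInv_conv h.integrable h.integrable_dfun]
  have hm : MemLp (fun x => f x * derivX f x) 2 volume :=
    (memLp_congr_ae hprod).2 (Lp.memLp _)
  have : advection f = 𝓕⁻ (adv U U) := (ofFun_eq_iff hm _).2 hprod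
  rw [this, FourierTransform.fourier_fourierInv_eq]

end

/-! ### The energy estimate for a transport term -/

noncomputable section

lemma Herm.ae_prod {V : ℝ → ℂ} (hV : Herm V) :
    ∀ᵐ p : ℝ × ℝ ∂(volume.prod volume), V (p.2 - p.1) = conj (V (p.1 - p.2)) := by
  have := (quasiMeasurePreserving_sub (volume : Measure ℝ) (volume : Measure ℝ)).ae hV
  filter_upwards [this] with p hp
  rw [← hp, neg_sub]

/-- The trilinear bounds behind the energy estimate. -/
lemma lintegral_trilinear_le {f g h : ℝ → ℝ≥0∞} (hf : Measurable f) (hg : Measurable g)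
    (hh : Measurable h) :
    ∫⁻ ξ, f ξ * lconv g h ξ ≤ norm2 f * ((∫⁻ ξ, g ξ) * norm2 h) :=
  (lintegral_mul_le_norm2 hf (measurable_lconv hg hh)).trans (by
    gcongr; exact norm2_lconv_le hg hh)

lemma lintegral_trilinear_le' {f g h : ℝ → ℝ≥0∞} (hf : Measurable f) (hg : Measurable g)
    (hh : Measurable h) :
    ∫⁻ ξ, f ξ * lconv g h ξ ≤ (∫⁻ ξ, f ξ) * (norm2 g * norm2 h) := by
  rw [← lintegral_mul_const _ hf]
  refine lintegral_mono fun ξ => ?_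
  gcongr
  exact lconv_le_norm2 hg hh ξ

/-- The integrand of the quadratic form `⟨ω² U, V U_x⟩`. -/
def energyKernel (ω : ℝ → ℝ) (U V : ℝ → ℂ) (p : ℝ × ℝ) : ℂ :=
  ((ω p.1 ^ 2 : ℝ) : ℂ) * conj (U p.1) * (V (p.1 - p.2) * dfun U p.2)

lemma measurable_energyKernel {ω : ℝ → ℝ} {U V : ℝ → ℂ} (hω : Measurable ω) (hU : Measurable U)
    (hV : Measurable V) : Measurable (energyKernel ω U V) := by
  have := measurable_dfun hU
  have h2 : Measurable fun p : ℝ × ℝ => conj (U p.1) :=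
    Complex.continuous_conj.measurable.comp (hU.comp measurable_fst)
  unfold energyKernel
  fun_prop

lemma lintegral_prod_lconv {f g h : ℝ → ℝ≥0∞} (hf : Measurable f) (hg : Measurable g)
    (hh : Measurable h) : ∫⁻ p : ℝ × ℝ, f p.1 * (g (p.1 - p.2) * h p.2) ∂(volume.prod volume)
      = ∫⁻ ξ, f ξ * lconv g h ξ := by
  rw [lintegral_prod _ (by fun_prop)]
  refine lintegral_congr fun ξ => ?_
  rw [lconv, ← lintegral_const_mul _ (by fun_prop)]

lemma integrable_energyKernel {ω : ℝ → ℝ} {c : ℝ} (hω : Measurable ω) (h0 : ∀ ξ, 0 ≤ ω ξ)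
    (hc : ∀ ξ, ω ξ ≤ c) {U V : L2} (hU : IsH2 U) :
    Integrable (energyKernel ω U V) (volume.prod volume) := by
  have mU := measurable_coe U
  have mV := measurable_coe V
  have mdU := measurable_dfun mU
  refine ⟨(measurable_energyKernel hω mU mV).aestronglyMeasurable, ?_⟩
  have hle : ∀ p : ℝ × ℝ, ‖energyKernel ω U V p‖ₑ ≤
      ENNReal.ofReal (c ^ 2) * ‖U p.1‖ₑ * (‖V (p.1 - p.2)‖ₑ * ‖dfun U p.2‖ₑ) := by
    intro p
    unfold energyKernel
    rw [enorm_mul, enorm_mul, enorm_mul, ← ofReal_norm (Complex.ofReal _), Complex.norm_real,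
      RCLike.enorm_conj]
    gcongr
    rw [Real.norm_of_nonneg (by positivity)]
    exact pow_le_pow_left₀ (h0 _) (hc _) 2
  refine (lintegral_mono hle).trans_lt ?_
  rw [lintegral_prod_lconv (f := fun ξ => ENNReal.ofReal (c ^ 2) * ‖U ξ‖ₑ)
    (g := fun ξ => ‖V ξ‖ₑ) (h := fun ξ => ‖dfun U ξ‖ₑ) (by fun_prop) (by fun_prop) (by fun_prop)]
  refine (lintegral_trilinear_le' (by fun_prop) (by fun_prop) (by fun_prop)).trans_lt ?_
  rw [lintegral_const_mul _ (by fun_prop)]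
  refine ENNReal.mul_lt_top (ENNReal.mul_lt_top ENNReal.ofReal_lt_top ?_) (ENNReal.mul_lt_top ?_ ?_)
  · exact hU.integrable.2
  · rw [norm2_eq_eLpNorm]; exact Lp.eLpNorm_lt_top V
  · exact (norm2_dfun_le U).trans_lt hU.wnorm_one_lt_top

/-- Integration by parts on the Fourier side. Reality of `V` makes the kernel and its conjugated
reflection share the factor `conj (U ξ) V(ξ-η) U η`, so only the difference `η ω(ξ)² - ξ ω(η)²`
survives, in which the loss of a derivative cancels. -/
lemma energyKernel_add_swap {ω : ℝ → ℝ} {U V : ℝ → ℂ} (p : ℝ × ℝ)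
    (hp : V (p.2 - p.1) = conj (V (p.1 - p.2))) :
    energyKernel ω U V p + conj (energyKernel ω U V p.swap) =
      conj (U p.1) * V (p.1 - p.2) * U p.2 *
        (Complex.I * ((2 * Real.pi * (p.2 * ω p.1 ^ 2 - p.1 * ω p.2 ^ 2) : ℝ) : ℂ)) := by
  simp only [energyKernel, dfun, Prod.fst_swap, Prod.snd_swap, hp]
  simp only [map_mul, Complex.conj_conj, Complex.conj_I, Complex.conj_ofReal]
  push_cast
  ring

/-- The bound on the symmetrised symbol of `⟨ω² U, V U_x⟩`. -/
def SymbolBound (C C' : ℝ) (ω : ℝ → ℝ) : Prop := ∀ ξ η : ℝ,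
  |η * ω ξ ^ 2 - ξ * ω η ^ 2| ≤ C * (|ξ - η| * (ω ξ * ω η)) +
    C' * (|η| * (ω ξ * ω (ξ - η)) + |ξ| * (ω η * ω (ξ - η)))

lemma IsWeight.symbolBound {m : ℕ} {ω : ℝ → ℝ} (h : IsWeight m ω) :
    SymbolBound (energyConst m) (energyConst m) ω := fun ξ η =>
  (h.symbol_le ξ η).trans (le_of_eq (by ring))

/-- For the L² energy the symbol is `η - ξ` itself. The vanishing second constant means that only
the derivative of the transporting function enters. -/
lemma symbolBound_one : SymbolBound 1 0 fun _ => 1 := fun ξ η => by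
  simp [abs_sub_comm]

lemma enorm_energyKernel_add_swap_le {ω : ℝ → ℝ} {C C' : ℝ} (h0 : ∀ ξ, 0 ≤ ω ξ) (hC : 0 ≤ C)
    (hC' : 0 ≤ C') (h : SymbolBound C C' ω) {U V : ℝ → ℂ}
    (p : ℝ × ℝ) (hp : V (p.2 - p.1) = conj (V (p.1 - p.2))) :
    ‖energyKernel ω U V p + conj (energyKernel ω U V p.swap)‖ₑ ≤
      ENNReal.ofReal C *
      (ENNReal.ofReal (ω p.1) * ‖U p.1‖ₑ * (‖dfun V (p.1 - p.2)‖ₑ *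
          (ENNReal.ofReal (ω p.2) * ‖U p.2‖ₑ))) + ENNReal.ofReal C' *
        (ENNReal.ofReal (ω p.1) * ‖U p.1‖ₑ * (ENNReal.ofReal (ω (p.1 - p.2)) * ‖V (p.1 - p.2)‖ₑ *
          ‖dfun U p.2‖ₑ) +
        ‖dfun U p.1‖ₑ * (ENNReal.ofReal (ω (p.1 - p.2)) * ‖V (p.1 - p.2)‖ₑ *
          (ENNReal.ofReal (ω p.2) * ‖U p.2‖ₑ))) := by
  rw [energyKernel_add_swap p hp]
  obtain ⟨ξ, η⟩ := p
  simp only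
  have hx := h0 ξ
  have he := h0 η
  have hr := h0 (ξ - η)
  have hs := h ξ η
  have hpi : 0 ≤ 2 * Real.pi := by positivity
  have h1 : |2 * Real.pi * (η * ω ξ ^ 2 - ξ * ω η ^ 2)| ≤
      C * (|2 * Real.pi * (ξ - η)| * (ω ξ * ω η)) + C' * (|2 * Real.pi * η| * (ω ξ * ω (ξ - η)) +
        |2 * Real.pi * ξ| * (ω η * ω (ξ - η))) := by
    rw [abs_mul (2 * Real.pi), abs_mul (2 * Real.pi) (ξ - η), abs_mul (2 * Real.pi) η,
      abs_mul (2 * Real.pi) ξ, abs_of_nonneg hpi]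
    calc _ ≤ _ := mul_le_mul_of_nonneg_left hs hpi
      _ = _ := by ring
  have e : ‖Complex.I * ((2 * Real.pi * (η * ω ξ ^ 2 - ξ * ω η ^ 2) : ℝ) : ℂ)‖ₑ ≤
      ENNReal.ofReal C *
      (ENNReal.ofReal |2 * Real.pi * (ξ - η)| * (ENNReal.ofReal (ω ξ) * ENNReal.ofReal (ω η))) +
        ENNReal.ofReal C' * (ENNReal.ofReal |2 * Real.pi * η| * (ENNReal.ofReal (ω ξ) * ENNReal.ofReal (ω (ξ - η))) +
        ENNReal.ofReal |2 * Real.pi * ξ| *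
          (ENNReal.ofReal (ω η) * ENNReal.ofReal (ω (ξ - η)))) := by
    rw [← ofReal_norm, norm_mul, Complex.norm_I, one_mul, Complex.norm_real, Real.norm_eq_abs]
    refine (ENNReal.ofReal_le_ofReal h1).trans (le_of_eq ?_)
    rw [ENNReal.ofReal_add (by positivity) (by positivity), ENNReal.ofReal_mul hC,
      ENNReal.ofReal_mul hC', ENNReal.ofReal_add (by positivity) (by positivity),
      ENNReal.ofReal_mul (abs_nonneg _), ENNReal.ofReal_mul (abs_nonneg _),
      ENNReal.ofReal_mul (abs_nonneg _), ENNReal.ofReal_mul hx, ENNReal.ofReal_mul hx,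
      ENNReal.ofReal_mul he]
  rw [enorm_mul, enorm_mul, enorm_mul, RCLike.enorm_conj, enorm_dfun, enorm_dfun, enorm_dfun]
  calc _ ≤ ‖U ξ‖ₑ * ‖V (ξ - η)‖ₑ * ‖U η‖ₑ * _ := mul_le_mul' le_rfl e
    _ = _ := by ring

/-- The energy estimate for `V U_x` in a bounded weight. -/
lemma energy_le {ω : ℝ → ℝ} {c C C' : ℝ} (mω : Measurable ω) (h0 : ∀ ξ, 0 ≤ ω ξ) (hC : 0 ≤ C)
    (hC' : 0 ≤ C') (h : SymbolBound C C' ω) (hc : ∀ ξ, ω ξ ≤ c) {U V : L2}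
    (hU : IsH2 U) (hV : IsH2 V) (hV' : Herm V) :
    ENNReal.ofReal |2 * ∫ ξ, ω ξ ^ 2 * (conj (U ξ) * adv V U ξ).re| ≤
      ENNReal.ofReal C * (lnorm (bw 1) V * wnorm ω U ^ 2) +
        ENNReal.ofReal C' * (2 * (lnorm (bw 1) U * wnorm ω U * wnorm ω V)) := by
  have mU := measurable_coe U
  have mV := measurable_coe V
  have mdU := measurable_dfun mU
  have mdV := measurable_dfun mV
  set K := energyKernel ω U V with hK
  have hKi : Integrable K (volume.prod volume) := integrable_energyKernel mω h0 hc hU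
  have hKs : Integrable (fun p => conj (K p.swap)) (volume.prod volume) := by
    have h1 := hKi.swap
    exact h1.congr' (Complex.continuous_conj.comp_aestronglyMeasurable h1.1)
      (Eventually.of_forall fun p => (RCLike.norm_conj _).symm)
  have h1 : ∫ ξ, ω ξ ^ 2 * (conj (U ξ) * adv V U ξ).re = (∫ p, K p ∂(volume.prod volume)).re := by
    rw [integral_prod _ hKi]
    have h2 : (∫ ξ, ∫ η, K (ξ, η)).re = ∫ ξ, (∫ η, K (ξ, η)).re := by
      have := hKi.integral_prod_left
      exact (integral_re this).symm
    rw [h2]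
    refine integral_congr_ae ?_
    filter_upwards [adv_coe hV hU] with ξ hξ
    rw [hξ]
    simp only [hK, energyKernel]
    rw [integral_const_mul]
    rw [mul_assoc, Complex.re_ofReal_mul]
    rfl
  have h2 : 2 * (∫ p, K p ∂(volume.prod volume)).re
      = (∫ p, (K p + conj (K p.swap)) ∂(volume.prod volume)).re := by
    rw [integral_add hKi hKs, integral_conj, integral_prod_swap, Complex.add_re, Complex.conj_re]
    ring
  rw [h1, h2]
  calc ENNReal.ofReal |(∫ p, (K p + conj (K p.swap)) ∂(volume.prod volume)).re|
      ≤ ‖∫ p, (K p + conj (K p.swap)) ∂(volume.prod volume)‖ₑ := by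
        rw [← ofReal_norm]
        exact ENNReal.ofReal_le_ofReal (Complex.abs_re_le_norm _)
    _ ≤ ∫⁻ p, ‖K p + conj (K p.swap)‖ₑ ∂(volume.prod volume) := enorm_integral_le_lintegral_enorm _
    _ ≤ _ := lintegral_mono_ae (hV'.ae_prod.mono fun p hp => 
        enorm_energyKernel_add_swap_le h0 hC hC' h p hp)
    _ ≤ _ := by
        rw [lintegral_add_left (by fun_prop), lintegral_const_mul _ (by fun_prop),
          lintegral_const_mul _ (by fun_prop), lintegral_add_left (by fun_prop)]
        rw [lintegral_prod_lconv (f := fun ξ => ENNReal.ofReal (ω ξ) * ‖U ξ‖ₑ)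
            (g := fun ξ => ‖dfun V ξ‖ₑ) (h := fun ξ => ENNReal.ofReal (ω ξ) * ‖U ξ‖ₑ)
            (by fun_prop) (by fun_prop) (by fun_prop),
          lintegral_prod_lconv (f := fun ξ => ENNReal.ofReal (ω ξ) * ‖U ξ‖ₑ)
            (g := fun ξ => ENNReal.ofReal (ω ξ) * ‖V ξ‖ₑ) (h := fun ξ => ‖dfun U ξ‖ₑ)
            (by fun_prop) (by fun_prop) (by fun_prop),
          lintegral_prod_lconv (f := fun ξ => ‖dfun U ξ‖ₑ)
            (g := fun ξ => ENNReal.ofReal (ω ξ) * ‖V ξ‖ₑ)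
            (h := fun ξ => ENNReal.ofReal (ω ξ) * ‖U ξ‖ₑ)
            (by fun_prop) (by fun_prop) (by fun_prop)]
        -- In each of the three terms the differentiated factor is placed in L¹: the derivative of
        -- `V` in the first, that of `U` in the other two.
        have b1 : ∫⁻ ξ, ENNReal.ofReal (ω ξ) * ‖U ξ‖ₑ * lconv (fun ξ => ‖dfun V ξ‖ₑ)
            (fun ξ => ENNReal.ofReal (ω ξ) * ‖U ξ‖ₑ) ξ ≤
            wnorm ω U * (lnorm (bw 1) V * wnorm ω U) := by
          refine (lintegral_trilinear_le (f := fun ξ => ENNReal.ofReal (ω ξ) * ‖U ξ‖ₑ)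
            (by fun_prop) (by fun_prop) (by fun_prop)).trans ?_
          refine mul_le_mul' le_rfl (mul_le_mul' (lintegral_enorm_dfun_le V) le_rfl)
        have b2 : ∫⁻ ξ, ENNReal.ofReal (ω ξ) * ‖U ξ‖ₑ *
            lconv (fun ξ => ENNReal.ofReal (ω ξ) * ‖V ξ‖ₑ) (fun ξ => ‖dfun U ξ‖ₑ) ξ ≤
            wnorm ω U * (lnorm (bw 1) U * wnorm ω V) := by
          rw [lconv_comm]
          refine (lintegral_trilinear_le (f := fun ξ => ENNReal.ofReal (ω ξ) * ‖U ξ‖ₑ)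
            (by fun_prop) (by fun_prop) (by fun_prop)).trans ?_
          refine mul_le_mul' le_rfl (mul_le_mul' (lintegral_enorm_dfun_le U) le_rfl)
        have b3 : ∫⁻ ξ, ‖dfun U ξ‖ₑ * lconv (fun ξ => ENNReal.ofReal (ω ξ) * ‖V ξ‖ₑ)
            (fun ξ => ENNReal.ofReal (ω ξ) * ‖U ξ‖ₑ) ξ ≤
            lnorm (bw 1) U * (wnorm ω V * wnorm ω U) := by
          refine (lintegral_trilinear_le' (by fun_prop) (by fun_prop) (by fun_prop)).trans ?_
          exact mul_le_mul' (lintegral_enorm_dfun_le U) le_rfl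
        refine add_le_add (mul_le_mul' le_rfl (b1.trans (le_of_eq (by ring))))
          (mul_le_mul' le_rfl ((add_le_add b2 b3).trans (le_of_eq (by ring))))

end

/-! ### Bounded weights, time derivatives of energies and Grönwall -/

noncomputable section

/-- Bounded measurable symbols. -/
def BddSymbol (m : ℝ → ℂ) : Prop := Measurable m ∧ ∃ c, ∀ ξ, ‖m ξ‖ ≤ c

lemma BddSymbol.memLp {m : ℝ → ℂ} (h : BddSymbol m) (U : L2) :
    MemLp (fun ξ => m ξ * U ξ) 2 volume := by
  obtain ⟨hm, c, hc⟩ := h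
  refine MemLp.of_le_mul (c := c) (Lp.memLp U) ?_ (Eventually.of_forall fun ξ => ?_)
  · exact (hm.mul (measurable_coe U)).aestronglyMeasurable
  · rw [norm_mul]; gcongr; exact hc ξ

/-- The multiplication operator with a bounded symbol. -/
def mulCLM {m : ℝ → ℂ} (h : BddSymbol m) : L2 →L[ℝ] L2 :=
  LinearMap.mkContinuous
    { toFun := fun U => (h.memLp U).toLp _
      map_add' := fun U V => by
        rw [← MemLp.toLp_add]
        refine MemLp.toLp_congr _ _ ?_
        filter_upwards [Lp.coeFn_add U V] with ξ hξ
        rw [hξ, Pi.add_apply, Pi.add_apply, mul_add]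
      map_smul' := fun c U => by
        rw [RingHom.id_apply, ← MemLp.toLp_const_smul]
        refine MemLp.toLp_congr _ _ ?_
        filter_upwards [Lp.coeFn_smul c U] with ξ hξ
        simp only [hξ, Pi.smul_apply, Complex.real_smul]
        ring }
    h.2.choose fun U => by
      refine Lp.norm_le_mul_norm_of_ae_le_mul ?_
      filter_upwards [(h.memLp U).coeFn_toLp] with ξ hξ
      simp only [LinearMap.coe_mk, AddHom.coe_mk]
      rw [hξ, norm_mul]
      gcongr
      exact h.2.choose_spec ξ

lemma mulCLM_coe {m : ℝ → ℂ} (h : BddSymbol m) (U : L2) :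
    (mulCLM h U : ℝ → ℂ) =ᵐ[volume] fun ξ => m ξ * U ξ := (h.memLp U).coeFn_toLp

lemma wnorm_mulCLM {ω : ℝ → ℝ} {m : ℝ → ℂ} (h : BddSymbol m) (U : L2) :
    wnorm ω (mulCLM h U) = wnorm ω fun ξ => m ξ * U ξ := wnorm_congr (mulCLM_coe h U)

lemma wnorm_mulCLM_le {ω : ℝ → ℝ} {m : ℝ → ℂ} (h : BddSymbol m) (h1 : ∀ ξ, ‖m ξ‖ ≤ 1) (U : L2) :
    wnorm ω (mulCLM h U) ≤ wnorm ω U := by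
  rw [wnorm_mulCLM]
  refine wnorm_le_of_enorm_le fun ξ => ?_
  rw [enorm_mul]
  refine mul_le_of_le_one_left' ?_
  rw [← ofReal_norm, ← ENNReal.ofReal_one]
  exact ENNReal.ofReal_le_ofReal (h1 ξ)

/-- Bounded nonnegative measurable weights. -/
structure BddWeight (ω : ℝ → ℝ) : Prop where
  measurable : Measurable ω
  nonneg : ∀ ξ, 0 ≤ ω ξ
  bdd : ∃ c, ∀ ξ, ω ξ ≤ c

lemma BddWeight.symbol {ω : ℝ → ℝ} (h : BddWeight ω) : BddSymbol fun ξ => (ω ξ : ℂ) := by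
  obtain ⟨c, hc⟩ := h.bdd
  refine ⟨Complex.measurable_ofReal.comp h.measurable, c, fun ξ => ?_⟩
  rw [Complex.norm_real, Real.norm_of_nonneg (h.nonneg ξ)]
  exact hc ξ

lemma BddWeight.one : BddWeight fun _ => 1 :=
  ⟨measurable_const, fun _ => zero_le_one, 1, fun _ => le_rfl⟩

lemma IsWeight.bddWeight_min {m : ℕ} {ω : ℝ → ℝ} (h : IsWeight m ω) {c : ℝ} (hc : 0 ≤ c) :
    BddWeight fun ξ => min (ω ξ) c :=
  ⟨(h.min_const hc).measurable, (h.min_const hc).nonneg, c, fun _ => min_le_right _ _⟩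

lemma BddWeight.enorm_mulCLM {ω : ℝ → ℝ} (h : BddWeight ω) (U : L2) :
    ‖mulCLM h.symbol U‖ₑ = wnorm ω U := by
  rw [← wnorm_one, wnorm_mulCLM]
  unfold wnorm
  congr 1
  ext ξ
  rw [enorm_mul, ← ofReal_norm (Complex.ofReal _), Complex.norm_real,
    Real.norm_of_nonneg (h.nonneg ξ)]
  simp

/-- The weighted norm as a real number. -/
def wr (ω : ℝ → ℝ) (U : ℝ → ℂ) : ℝ := (wnorm ω U).toReal

lemma wr_nonneg (ω : ℝ → ℝ) (U : ℝ → ℂ) : 0 ≤ wr ω U := ENNReal.toReal_nonneg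

lemma BddWeight.norm_mulCLM {ω : ℝ → ℝ} (h : BddWeight ω) (U : L2) :
    ‖mulCLM h.symbol U‖ = wr ω U := by
  rw [wr, ← h.enorm_mulCLM, toReal_enorm]

lemma BddWeight.wnorm_lt_top {ω : ℝ → ℝ} (h : BddWeight ω) (U : L2) : wnorm ω U < ∞ := by
  rw [← h.enorm_mulCLM]; exact enorm_lt_top

lemma BddWeight.ofReal_wr {ω : ℝ → ℝ} (h : BddWeight ω) (U : L2) :
    ENNReal.ofReal (wr ω U) = wnorm ω U := ENNReal.ofReal_toReal (h.wnorm_lt_top U).ne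

/-- The real inner product of `ω U` and `ω V`. -/
def energyIP (ω : ℝ → ℝ) (U V : ℝ → ℂ) : ℝ := ∫ ξ, ω ξ ^ 2 * (conj (U ξ) * V ξ).re

lemma BddWeight.inner_mulCLM {ω : ℝ → ℝ} (h : BddWeight ω) (U V : L2) :
    inner ℝ (mulCLM h.symbol U) (mulCLM h.symbol V) = energyIP ω U V := by
  rw [L2.inner_def]
  refine integral_congr_ae ?_
  filter_upwards [mulCLM_coe h.symbol U, mulCLM_coe h.symbol V] with ξ h1 h2
  rw [h1, h2, Complex.inner]
  simp only [map_mul, Complex.conj_ofReal]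
  rw [← Complex.re_ofReal_mul]
  congr 1
  push_cast
  ring

lemma BddWeight.hasDerivAt_sq {ω : ℝ → ℝ} (h : BddWeight ω) {U : ℝ → L2} {U' : L2} {t : ℝ}
    (hU : HasDerivAt U U' t) :
    HasDerivAt (fun t => wr ω (U t) ^ 2) (2 * energyIP ω (U t) U') t := by
  have h1 := ((mulCLM h.symbol).hasFDerivAt.comp_hasDerivAt t hU).norm_sq
  simp only [Function.comp_apply] at h1
  rw [h.inner_mulCLM] at h1
  refine h1.congr_of_eventuallyEq (Eventually.of_forall fun t => ?_)
  simp only [h.norm_mulCLM]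

lemma BddWeight.continuousOn_wr {ω : ℝ → ℝ} (h : BddWeight ω) {U : ℝ → L2} {s : Set ℝ}
    (hU : ContinuousOn U s) : ContinuousOn (fun t => wr ω (U t)) s := by
  have h1 := ((mulCLM h.symbol).continuous.comp_continuousOn hU).norm
  exact h1.congr fun t _ => (h.norm_mulCLM _).symm

lemma BddWeight.abs_energyIP_le {ω : ℝ → ℝ} (h : BddWeight ω) (U V : L2) :
    |energyIP ω U V| ≤ wr ω U * wr ω V := by
  rw [← h.inner_mulCLM, ← h.norm_mulCLM, ← h.norm_mulCLM]
  exact abs_real_inner_le_norm _ _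

lemma BddWeight.energyIP_add {ω : ℝ → ℝ} (h : BddWeight ω) (U V W : L2) :
    energyIP ω U (V + W : L2) = energyIP ω U V + energyIP ω U W := by
  simp only [← h.inner_mulCLM, map_add, inner_add_right]

lemma BddWeight.energyIP_sub {ω : ℝ → ℝ} (h : BddWeight ω) (U V W : L2) :
    energyIP ω U (V - W : L2) = energyIP ω U V - energyIP ω U W := by
  simp only [← h.inner_mulCLM, map_sub, inner_sub_right]

lemma BddWeight.energyIP_neg {ω : ℝ → ℝ} (h : BddWeight ω) (U V : L2) :
    energyIP ω U (-V : L2) = -energyIP ω U V := by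
  simp only [← h.inner_mulCLM, map_neg, inner_neg_right]

lemma BddWeight.two_energyIP_adv_le {ω : ℝ → ℝ} (h : BddWeight ω) {C C' a b : ℝ} (hC : 0 ≤ C)
    (hC' : 0 ≤ C') (hs : SymbolBound C C' ω) {U V : L2}
    (hU : IsH2 U) (hV : IsH2 V) (hV' : Herm V) (ha : 0 ≤ a) (hb : 0 ≤ b)
    (hVa : lnorm (bw 1) V ≤ ENNReal.ofReal a) (hUb : lnorm (bw 1) U ≤ ENNReal.ofReal b) :
    |2 * energyIP ω U (adv V U)| ≤
      C * (a * wr ω U ^ 2) + C' * (2 * (b * wr ω U * wr ω V)) := by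
  obtain ⟨c, hc⟩ := h.bdd
  have h1 := energy_le h.measurable h.nonneg hC hC' hs hc hU hV hV'
  have w1 := wr_nonneg ω U
  have w2 := wr_nonneg ω V
  rw [← ENNReal.ofReal_le_ofReal_iff (by positivity)]
  refine h1.trans ?_
  rw [ENNReal.ofReal_add (by positivity) (by positivity), ENNReal.ofReal_mul hC,
    ENNReal.ofReal_mul hC', ENNReal.ofReal_mul ha, ENNReal.ofReal_pow w1, h.ofReal_wr,
    ENNReal.ofReal_mul (by norm_num : (0 : ℝ) ≤ 2), ENNReal.ofReal_mul (by positivity),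
    ENNReal.ofReal_mul hb, h.ofReal_wr, h.ofReal_wr, ENNReal.ofReal_ofNat]
  gcongr

/-- Monotone convergence for truncated weights. -/
lemma wnorm_le_of_min {ω : ℝ → ℝ} (hω : Measurable ω) {U : ℝ → ℂ} (hU : Measurable U) {K : ℝ≥0∞}
    (h : ∀ N : ℕ, wnorm (fun ξ => min (ω ξ) N) U ≤ K) : wnorm ω U ≤ K := by
  have h1 : ∀ N : ℕ, ∫⁻ ξ, (ENNReal.ofReal (min (ω ξ) N) * ‖U ξ‖ₑ) ^ (2 : ℝ) ≤ K ^ (2 : ℝ) := by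
    intro N
    rw [← norm2_sq]
    exact ENNReal.rpow_le_rpow (h N) (by norm_num)
  have h2 : wnorm ω U ^ (2 : ℝ) ≤ K ^ (2 : ℝ) := by
    rw [wnorm, norm2_sq]
    have h3 : ∀ ξ, (ENNReal.ofReal (ω ξ) * ‖U ξ‖ₑ) ^ (2 : ℝ)
        ≤ ⨆ N : ℕ, (ENNReal.ofReal (min (ω ξ) N) * ‖U ξ‖ₑ) ^ (2 : ℝ) := by
      intro ξ
      obtain ⟨N, hN⟩ := exists_nat_ge (ω ξ)
      refine le_iSup_of_le N ?_
      rw [min_eq_left hN]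
    refine (lintegral_mono h3).trans ?_
    rw [lintegral_iSup (fun N => by fun_prop)]
    · exact iSup_le h1
    · intro N M hNM ξ
      have : (N : ℝ) ≤ M := by exact_mod_cast hNM
      simp only
      gcongr
  exact (ENNReal.rpow_le_rpow_iff (by norm_num : (0 : ℝ) < 2)).1 h2

/-- Fatou's lemma for weighted norms. -/
lemma wnorm_le_of_tendsto {m : ℕ} {ω : ℝ → ℝ} (h : IsWeight m ω) {U : ℕ → L2} {V : L2}
    (hU : Tendsto U atTop (𝓝 V)) {K : ℝ≥0∞} (hK : ∀ᶠ n in atTop, wnorm ω (U n) ≤ K) :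
    wnorm ω V ≤ K := by
  refine wnorm_le_of_min h.measurable (measurable_coe V) fun N => ?_
  have hb := h.bddWeight_min (c := N) (by positivity)
  rw [← hb.enorm_mulCLM]
  have h1 : Tendsto (fun n => ‖mulCLM hb.symbol (U n)‖ₑ) atTop (𝓝 ‖mulCLM hb.symbol V‖ₑ) :=
    (((mulCLM hb.symbol).continuous.tendsto V).comp hU).enorm
  refine le_of_tendsto h1 (hK.mono fun n hn => ?_)
  rw [hb.enorm_mulCLM]
  exact (wnorm_mono (fun ξ => min_le_left _ _) _).trans hn

/-- The function `exp (-K t) * y t - c * t` is nonincreasing, since `exp (-K t) ≤ 1` and `c ≥ 0`.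
Derivatives are required only in the open interval, so one-sided derivatives at the endpoints never
enter. -/
lemma gronwall_of_interior {y y' : ℝ → ℝ} {σ K c : ℝ} (hc : 0 ≤ c) (hK : 0 ≤ K)
    (hy : ContinuousOn y (Icc 0 σ)) (hd : ∀ t ∈ Ioo 0 σ, HasDerivAt y (y' t) t)
    (hle : ∀ t ∈ Ioo 0 σ, y' t ≤ K * y t + c) {t : ℝ} (ht : t ∈ Icc 0 σ) :
    y t ≤ Real.exp (K * t) * (y 0 + c * t) := by
  have hanti : AntitoneOn (fun t => Real.exp (-(K * t)) * y t - c * t) (Icc 0 σ) := by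
    have hder : ∀ t ∈ Ioo 0 σ, HasDerivAt (fun t => Real.exp (-(K * t)) * y t - c * t)
        (Real.exp (-(K * t)) * (-K) * y t + Real.exp (-(K * t)) * y' t - c) t := by
      intro t ht
      have h1 : HasDerivAt (fun t : ℝ => -(K * t)) (-K) t := by
        exact ((hasDerivAt_id t).const_mul K).neg.congr_deriv (by simp)
      have h2 := (h1.exp.mul (hd t ht)).sub ((hasDerivAt_id t).const_mul c)
      exact h2.congr_deriv (by simp)
    refine antitoneOn_of_deriv_nonpos (convex_Icc 0 σ) ?_ ?_ ?_
    · exact ((Continuous.continuousOn (by fun_prop)).mul hy).sub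
        (Continuous.continuousOn (by fun_prop))
    · rw [interior_Icc]
      exact fun t ht => (hder t ht).differentiableAt.differentiableWithinAt
    · rw [interior_Icc]
      intro t ht
      rw [(hder t ht).deriv]
      have h1 := hle t ht
      have h2 : Real.exp (-(K * t)) ≤ 1 := Real.exp_le_one_iff.2 (by
        have := ht.1; nlinarith)
      have h3 := Real.exp_pos (-(K * t))
      nlinarith
  have h0 : (0 : ℝ) ∈ Icc 0 σ := ⟨le_rfl, ht.1.trans ht.2⟩
  have h1 := hanti h0 ht ht.1
  simp only [mul_zero, neg_zero, Real.exp_zero, one_mul, sub_zero] at h1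
  have h2 : Real.exp (-(K * t)) * y t ≤ y 0 + c * t := by linarith
  rw [Real.exp_neg] at h2
  have h3 := Real.exp_pos (K * t)
  rwa [inv_mul_le_iff₀ h3] at h2

lemma le_add_mul_of_interior {y y' : ℝ → ℝ} {σ c : ℝ} (hc : 0 ≤ c)
    (hy : ContinuousOn y (Icc 0 σ)) (hd : ∀ t ∈ Ioo 0 σ, HasDerivAt y (y' t) t)
    (hle : ∀ t ∈ Ioo 0 σ, y' t ≤ c) {t : ℝ} (ht : t ∈ Icc 0 σ) : y t ≤ y 0 + c * t := by
  have := gronwall_of_interior (K := 0) hc le_rfl hy hd (fun t ht => by simpa using hle t ht) ht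
  simpa using this

end

/-! ### A priori estimates for solutions and for differences of solutions -/

noncomputable section

lemma wr_one (U : L2) : wr (fun _ => 1) U = ‖U‖ := by
  rw [wr, wnorm_one, toReal_enorm]

lemma isH2_of_wnorm_bw {s : ℝ} (hs : 2 ≤ s) {U : ℝ → ℂ} (h : wnorm (bw s) U < ∞) : IsH2 U :=
  (wnorm_bw_mono hs U).trans_lt h

/-- Solutions of Burgers' equation on `[0, σ]`, on the Fourier side. -/
structure IsBurgers (σ : ℝ) (U : ℝ → L2) : Prop where
  cont : ContinuousOn U (Icc 0 σ)
  deriv : ∀ t ∈ Ioo 0 σ, HasDerivAt U (-adv (U t) (U t)) t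
  h2 : ∀ t ∈ Icc 0 σ, IsH2 (U t)
  herm : ∀ t ∈ Icc 0 σ, Herm (U t)

/-- Persistence of regularity, with growth controlled by `‖û_x‖_{L¹}`. -/
lemma wnorm_le_of_energyIP {σ a : ℝ} {U U' : ℝ → L2} (hcont : ContinuousOn U (Icc 0 σ))
    (hderiv : ∀ t ∈ Ioo 0 σ, HasDerivAt U (U' t) t)
    (hIP : ∀ t ∈ Ioo 0 σ, ∀ ω, BddWeight ω →
      energyIP ω (U t) (U' t) = -energyIP ω (U t) (adv (U t) (U t)))
    (h2 : ∀ t ∈ Icc 0 σ, IsH2 (U t)) (hherm : ∀ t ∈ Icc 0 σ, Herm (U t)) (ha : 0 ≤ a)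
    (hU : ∀ t ∈ Icc 0 σ, lnorm (bw 1) (U t) ≤ ENNReal.ofReal a) {m : ℕ} {ω : ℝ → ℝ}
    (hω : IsWeight m ω) {t : ℝ} (ht : t ∈ Icc 0 σ) :
    wnorm ω (U t) ≤ ENNReal.ofReal (Real.exp (2 * energyConst m * a * t)) * wnorm ω (U 0) := by
  refine wnorm_le_of_min hω.measurable (measurable_coe _) fun N => ?_
  have hN : (0 : ℝ) ≤ N := by positivity
  have hb := hω.bddWeight_min hN
  have hC := energyConst_nonneg m
  set ν : ℝ → ℝ := fun ξ => min (ω ξ) N with hν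
  -- The energy inequality gives the rate `3 * energyConst m * a` for the square of the norm; it is
  -- rounded up to 4 so that the square root has a clean rate.
  have key := gronwall_of_interior (y := fun t => wr ν (U t) ^ 2) (c := 0)
    (K := 4 * energyConst m * a) le_rfl (by positivity) ((hb.continuousOn_wr hcont).pow 2)
    (fun t ht => hb.hasDerivAt_sq (hderiv t ht)) (fun t ht => by
      have ht' := Ioo_subset_Icc_self ht
      have h1 := hb.two_energyIP_adv_le hC hC (hω.min_const hN).symbolBound (h2 t ht')
        (h2 t ht') (hherm t ht') ha ha (hU t ht') (hU t ht')
      -- Only the tested equation enters. This lets the lemma cover the Galerkin equation, whose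
      -- cut-off disappears when tested against a band-limited solution.
      rw [hIP t ht ν hb]
      have h2 := neg_abs_le (2 * energyIP ν (U t) (adv (U t) (U t)))
      have h3 : 0 ≤ energyConst m * (a * wr ν (U t) ^ 2) := by positivity
      nlinarith) ht
  simp only [zero_mul, add_zero] at key
  have h1 : wr ν (U t) ≤ Real.exp (2 * energyConst m * a * t) * wr ν (U 0) := by
    refine abs_le_of_sq_le_sq' ?_ (by have := wr_nonneg ν (U 0); positivity) |>.2
    rw [mul_pow, ← Real.exp_nat_mul]
    refine key.trans (le_of_eq ?_)
    congr 2
    push_cast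
    ring
  rw [← hb.ofReal_wr]
  refine (ENNReal.ofReal_le_ofReal h1).trans ?_
  rw [ENNReal.ofReal_mul (Real.exp_pos _).le, hb.ofReal_wr]
  gcongr
  exact wnorm_mono (fun ξ => min_le_left _ _) _

lemma IsBurgers.wnorm_le {σ a : ℝ} {U : ℝ → L2} (h : IsBurgers σ U) (ha : 0 ≤ a)
    (hU : ∀ t ∈ Icc 0 σ, lnorm (bw 1) (U t) ≤ ENNReal.ofReal a) {m : ℕ} {ω : ℝ → ℝ}
    (hω : IsWeight m ω) {t : ℝ} (ht : t ∈ Icc 0 σ) :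
    wnorm ω (U t) ≤ ENNReal.ofReal (Real.exp (2 * energyConst m * a * t)) * wnorm ω (U 0) :=
  wnorm_le_of_energyIP h.cont h.deriv (fun _ _ _ hb => hb.energyIP_neg _ _) h.h2 h.herm ha hU hω ht

/-- The `L²` estimate for the difference of two solutions. -/
lemma norm_sq_difference_le {σ a b φ : ℝ} {D X F U V : ℝ → L2} (ha : 0 ≤ a) (hb : 0 ≤ b)
    (hcont : ContinuousOn D (Icc 0 σ))
    (hderiv : ∀ t ∈ Ioo 0 σ,
      HasDerivAt D (X t - (adv (U t) (D t) + adv (D t) (V t)) + F t) t)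
    (hD : ∀ t ∈ Ioo 0 σ, IsH2 (D t)) (hU : ∀ t ∈ Ioo 0 σ, IsH2 (U t))
    (hV : ∀ t ∈ Ioo 0 σ, IsH2 (V t)) (hUh : ∀ t ∈ Ioo 0 σ, Herm (U t))
    (hUa : ∀ t ∈ Ioo 0 σ, lnorm (bw 1) (U t) ≤ ENNReal.ofReal a)
    (hVb : ∀ t ∈ Ioo 0 σ, lnorm (bw 1) (V t) ≤ ENNReal.ofReal b)
    (hF : ∀ t ∈ Ioo 0 σ, ‖F t‖ ≤ φ)
    (hX : ∀ t ∈ Ioo 0 σ, energyIP (fun _ => 1) (D t) (X t) ≤ 0) {t : ℝ} (ht : t ∈ Icc 0 σ) :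
    ‖D t‖ ^ 2 ≤ Real.exp ((a + 2 * b + 1) * t) * (‖D 0‖ ^ 2 + φ ^ 2 * t) := by
  have h1 := BddWeight.one
  have key := gronwall_of_interior (y := fun t => wr (fun _ => 1) (D t) ^ 2) (c := φ ^ 2)
    (K := a + 2 * b + 1) (sq_nonneg _) (by positivity) ((h1.continuousOn_wr hcont).pow 2)
    (fun t ht => h1.hasDerivAt_sq (hderiv t ht)) (fun t ht => ?_) ht
  · simpa only [wr_one] using key
  -- The second constant of `symbolBound_one` is 0, so the L¹ bound for the derivative of `D` is
  -- multiplied by 0; any finite value may be inserted, and its own is used.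
  have hlD := ((hD t ht).lnorm_lt_top (measurable_coe _)).ne
  have e1 := h1.two_energyIP_adv_le zero_le_one le_rfl symbolBound_one (hD t ht) (hU t ht)
    (hUh t ht) ha ENNReal.toReal_nonneg (hUa t ht) (ENNReal.ofReal_toReal hlD).ge
  have e2 := h1.abs_energyIP_le (D t) (adv (D t) (V t))
  have e3 := h1.abs_energyIP_le (D t) (F t)
  have e4 : ‖adv (D t) (V t)‖ ≤ b * ‖D t‖ := by
    have := (enorm_adv_le_right (hD t ht) (hV t ht)).trans (mul_le_mul' (hVb t ht) le_rfl)
    rw [← ofReal_norm, ← ofReal_norm, ← ENNReal.ofReal_mul hb] at this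
    exact (ENNReal.ofReal_le_ofReal_iff (by positivity)).1 this
  rw [h1.energyIP_add, h1.energyIP_sub, h1.energyIP_add]
  simp only [wr_one] at *
  have h5 := neg_abs_le (2 * energyIP (fun _ => 1) (D t) (adv (U t) (D t)))
  have h6 := neg_abs_le (energyIP (fun _ => 1) (D t) (adv (D t) (V t)))
  have h7 := le_abs_self (energyIP (fun _ => 1) (D t) (F t))
  have h8 := hX t ht
  have h9 := hF t ht
  have h10 : ‖D t‖ * ‖adv (D t) (V t)‖ ≤ ‖D t‖ * (b * ‖D t‖) := by gcongr
  have h11 : ‖D t‖ * ‖F t‖ ≤ ‖D t‖ * φ := by gcongr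
  -- The forcing is absorbed by `2 ‖D‖ φ ≤ ‖D‖² + φ²`, which is the source of the 1 in the rate.
  nlinarith [sq_nonneg (‖D t‖ - φ)]

/-- The constant `L` in the `H^r` estimate for differences. -/
def diffConst (m : ℕ) (r M₁ M₂ : ℝ) : ℝ :=
  (embConst (r - 1)).toReal * (3 * energyConst m * M₁ + 4 * 2 ^ m * M₂) / 2

lemma diffConst_nonneg (m : ℕ) (r : ℝ) {M₁ M₂ : ℝ} (h1 : 0 ≤ M₁) (h2 : 0 ≤ M₂) :
    0 ≤ diffConst m r M₁ M₂ := by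
  have := energyConst_nonneg m
  unfold diffConst
  positivity

lemma lnorm_one_le {r M : ℝ} (hr : 3 / 2 < r) {U : ℝ → ℂ} (hU : Measurable U)
    (h : wnorm (bw r) U ≤ ENNReal.ofReal M) :
    lnorm (bw 1) U ≤ ENNReal.ofReal ((embConst (r - 1)).toReal * M) := by
  have he := (embConst_lt_top (d := r - 1) (by linarith)).ne
  rw [ENNReal.ofReal_mul ENNReal.toReal_nonneg, ENNReal.ofReal_toReal he]
  exact (lnorm_bw_le 1 r hU).trans (mul_le_mul' le_rfl h)

/-- The growth of the truncated energy of a difference in `H^r`. -/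
lemma two_energyIP_difference_le {m : ℕ} {r M₁ M₂ φ B : ℝ} (hr : 3 / 2 < r) (hrm : r ≤ m)
    (h1 : 0 ≤ M₁) (h2 : 0 ≤ M₂) (hφ : 0 ≤ φ) (hB : 0 ≤ B) {D X F U V : L2}
    (hD : IsH2 D) (hU : IsH2 U) (hV : IsH2 V) (hUh : Herm U)
    (hUr : wnorm (bw r) U ≤ ENNReal.ofReal M₁) (hVr : wnorm (bw (r + 1)) V ≤ ENNReal.ofReal M₂)
    (hF : wnorm (bw r) F ≤ ENNReal.ofReal φ) (hDB : wnorm (bw r) D ≤ ENNReal.ofReal B) (N : ℕ)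
    (hX : energyIP (fun ξ => min (bw r ξ) N) D X ≤ 0) :
    2 * energyIP (fun ξ => min (bw r ξ) N) D (X - (adv U D + adv D V) + F : L2) ≤
      2 * (diffConst m r M₁ M₂ * B + φ) * B := by
  have hω : IsWeight m (bw r) := isWeight_bw (by linarith) hrm
  have hN : (0 : ℝ) ≤ N := by positivity
  have hb := hω.bddWeight_min hN
  have hC := energyConst_nonneg m
  set ν : ℝ → ℝ := fun ξ => min (bw r ξ) N with hν
  set e := (embConst (r - 1)).toReal with he
  have he0 : 0 ≤ e := ENNReal.toReal_nonneg
  have hνle : ∀ W : L2, wnorm ν W ≤ wnorm (bw r) W := fun W => wnorm_mono (fun ξ => min_le_left _ _) W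
  have toR : ∀ {W : L2} {M : ℝ}, 0 ≤ M → wnorm (bw r) W ≤ ENNReal.ofReal M → wr ν W ≤ M :=
    fun {W M} hM hW => ENNReal.toReal_le_of_le_ofReal hM ((hνle W).trans hW)
  have mD := measurable_coe D
  have mV := measurable_coe V
  have lU := lnorm_one_le hr (measurable_coe U) hUr
  have lD := lnorm_one_le hr mD hDB
  have lV := lnorm_one_le hr mV ((wnorm_bw_mono (by linarith) _).trans hVr)
  have e1 := hb.two_energyIP_adv_le hC hC (hω.min_const hN).symbolBound hD hU hUh
    (by positivity) (by positivity) lU lD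
  have e2 := hb.abs_energyIP_le D (adv D V)
  have e3 := hb.abs_energyIP_le D F
  -- The product estimate in H^r: this is the term that requires one more derivative of `V` than of
  -- the error.
  have hadv : wr ν (adv D V) ≤ 2 * 2 ^ m * e * M₂ * B := by
    refine toR (by positivity) ?_
    refine (wnorm_adv_le hω hD hV).trans ?_
    have h3 : (fun ξ => bw r ξ * bw 1 ξ) = bw (r + 1) := by ext ξ; rw [bw_add]
    rw [h3]
    calc _ ≤ 2 ^ m * (ENNReal.ofReal B * ENNReal.ofReal (e * M₂) +
          ENNReal.ofReal (e * B) * ENNReal.ofReal M₂) := by gcongr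
      _ = ENNReal.ofReal (2 * 2 ^ m * e * M₂ * B) := by
          rw [← ENNReal.ofReal_mul hB, ← ENNReal.ofReal_mul (by positivity),
            ← ENNReal.ofReal_add (by positivity) (by positivity)]
          have h4 : (2 : ℝ≥0∞) ^ m = ENNReal.ofReal (2 ^ m) := by
            rw [ENNReal.ofReal_pow (by norm_num)]; norm_num
          rw [h4, ← ENNReal.ofReal_mul (by positivity)]
          congr 1
          ring
  rw [hb.energyIP_add, hb.energyIP_sub, hb.energyIP_add]
  have yD := toR hB hDB
  have yU := toR h1 hUr
  have yF := toR hφ hF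
  have w0 := wr_nonneg ν D
  have wU := wr_nonneg ν U
  have wF := wr_nonneg ν F
  have wA := wr_nonneg ν (adv D V)
  have h5 := neg_abs_le (2 * energyIP ν D (adv U D))
  have h6 := neg_abs_le (energyIP ν D (adv D V))
  have h7 := le_abs_self (energyIP ν D F)
  have b1 : energyConst m * (e * M₁ * wr ν D ^ 2) ≤ energyConst m * (e * M₁ * B ^ 2) := by gcongr
  have b2 : energyConst m * (2 * (e * B * wr ν D * wr ν U)) ≤
      energyConst m * (2 * (e * B * B * M₁)) := by gcongr
  have b3 : wr ν D * wr ν (adv D V) ≤ B * (2 * 2 ^ m * e * M₂ * B) := by gcongr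
  have b4 : wr ν D * wr ν F ≤ B * φ := by gcongr
  have : 2 * (diffConst m r M₁ M₂ * B + φ) * B =
      energyConst m * (e * M₁ * B ^ 2) + energyConst m * (2 * (e * B * B * M₁)) +
      2 * (B * (2 * 2 ^ m * e * M₂ * B)) + 2 * (B * φ) := by
    unfold diffConst
    rw [← he]
    ring
  rw [this]
  linarith

/-- The `H^r` estimate for the difference of two solutions on a short time interval. -/
lemma wnorm_difference_le {m : ℕ} {σ r M₁ M₂ φ y₀ B₀ : ℝ} {D X F U V : ℝ → L2}
    (hr : 3 / 2 < r) (hrm : r ≤ m) (h1 : 0 ≤ M₁) (h2 : 0 ≤ M₂) (hφ : 0 ≤ φ) (hy : 0 ≤ y₀)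
    (hcont : ContinuousOn D (Icc 0 σ))
    (hderiv : ∀ t ∈ Ioo 0 σ,
      HasDerivAt D (X t - (adv (U t) (D t) + adv (D t) (V t)) + F t) t)
    (hD : ∀ t ∈ Ioo 0 σ, IsH2 (D t)) (hU : ∀ t ∈ Ioo 0 σ, IsH2 (U t))
    (hV : ∀ t ∈ Ioo 0 σ, IsH2 (V t)) (hUh : ∀ t ∈ Ioo 0 σ, Herm (U t))
    (hUr : ∀ t ∈ Ioo 0 σ, wnorm (bw r) (U t) ≤ ENNReal.ofReal M₁)
    (hVr : ∀ t ∈ Ioo 0 σ, wnorm (bw (r + 1)) (V t) ≤ ENNReal.ofReal M₂)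
    (hF : ∀ t ∈ Ioo 0 σ, wnorm (bw r) (F t) ≤ ENNReal.ofReal φ)
    (hX : ∀ t ∈ Ioo 0 σ, ∀ ω, BddWeight ω → energyIP ω (D t) (X t) ≤ 0)
    (hB₀ : ∀ t ∈ Icc 0 σ, wnorm (bw r) (D t) ≤ ENNReal.ofReal B₀)
    (hy₀ : wnorm (bw r) (D 0) ≤ ENNReal.ofReal y₀)
    (hσ : 4 * σ * diffConst m r M₁ M₂ ≤ 1) {t : ℝ} (ht : t ∈ Icc 0 σ) :
    wnorm (bw r) (D t) ≤
      ENNReal.ofReal ((1 + 4 * σ * diffConst m r M₁ M₂) * (y₀ + 2 * σ * φ)) := by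
  set L := diffConst m r M₁ M₂ with hL
  have hL0 : 0 ≤ L := diffConst_nonneg m r h1 h2
  have hσ0 : 0 ≤ σ := ht.1.trans ht.2
  have hω : IsWeight m (bw r) := isWeight_bw (by linarith) hrm
  have hfin : ∀ t ∈ Icc 0 σ, wnorm (bw r) (D t) ≠ ∞ := fun t ht =>
    ((hB₀ t ht).trans_lt ENNReal.ofReal_lt_top).ne
  -- The derivative of a truncated energy involves the L¹ norm of the derivative of `D`, controlled
  -- here by the full H^r norm rather than the truncated one. The inequality is therefore integrated
  -- with a uniform bound `B` frozen on the right, and the truncation is removed afterwards.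
  have step : ∀ B, 0 ≤ B → (∀ t ∈ Icc 0 σ, wnorm (bw r) (D t) ≤ ENNReal.ofReal B) →
      ∀ t ∈ Icc 0 σ, wr (bw r) (D t) ≤ Real.sqrt (y₀ ^ 2 + 2 * (L * B + φ) * B * σ) := by
    intro B hB hDB t ht
    have hc : 0 ≤ 2 * (L * B + φ) * B := by positivity
    refine ENNReal.toReal_le_of_le_ofReal (Real.sqrt_nonneg _) ?_
    refine wnorm_le_of_min hω.measurable (measurable_coe _) fun N => ?_
    have hN : (0 : ℝ) ≤ N := by positivity
    have hb := hω.bddWeight_min hN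
    rw [← hb.ofReal_wr]
    refine ENNReal.ofReal_le_ofReal (Real.le_sqrt_of_sq_le ?_)
    have key := le_add_mul_of_interior (y := fun t => wr (fun ξ => min (bw r ξ) N) (D t) ^ 2)
      hc ((hb.continuousOn_wr hcont).pow 2) (fun t ht => hb.hasDerivAt_sq (hderiv t ht))
      (fun t ht => two_energyIP_difference_le hr hrm h1 h2 hφ hB (hD t ht) (hU t ht) (hV t ht)
        (hUh t ht) (hUr t ht) (hVr t ht) (hF t ht) (hDB t (Ioo_subset_Icc_self ht)) N
        (hX t ht _ hb)) ht
    refine key.trans ?_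
    have h0 : wr (fun ξ => min (bw r ξ) N) (D 0) ≤ y₀ :=
      ENNReal.toReal_le_of_le_ofReal hy ((wnorm_mono (fun ξ => min_le_left _ _) _).trans hy₀)
    have h3 := wr_nonneg (fun ξ => min (bw r ξ) N) (D 0)
    have h4 := ht.2
    gcongr
  set S := (fun t => wr (bw r) (D t)) '' Icc 0 σ with hS
  have hne : S.Nonempty := ⟨_, mem_image_of_mem _ ht⟩
  have hbdd : BddAbove S := by
    refine ⟨max B₀ 0, ?_⟩
    rintro _ ⟨t, ht, rfl⟩
    exact ENNReal.toReal_le_of_le_ofReal (le_max_right _ _)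
      ((hB₀ t ht).trans (ENNReal.ofReal_le_ofReal (le_max_left _ _)))
  -- The bound `B₀` serves only to make the supremum finite and leaves no trace in the result. The
  -- maximum with `y₀` gives `y₀² ≤ y₀ B`, so that the quadratic inequality for `B` can be divided
  -- by `B`.
  set B := max (sSup S) y₀ with hB
  have hBy : y₀ ≤ B := le_max_right _ _
  have hB0 : 0 ≤ B := hy.trans hBy
  have hle : ∀ t ∈ Icc 0 σ, wr (bw r) (D t) ≤ B := fun t ht =>
    (le_csSup hbdd (mem_image_of_mem _ ht)).trans (le_max_left _ _)
  have hle' : ∀ t ∈ Icc 0 σ, wnorm (bw r) (D t) ≤ ENNReal.ofReal B := fun t ht => by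
    rw [← ENNReal.ofReal_toReal (hfin t ht)]
    exact ENNReal.ofReal_le_ofReal (hle t ht)
  have h3 := step B hB0 hle'
  have hq0 : 0 ≤ 2 * (L * B + φ) * B * σ := by positivity
  have h4 : B ≤ Real.sqrt (y₀ ^ 2 + 2 * (L * B + φ) * B * σ) := by
    refine max_le (csSup_le hne ?_) (Real.le_sqrt_of_sq_le (by linarith))
    rintro _ ⟨t, ht, rfl⟩
    exact h3 t ht
  have h5 : B ^ 2 ≤ y₀ ^ 2 + 2 * (L * B + φ) * B * σ := by
    rw [← Real.sq_sqrt (by positivity : 0 ≤ y₀ ^ 2 + 2 * (L * B + φ) * B * σ)]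
    exact pow_le_pow_left₀ hB0 h4 2
  have h6 : B ≤ (1 + 4 * σ * L) * (y₀ + 2 * σ * φ) := by
    rcases hB0.eq_or_lt with h0 | h0
    · rw [← h0]; positivity
    have h7 : B * B ≤ (y₀ + 2 * σ * (L * B + φ)) * B := by nlinarith
    have h8 := le_of_mul_le_mul_right h7 h0
    have h9 : 0 ≤ σ * L := by positivity
    -- With `x = σ L ≤ 1 / 4` one has `(1 + 4x)(1 - 2x) = 1 + 2x(1 - 4x) ≥ 1`, which is the reason
    -- for the smallness condition on `σ`.
    have h10 : B ≤ B * ((1 + 4 * σ * L) * (1 - 2 * σ * L)) :=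
      le_mul_of_one_le_right hB0 (by nlinarith)
    have h11 : B * (1 - 2 * σ * L) ≤ y₀ + 2 * σ * φ := by linarith
    have h12 := mul_le_mul_of_nonneg_left h11 (by positivity : 0 ≤ 1 + 4 * σ * L)
    linarith
  exact (hle' t ht).trans (ENNReal.ofReal_le_ofReal h6)

end

/-! ### Tools for the Galerkin scheme: bounded fields, retraction, reflection, cut-off -/

noncomputable section

section ODE

variable {E : Type*} [NormedAddCommGroup E]

/-- A field bounded by `L` cannot leave the ball of radius `L * (σ + 1)` in the time available, so
Picard–Lindelöf needs no continuation argument. It is applied on `[-1, σ + 1]` to make the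
derivatives at 0 and `σ` two-sided. -/
lemma exists_hasDerivAt_of_bdd_lipschitz [NormedSpace ℝ E] [CompleteSpace E] {F : E → E} {K : NNReal} {L σ : ℝ}
    (hF : LipschitzWith K F) (hL : ∀ x, ‖F x‖ ≤ L) (hσ : 0 ≤ σ) (x₀ : E) :
    ∃ U : ℝ → E, U 0 = x₀ ∧ ∀ t ∈ Icc 0 σ, HasDerivAt U (F (U t)) t := by
  have hL0 : 0 ≤ L := (norm_nonneg _).trans (hL 0)
  have hPL : IsPicardLindelof (fun _ : ℝ => F) (tmin := -1) (tmax := σ + 1)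
      ⟨0, by constructor <;> linarith⟩ x₀ ⟨L * (σ + 1), by positivity⟩ 0 ⟨L, hL0⟩ K := by
    refine ⟨fun t _ => hF.lipschitzOnWith, fun x _ => continuousOn_const, fun t _ x _ => hL x, ?_⟩
    change L * max (σ + 1 - 0) (0 - (-1)) ≤ L * (σ + 1) - 0
    rw [sub_zero, sub_zero, zero_sub, neg_neg, max_eq_left (by linarith)]
  obtain ⟨U, h0, hU⟩ := hPL.exists_eq_forall_mem_Icc_hasDerivWithinAt₀
  refine ⟨U, h0, fun t ht => ?_⟩
  exact (hU t ⟨by linarith [ht.1], by linarith [ht.2]⟩).hasDerivAt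
    (Icc_mem_nhds (by linarith [ht.1]) (by linarith [ht.2]))

/-- The factor of the radial retraction onto the ball of radius `ρ`. -/
def radialFactor (ρ : ℝ) (x : E) : ℝ := ρ / max ρ ‖x‖

variable {ρ : ℝ}

lemma radialFactor_pos (hρ : 0 < ρ) (x : E) : 0 < radialFactor ρ x :=
  div_pos hρ (lt_max_of_lt_left hρ)

lemma radialFactor_le_one (hρ : 0 < ρ) (x : E) : radialFactor ρ x ≤ 1 :=
  (div_le_one (lt_max_of_lt_left hρ)).2 (le_max_left _ _)

variable [NormedSpace ℝ E]

/-- The radial retraction onto the ball of radius `ρ`. -/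
def radial (ρ : ℝ) (x : E) : E := radialFactor ρ x • x

lemma radial_of_norm_le (hρ : 0 < ρ) {x : E} (h : ‖x‖ ≤ ρ) : radial ρ x = x := by
  rw [radial, radialFactor, max_eq_left h, div_self hρ.ne', one_smul]

lemma norm_radial_le (hρ : 0 < ρ) (x : E) : ‖radial ρ x‖ ≤ ρ := by
  have hm : 0 < max ρ ‖x‖ := lt_max_of_lt_left hρ
  rw [radial, norm_smul, Real.norm_of_nonneg (radialFactor_pos hρ x).le, radialFactor,
    div_mul_eq_mul_div, div_le_iff₀ hm]
  gcongr
  exact le_max_right _ _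

lemma norm_radial_sub_le (hρ : 0 < ρ) (x y : E) : ‖radial ρ x - radial ρ y‖ ≤ 2 * ‖x - y‖ := by
  have hx : 0 < max ρ ‖x‖ := lt_max_of_lt_left hρ
  have hy : 0 < max ρ ‖y‖ := lt_max_of_lt_left hρ
  have e : radial ρ x - radial ρ y
      = radialFactor ρ x • (x - y) + (radialFactor ρ x - radialFactor ρ y) • y := by
    unfold radial; module
  have h1 : |radialFactor ρ x - radialFactor ρ y| * ‖y‖ ≤ ‖x - y‖ := by
    have h2 : radialFactor ρ x - radialFactor ρ y
        = radialFactor ρ x * ((max ρ ‖y‖ - max ρ ‖x‖) / max ρ ‖y‖) := by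
      unfold radialFactor; field_simp
    have h3 : |max ρ ‖y‖ - max ρ ‖x‖| ≤ ‖x - y‖ := by
      have h4 := abs_max_sub_max_le_max ρ ‖y‖ ρ ‖x‖
      have h5 : |‖y‖ - ‖x‖| ≤ ‖x - y‖ := by
        rw [abs_sub_comm]; exact abs_norm_sub_norm_le x y
      refine h4.trans (max_le (by simp) h5)
    rw [h2, abs_mul, abs_div, abs_of_pos hy, abs_of_pos (radialFactor_pos hρ x)]
    have h6 : ‖y‖ / max ρ ‖y‖ ≤ 1 := (div_le_one hy).2 (le_max_right _ _)
    calc _ = radialFactor ρ x * |max ρ ‖y‖ - max ρ ‖x‖| * (‖y‖ / max ρ ‖y‖) := by ring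
      _ ≤ 1 * ‖x - y‖ * 1 := by
          gcongr
          exact radialFactor_le_one hρ x
      _ = _ := by ring
  rw [e]
  refine (norm_add_le _ _).trans ?_
  rw [norm_smul, norm_smul, Real.norm_of_nonneg (radialFactor_pos hρ x).le, Real.norm_eq_abs]
  have h7 := mul_le_mul_of_nonneg_right (radialFactor_le_one hρ x) (norm_nonneg (x - y))
  linarith

end ODE

lemma norm_conj_neg_toLp (U : L2) : ‖(memLp_conj_neg (Lp.memLp U)).toLp _‖ = ‖U‖ := by
  rw [Lp.norm_toLp, Lp.norm_def]
  refine congrArg _ ?_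
  have h1 := eLpNorm_comp_measurePreserving (p := 2) (Lp.aestronglyMeasurable U)
    (Measure.measurePreserving_neg (volume : Measure ℝ))
  rw [← h1]
  refine eLpNorm_congr_norm_ae (Eventually.of_forall fun ξ => ?_)
  simp

/-- The Fourier side of complex conjugation. -/
def reflCLM : L2 →L[ℝ] L2 :=
  LinearMap.mkContinuous
    { toFun := fun U => (memLp_conj_neg (Lp.memLp U)).toLp _
      map_add' := fun U V => by
        rw [← MemLp.toLp_add]
        refine MemLp.toLp_congr _ _ ?_
        filter_upwards [ae_neg (Lp.coeFn_add U V)] with ξ hξ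
        rw [hξ, Pi.add_apply, Pi.add_apply, map_add]
      map_smul' := fun c U => by
        rw [RingHom.id_apply, ← MemLp.toLp_const_smul]
        refine MemLp.toLp_congr _ _ ?_
        filter_upwards [ae_neg (Lp.coeFn_smul c U)] with ξ hξ
        rw [hξ]
        simp }
    1 fun U => by
      rw [one_mul]
      exact (norm_conj_neg_toLp U).le

lemma reflCLM_coe (U : L2) : (reflCLM U : ℝ → ℂ) =ᵐ[volume] fun ξ => conj (U (-ξ)) :=
  (memLp_conj_neg (Lp.memLp U)).coeFn_toLp

lemma herm_iff_reflCLM (U : L2) : Herm U ↔ reflCLM U = U := by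
  constructor
  · intro h
    apply Lp.ext
    filter_upwards [reflCLM_coe U, ae_neg h] with ξ h1 h2
    rw [h1, ← h2, neg_neg]
  · intro h
    have h1 := reflCLM_coe U
    rw [h] at h1
    filter_upwards [ae_neg h1] with ξ h2
    rw [h2, neg_neg]

lemma norm_reflCLM (U : L2) : ‖reflCLM U‖ = ‖U‖ := norm_conj_neg_toLp U

lemma Herm.of_tendsto {U : ℕ → L2} {V : L2} (h : Tendsto U atTop (𝓝 V)) (hU : ∀ n, Herm (U n)) :
    Herm V := by
  rw [herm_iff_reflCLM]
  refine tendsto_nhds_unique ((reflCLM.continuous.tendsto V).comp h) ?_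
  refine h.congr fun n => ?_
  exact ((herm_iff_reflCLM _).1 (hU n)).symm

lemma wnorm_reflCLM {m : ℕ} {ω : ℝ → ℝ} (h : IsWeight m ω) (U : L2) :
    wnorm ω (reflCLM U) = wnorm ω U := by
  rw [wnorm_congr (reflCLM_coe U)]
  unfold wnorm norm2
  congr 1
  rw [← lintegral_neg_eq_self (μ := volume) (fun ξ => (ENNReal.ofReal (ω ξ) * ‖U ξ‖ₑ) ^ (2 : ℝ))]
  refine lintegral_congr fun ξ => ?_
  simp only [h.even, RCLike.enorm_conj]

lemma isH2_reflCLM {U : L2} (h : IsH2 U) : IsH2 (reflCLM U) := by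
  unfold IsH2
  rwa [wnorm_reflCLM (m := 2) (isWeight_bw (by norm_num) (by norm_num))]

lemma reflCLM_adv {U V : L2} (hU : IsH2 U) (hV : IsH2 V) :
    reflCLM (adv U V) = adv (reflCLM U) (reflCLM V) := by
  apply Lp.ext
  have hd : dfun (reflCLM V) =ᵐ[volume] fun ξ => conj (dfun V (-ξ)) := by
    filter_upwards [reflCLM_coe V] with ξ hξ
    simp [dfun, hξ, Complex.conj_ofNat]
  filter_upwards [reflCLM_coe (adv U V), ae_neg (adv_coe hU hV),
    adv_coe (isH2_reflCLM hU) (isH2_reflCLM hV)] with ξ h1 h2 h3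
  rw [h1, h2, h3, conv_congr_left (reflCLM_coe U), conv_congr_right _ hd]
  unfold conv
  rw [← integral_conj, ← integral_neg_eq_self]
  congr 1
  ext η
  rw [map_mul]
  congr 3
  ring

/-- The symbol of the frequency cut-off. -/
def cutSymbol (R : ℝ) (ξ : ℝ) : ℂ := if bracket ξ ≤ R then 1 else 0

lemma cutSymbol_bdd (R : ℝ) : BddSymbol (cutSymbol R) := by
  refine ⟨Measurable.ite (measurableSet_le continuous_bracket.measurable measurable_const)
    measurable_const measurable_const, 1, fun ξ => ?_⟩
  unfold cutSymbol
  split_ifs <;> simp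

lemma norm_cutSymbol_le (R ξ : ℝ) : ‖cutSymbol R ξ‖ ≤ 1 := by
  unfold cutSymbol
  split_ifs <;> simp

/-- The frequency cut-off. -/
def cut (R : ℝ) : L2 →L[ℝ] L2 := mulCLM (cutSymbol_bdd R)

lemma cut_coe (R : ℝ) (U : L2) : (cut R U : ℝ → ℂ) =ᵐ[volume] fun ξ => cutSymbol R ξ * U ξ :=
  mulCLM_coe _ U

lemma cut_cut (R : ℝ) (U : L2) : cut R (cut R U) = cut R U := by
  apply Lp.ext
  filter_upwards [cut_coe R (cut R U), cut_coe R U] with ξ h1 h2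
  rw [h1, h2]
  unfold cutSymbol
  split_ifs <;> simp

lemma wnorm_cut_le {ω : ℝ → ℝ} (R : ℝ) (U : L2) : wnorm ω (cut R U) ≤ wnorm ω U :=
  wnorm_mulCLM_le _ (norm_cutSymbol_le R) U

lemma norm_cut_le (R : ℝ) (U : L2) : ‖cut R U‖ ≤ ‖U‖ := by
  have := wnorm_cut_le (ω := fun _ => 1) R U
  rw [wnorm_one, wnorm_one] at this
  exact enorm_le_iff_norm_le.1 this

lemma wnorm_bw_cut_le {s R : ℝ} (hs : 0 ≤ s) (U : L2) :
    wnorm (bw s) (cut R U) ≤ wnorm (fun ξ => min (bw s ξ) (R ^ s)) (cut R U) := by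
  rw [wnorm_congr (cut_coe R U), wnorm_congr (cut_coe R U)]
  refine norm2_mono fun ξ => ?_
  simp only [cutSymbol]
  split_ifs with h
  · rw [min_eq_left]
    exact Real.rpow_le_rpow (bracket_pos ξ).le h hs
  · simp

lemma wnorm_bw_cut_le_mul {s R : ℝ} (hs : 0 ≤ s) (U : L2) :
    wnorm (bw s) (cut R U) ≤ ENNReal.ofReal (R ^ s) * ‖U‖ₑ := by
  refine (wnorm_bw_cut_le hs U).trans ?_
  refine (wnorm_mono (fun ξ => min_le_right _ _) _).trans ((wnorm_cut_le R U).trans ?_)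
  rw [wnorm_const]

lemma isH2_cut (R : ℝ) (U : L2) : IsH2 (cut R U) :=
  (wnorm_bw_cut_le_mul (by norm_num) U).trans_lt (ENNReal.mul_lt_top ENNReal.ofReal_lt_top
    enorm_lt_top)

lemma norm_sub_cut_le {R : ℝ} (hR : 0 < R) (U : L2) :
    ‖U - cut R U‖ₑ ≤ ENNReal.ofReal R⁻¹ * wnorm (bw 1) U := by
  have mU := measurable_coe U
  have hb := measurable_bw 1
  rw [← wnorm_one, wnorm, wnorm, ← norm2_const_mul (by fun_prop)]
  refine norm2_mono_ae ?_
  filter_upwards [Lp.coeFn_sub U (cut R U), cut_coe R U] with ξ h1 h2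
  rw [h1, Pi.sub_apply, h2]
  unfold cutSymbol
  split_ifs with h
  · simp
  · rw [zero_mul, sub_zero, ENNReal.ofReal_one, one_mul, ← mul_assoc,
      ← ENNReal.ofReal_mul (by positivity)]
    refine le_mul_of_one_le_left' ?_
    rw [← ENNReal.ofReal_one]
    apply ENNReal.ofReal_le_ofReal
    rw [bw_one, ← div_eq_inv_mul, one_le_div hR]
    exact (not_le.1 h).le

lemma energyIP_cut (R : ℝ) (ω : ℝ → ℝ) (U V : L2) :
    energyIP ω U (cut R V) = energyIP ω (cut R U) V := by
  refine integral_congr_ae ?_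
  filter_upwards [cut_coe R U, cut_coe R V] with ξ h1 h2
  rw [h1, h2]
  unfold cutSymbol
  split_ifs <;> simp

lemma reflCLM_cut (R : ℝ) (U : L2) : reflCLM (cut R U) = cut R (reflCLM U) := by
  apply Lp.ext
  filter_upwards [reflCLM_coe (cut R U), ae_neg (cut_coe R U), cut_coe R (reflCLM U),
    reflCLM_coe U] with ξ h1 h2 h3 h4
  have h5 : cutSymbol R (-ξ) = cutSymbol R ξ := by
    unfold cutSymbol bracket japanese
    simp
  rw [h1, h2, h3, h4, h5]
  unfold cutSymbol
  split_ifs <;> simp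

lemma Herm.cut {R : ℝ} {U : L2} (h : Herm U) : Herm (cut R U) := by
  rw [herm_iff_reflCLM] at *
  rw [reflCLM_cut, h]

end

/-! ### Galerkin approximations of Burgers' equation -/

noncomputable section

lemma norm_adv_le_left {U V : L2} (hU : IsH2 U) (hV : IsH2 V) {a b : ℝ} (ha : 0 ≤ a) (hb : 0 ≤ b)
    (h1 : lnorm (bw 1) U ≤ ENNReal.ofReal a) (h2 : wnorm (bw 1) V ≤ ENNReal.ofReal b) :
    ‖adv U V‖ ≤ a * b := by
  have := (enorm_adv_le_left hU hV).trans (mul_le_mul' h1 h2)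
  rw [← ofReal_norm, ← ENNReal.ofReal_mul ha] at this
  exact (ENNReal.ofReal_le_ofReal_iff (by positivity)).1 this

lemma norm_adv_le_right {U V : L2} (hU : IsH2 U) (hV : IsH2 V) {a : ℝ} (ha : 0 ≤ a)
    (h1 : lnorm (bw 1) V ≤ ENNReal.ofReal a) : ‖adv U V‖ ≤ a * ‖U‖ := by
  have := (enorm_adv_le_right hU hV).trans (mul_le_mul' h1 le_rfl)
  rw [← ofReal_norm, ← ofReal_norm, ← ENNReal.ofReal_mul ha] at this
  exact (ENNReal.ofReal_le_ofReal_iff (by positivity)).1 this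

lemma lnorm_le_of_bw_two {S : ℝ} {U : ℝ → ℂ} (hU : Measurable U)
    (h : wnorm (bw 2) U ≤ ENNReal.ofReal S) :
    lnorm (bw 1) U ≤ ENNReal.ofReal ((embConst 1).toReal * S) := by
  have := lnorm_one_le (r := 2) (by norm_num) hU h
  rwa [show (2 : ℝ) - 1 = 1 by norm_num] at this

/-- The truncated and cut off vector field of the Galerkin approximation. -/
def galerkinField (R ρ : ℝ) (U : L2) : L2 :=
  -cut R (adv (cut R (radial ρ U)) (cut R (radial ρ U)))

lemma norm_adv_cut_sub_le {R ρ : ℝ} (hR : 0 ≤ R) (hρ : 0 ≤ ρ) {X Y : L2} (hX : ‖X‖ ≤ ρ)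
    (hY : ‖Y‖ ≤ ρ) :
    ‖adv (cut R X) (cut R X) - adv (cut R Y) (cut R Y)‖ ≤
      (embConst 1).toReal * (R ^ 2 * ρ) * (R + 1) * ‖X - Y‖ := by
  have hXh := isH2_cut R X
  have hYh := isH2_cut R Y
  have e1 : (0 : ℝ) ≤ (embConst 1).toReal := ENNReal.toReal_nonneg
  have hl : ∀ Z : L2, ‖Z‖ ≤ ρ → lnorm (bw 1) (cut R Z) ≤
      ENNReal.ofReal ((embConst 1).toReal * (R ^ 2 * ρ)) := fun Z hZ => by
    refine lnorm_le_of_bw_two (measurable_coe _) ((wnorm_bw_cut_le_mul (by norm_num) Z).trans ?_)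
    rw [ENNReal.ofReal_mul (by positivity), Real.rpow_ofNat, ← ofReal_norm]
    gcongr
  have hD : wnorm (bw 1) (cut R X - cut R Y : L2) ≤ ENNReal.ofReal (R * ‖X - Y‖) := by
    rw [← map_sub]
    refine (wnorm_bw_cut_le_mul (by norm_num) _).trans ?_
    rw [ENNReal.ofReal_mul (by positivity), Real.rpow_one, ofReal_norm]
  have hD2 : ‖cut R X - cut R Y‖ ≤ ‖X - Y‖ := by
    rw [← map_sub]; exact norm_cut_le R _
  rw [adv_self_sub hXh hYh]
  refine (norm_add_le _ _).trans ?_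
  have h1 := norm_adv_le_left hXh (hXh.sub hYh) (by positivity) (by positivity) (hl X hX) hD
  have h2 := norm_adv_le_right (hXh.sub hYh) hYh (by positivity) (hl Y hY)
  have h3 := mul_le_mul_of_nonneg_left hD2
    (by positivity : 0 ≤ (embConst 1).toReal * (R ^ 2 * ρ))
  linarith

lemma adv_zero : adv 0 0 = 0 := by
  have h : IsH2 (0 : L2) := by
    have := isH2_cut 1 0
    rwa [map_zero] at this
  simpa using adv_sub_left h h h

/-- The cut-off makes differentiation bounded, and the radial retraction confines the quadratic
field to a ball, where it is Lipschitz. Together they make the field globally bounded and Lipschitz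
on L². -/
lemma galerkinField_lipschitz {R ρ : ℝ} (hR : 0 ≤ R) (hρ : 0 < ρ) :
    ∃ K : NNReal, ∃ L : ℝ, LipschitzWith K (galerkinField R ρ) ∧ ∀ U, ‖galerkinField R ρ U‖ ≤ L := by
  set c := (embConst 1).toReal * (R ^ 2 * ρ) * (R + 1) with hc
  have hc0 : 0 ≤ c := by
    have e1 : (0 : ℝ) ≤ (embConst 1).toReal := ENNReal.toReal_nonneg
    positivity
  refine ⟨Real.toNNReal (c * 2), c * ρ, ?_, ?_⟩
  · refine LipschitzWith.of_dist_le_mul fun X Y => ?_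
    rw [dist_eq_norm, dist_eq_norm]
    unfold galerkinField
    rw [neg_sub_neg, ← map_sub, Real.coe_toNNReal _ (by positivity), mul_assoc, norm_sub_rev X Y]
    refine (norm_cut_le R _).trans ?_
    refine (norm_adv_cut_sub_le hR hρ.le (norm_radial_le hρ Y) (norm_radial_le hρ X)).trans ?_
    exact mul_le_mul_of_nonneg_left (norm_radial_sub_le hρ Y X) hc0
  · intro U
    unfold galerkinField
    rw [norm_neg]
    refine (norm_cut_le R _).trans ?_
    have := norm_adv_cut_sub_le hR hρ.le (norm_radial_le hρ U) (Y := 0) (by simpa using hρ.le)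
    simp only [map_zero, adv_zero, sub_zero] at this
    exact this.trans (mul_le_mul_of_nonneg_left (norm_radial_le hρ U) hc0)

/-- The field commutes with conjugation, so the reflected solution solves the same equation; by
uniqueness real data have real solutions. -/
lemma reflCLM_galerkinField {R ρ : ℝ} (U : L2) :
    reflCLM (galerkinField R ρ U) = galerkinField R ρ (reflCLM U) := by
  have h := isH2_cut R (radial ρ U)
  have h1 : reflCLM (radial ρ U) = radial ρ (reflCLM U) := by
    unfold radial radialFactor
    rw [map_smul, norm_reflCLM]
  unfold galerkinField
  rw [map_neg, reflCLM_cut, reflCLM_adv h h, reflCLM_cut, h1]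

lemma BddWeight.wr_smul {ω : ℝ → ℝ} (h : BddWeight ω) {c : ℝ} (hc : 0 ≤ c) (U : L2) :
    wr ω (c • U : L2) = c * wr ω U := by
  rw [← h.norm_mulCLM, ← h.norm_mulCLM, map_smul, norm_smul, Real.norm_of_nonneg hc]

lemma BddWeight.energyIP_smul {ω : ℝ → ℝ} (h : BddWeight ω) (c : ℝ) (U V : L2) :
    energyIP ω (c • U : L2) V = c * energyIP ω U V := by
  simp only [← h.inner_mulCLM, map_smul, real_inner_smul_left]

lemma BddWeight.wr_mono {ω : ℝ → ℝ} (h : BddWeight ω) {U V : L2}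
    (hle : wnorm ω U ≤ wnorm ω V) : wr ω U ≤ wr ω V :=
  ENNReal.toReal_mono (h.wnorm_lt_top V).ne hle

/-- With `l` the factor of the retraction, testing with `l • U` instead of `U` and moving the
cut-off to the other side turns the expression into the Burgers energy of the band-limited `Z = cut
R (radial ρ U)`. For such `Z` the truncation at `R ^ r` is inactive, so the truncated norm controls
the L¹ norm. The surplus factor `l² ≤ 1` is discarded. -/
lemma two_energyIP_galerkinField_le {m : ℕ} {r R ρ : ℝ} (hr : 3 / 2 < r) (hrm : r ≤ m)
    (hR : 1 ≤ R) (hρ : 0 < ρ) {U : L2} (hU : Herm U) :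
    2 * energyIP (fun ξ => min (bw r ξ) (R ^ r)) U (galerkinField R ρ U) ≤
      3 * energyConst m * (embConst (r - 1)).toReal *
        wr (fun ξ => min (bw r ξ) (R ^ r)) U ^ 3 := by
  have hr0 : 0 ≤ r := by linarith
  have hω : IsWeight m (bw r) := isWeight_bw hr0 hrm
  have hRr : 0 ≤ R ^ r := by positivity
  have hb := hω.bddWeight_min hRr
  have hC := energyConst_nonneg m
  have he : 0 ≤ (embConst (r - 1)).toReal := ENNReal.toReal_nonneg
  set ν : ℝ → ℝ := fun ξ => min (bw r ξ) (R ^ r) with hν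
  set l := radialFactor ρ U with hl
  have hl0 : 0 < l := radialFactor_pos hρ U
  have hl1 : l ≤ 1 := radialFactor_le_one hρ U
  set Z := cut R (radial ρ U) with hZ
  have hZ2 : IsH2 Z := isH2_cut R _
  have hZh : Herm Z := by
    refine Herm.cut ?_
    rw [herm_iff_reflCLM] at hU ⊢
    unfold radial
    rw [map_smul, hU]
  set q := wr ν U with hq
  have hq0 : 0 ≤ q := wr_nonneg _ _
  have hZq : wr ν Z ≤ l * q := by
    rw [hq, ← hb.wr_smul hl0.le]
    exact hb.wr_mono (wnorm_cut_le R _)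
  have hlZ : lnorm (bw 1) Z ≤ ENNReal.ofReal ((embConst (r - 1)).toReal * (l * q)) := by
    refine lnorm_one_le hr (measurable_coe Z) ((wnorm_bw_cut_le hr0 _).trans ?_)
    rw [← hb.ofReal_wr]
    exact ENNReal.ofReal_le_ofReal hZq
  have h1 := hb.two_energyIP_adv_le hC hC (hω.min_const hRr).symbolBound hZ2 hZ2 hZh
    (by positivity) (by positivity) hlZ hlZ
  have h2 : l * energyIP ν U (galerkinField R ρ U) = -energyIP ν Z (adv Z Z) := by
    rw [← hb.energyIP_smul]
    change energyIP ν ((radial ρ U : L2) : ℝ → ℂ) ((-cut R (adv Z Z) : L2) : ℝ → ℂ) = _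
    rw [hb.energyIP_neg, energyIP_cut]
  have h3 := neg_abs_le (2 * energyIP ν Z (adv Z Z))
  have h4 : wr ν Z ^ 2 ≤ (l * q) ^ 2 := pow_le_pow_left₀ (wr_nonneg _ _) hZq 2
  set e := (embConst (r - 1)).toReal with he'
  have h5 : l * (2 * energyIP ν U (galerkinField R ρ U)) ≤
      l * (3 * energyConst m * e * q ^ 3) := by
    have hk : 0 ≤ energyConst m * (e * (l * q)) := by positivity
    calc l * (2 * energyIP ν U (galerkinField R ρ U)) = -(2 * energyIP ν Z (adv Z Z)) := by
          linear_combination 2 * h2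
      _ ≤ 3 * (energyConst m * (e * (l * q))) * wr ν Z ^ 2 := by linarith
      _ ≤ 3 * (energyConst m * (e * (l * q))) * (l * q) ^ 2 := by gcongr
      _ = l * (3 * energyConst m * e * q ^ 3) * l ^ 2 := by ring
      _ ≤ l * (3 * energyConst m * e * q ^ 3) * 1 := by
          gcongr
          exact pow_le_one₀ hl0.le hl1
      _ = _ := mul_one _
  exact le_of_mul_le_mul_left h5 hl0

/-- The Galerkin approximations exist on a time interval that does not depend on the cut-off. -/
lemma exists_galerkin {m : ℕ} {r R a σ : ℝ} (hr : 3 / 2 < r) (hrm : r ≤ m) (hR : 1 ≤ R)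
    (ha : 0 < a) (hσ : 0 < σ)
    (haσ : 8 * energyConst m * (embConst (r - 1)).toReal * a * σ < 1) {f : L2}
    (hf : Herm f) (hfr : wnorm (bw r) f ≤ ENNReal.ofReal a) :
    ∃ V : ℝ → L2, V 0 = cut R f ∧ (∀ t ∈ Icc 0 σ, HasDerivAt V (-cut R (adv (V t) (V t))) t) ∧
      ∀ t ∈ Icc 0 σ, cut R (V t) = V t ∧ Herm (V t) ∧
        wnorm (bw r) (V t) ≤ ENNReal.ofReal (2 * a) := by
  have hr0 : 0 ≤ r := by linarith
  have hρ : 0 < 2 * a := by positivity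
  have hR0 : 0 ≤ R := by linarith
  obtain ⟨K, L, hK, hL⟩ := galerkinField_lipschitz hR0 hρ
  obtain ⟨U, hU0, hU⟩ := exists_hasDerivAt_of_bdd_lipschitz hK hL hσ.le f
  have hcont : ContinuousOn U (Icc 0 σ) := fun t ht => (hU t ht).continuousAt.continuousWithinAt
  have hherm : ∀ t ∈ Icc 0 σ, Herm (U t) := by
    have h1 := ODE_solution_unique (v := fun _ => galerkinField R (2 * a)) (K := K)
      (f := fun t => reflCLM (U t)) (g := U) (a := 0) (b := σ) (fun _ => hK)
      (reflCLM.continuous.comp_continuousOn hcont) (fun t ht => by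
        have := reflCLM.hasFDerivAt.comp_hasDerivAt t (hU t (Ico_subset_Icc_self ht))
        rw [reflCLM_galerkinField] at this
        exact this.hasDerivWithinAt) hcont
      (fun t ht => (hU t (Ico_subset_Icc_self ht)).hasDerivWithinAt) (by
        simp only [hU0]; exact (herm_iff_reflCLM f).1 hf)
    exact fun t ht => (herm_iff_reflCLM _).2 (h1 ht)
  have hω : IsWeight m (bw r) := isWeight_bw hr0 hrm
  have hRr : 0 ≤ R ^ r := by positivity
  have hb := hω.bddWeight_min hRr
  have hC := energyConst_nonneg m
  set ν : ℝ → ℝ := fun ξ => min (bw r ξ) (R ^ r) with hν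
  set e := (embConst (r - 1)).toReal with he'
  have he : 0 ≤ e := ENNReal.toReal_nonneg
  have hB : ∀ t ∈ Icc 0 σ, wr ν (U t) ≤ 2 * a := by
    -- The linear barrier rises from `a²` at time 0 to `(2a)²` at time `σ`. Where the energy touches
    -- it, the norm is at most `2a`, and `haσ` makes the slope of the energy strictly smaller than
    -- that of the barrier.
    have hfence := image_le_of_deriv_right_lt_deriv_boundary' (a := 0) (b := σ)
      (f := fun t => wr ν (U t) ^ 2)
      (f' := fun t => 2 * energyIP ν (U t) (galerkinField R (2 * a) (U t)))
      ((hb.continuousOn_wr hcont).pow 2)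
      (fun t ht => (hb.hasDerivAt_sq (hU t (Ico_subset_Icc_self ht))).hasDerivWithinAt)
      (B := fun t => a ^ 2 * (1 + 3 * t / σ)) (B' := fun _ => a ^ 2 * (3 / σ)) (by
        simp only [mul_zero, zero_div, add_zero, mul_one, hU0]
        refine pow_le_pow_left₀ (wr_nonneg _ _) ?_ 2
        exact ENNReal.toReal_le_of_le_ofReal ha.le
          ((wnorm_mono (fun ξ => min_le_left _ _) _).trans hfr))
      (Continuous.continuousOn (by fun_prop)) (fun t _ => by
        have h1 : HasDerivAt (fun t : ℝ => a ^ 2 * (1 + 3 * t / σ)) (a ^ 2 * (3 / σ)) t := by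
          have h2 := ((((hasDerivAt_id t).const_mul 3).div_const σ).const_add 1).const_mul (a ^ 2)
          exact h2.congr_deriv (by simp)
        exact h1.hasDerivWithinAt) (fun t ht heq => by
        have hq0 := wr_nonneg ν (U t)
        have h4 : wr ν (U t) ^ 2 ≤ (2 * a) ^ 2 := by
          rw [heq]
          have h5 : t / σ ≤ 1 := (div_le_one hσ).2 ht.2.le
          have h6 : a ^ 2 * (t / σ) ≤ a ^ 2 * 1 := by gcongr
          calc a ^ 2 * (1 + 3 * t / σ) = a ^ 2 + 3 * (a ^ 2 * (t / σ)) := by ring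
            _ ≤ (2 * a) ^ 2 := by linarith
        have h5 : wr ν (U t) ≤ 2 * a := abs_le_of_sq_le_sq' h4 (by positivity) |>.2
        have h6 := two_energyIP_galerkinField_le hr hrm hR hρ (hherm t (Ico_subset_Icc_self ht))
        have h7 : wr ν (U t) ^ 3 ≤ (2 * a) ^ 3 := pow_le_pow_left₀ hq0 h5 3
        calc 2 * energyIP ν (U t) (galerkinField R (2 * a) (U t))
            ≤ 3 * energyConst m * e * wr ν (U t) ^ 3 := h6
          _ ≤ 3 * energyConst m * e * (2 * a) ^ 3 := by gcongr
          _ = (8 * energyConst m * e * a * σ) * (a ^ 2 * (3 / σ)) := by field_simp; ring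
          _ < 1 * (a ^ 2 * (3 / σ)) := by gcongr
          _ = _ := one_mul _)
    intro t ht
    have h1 := hfence ht
    have h4 : wr ν (U t) ^ 2 ≤ (2 * a) ^ 2 := by
      refine h1.trans ?_
      have h5 : t / σ ≤ 1 := (div_le_one hσ).2 ht.2
      have h6 : a ^ 2 * (t / σ) ≤ a ^ 2 * 1 := by gcongr
      calc a ^ 2 * (1 + 3 * t / σ) = a ^ 2 + 3 * (a ^ 2 * (t / σ)) := by ring
        _ ≤ (2 * a) ^ 2 := by linarith
    exact abs_le_of_sq_le_sq' h4 (by positivity) |>.2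
  have hnorm : ∀ t ∈ Icc 0 σ, ‖U t‖ ≤ 2 * a := fun t ht => by
    refine le_trans ?_ (hB t ht)
    rw [← wr_one]
    refine ENNReal.toReal_mono (hb.wnorm_lt_top _).ne (wnorm_mono (fun ξ => ?_) _)
    exact le_min (one_le_bw hr0 ξ) (Real.one_le_rpow hR hr0)
  -- The solution `U` itself starts from the uncut `f`. Since `‖U t‖ ≤ 2a` the retraction is
  -- inactive, and the projection of `U` solves the Galerkin equation.
  refine ⟨fun t => cut R (U t), by simp only [hU0], fun t ht => ?_, fun t ht =>
    ⟨cut_cut R _, (hherm t ht).cut, ?_⟩⟩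
  · have h1 := (cut R).hasFDerivAt.comp_hasDerivAt t (hU t ht)
    refine h1.congr_deriv ?_
    unfold galerkinField
    rw [radial_of_norm_le hρ (hnorm t ht), map_neg, cut_cut]
  · refine (wnorm_bw_cut_le hr0 _).trans ((wnorm_cut_le R _).trans ?_)
    rw [← hb.ofReal_wr]
    exact ENNReal.ofReal_le_ofReal (hB t ht)

end

/-! ### Passage to the limit and local existence for Burgers' equation -/

noncomputable section

/-- Interpolation by Cauchy–Schwarz. It converts convergence in L² with bounds in H² into
convergence in H¹, as the nonlinearity demands. -/
lemma wnorm_bw_one_sq_le (U : L2) : wnorm (bw 1) U ^ (2 : ℝ) ≤ ‖U‖ₑ * wnorm (bw 2) U := by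
  have mU := measurable_coe U
  have mb := measurable_bw 2
  have h := lintegral_mul_le_norm2 (f := fun ξ => ‖U ξ‖ₑ)
    (g := fun ξ => ENNReal.ofReal (bw 2 ξ) * ‖U ξ‖ₑ) (by fun_prop) (by fun_prop)
  rw [norm2_coe] at h
  refine le_trans (le_of_eq ?_) h
  rw [wnorm, norm2_sq]
  refine lintegral_congr fun ξ => ?_
  have e : bw 2 ξ = bw 1 ξ * bw 1 ξ := by rw [← bw_add]; norm_num
  rw [e, ENNReal.ofReal_mul (bw_pos _ _).le, ENNReal.rpow_two]
  ring

lemma wnorm_bw_one_le_sqrt {S : ℝ} {U : L2} (h : wnorm (bw 2) U ≤ ENNReal.ofReal S) :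
    wnorm (bw 1) U ≤ ENNReal.ofReal (Real.sqrt S * Real.sqrt ‖U‖) := by
  have h1 := (wnorm_bw_one_sq_le U).trans (mul_le_mul' le_rfl h)
  rw [← ENNReal.rpow_le_rpow_iff (by norm_num : (0 : ℝ) < 2)]
  refine h1.trans ?_
  rcases le_total S 0 with hS | hS
  · simp [ENNReal.ofReal_of_nonpos hS]
  rw [ENNReal.ofReal_rpow_of_nonneg (by positivity) (by norm_num), Real.rpow_two, mul_pow,
    Real.sq_sqrt hS, Real.sq_sqrt (norm_nonneg _), ENNReal.ofReal_mul hS, ofReal_norm, mul_comm]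

/-- The nonlinearity is Hölder continuous in `L²` on bounded subsets of `H²`. -/
lemma norm_adv_sub_le {S : ℝ} (hS : 0 ≤ S) {U V : L2} (hU : wnorm (bw 2) U ≤ ENNReal.ofReal S)
    (hV : wnorm (bw 2) V ≤ ENNReal.ofReal S) :
    ‖adv U U - adv V V‖ ≤ (2 * (embConst 1).toReal * S * Real.sqrt (2 * S)) * Real.sqrt ‖U - V‖ := by
  have hU2 : IsH2 U := hU.trans_lt ENNReal.ofReal_lt_top
  have hV2 : IsH2 V := hV.trans_lt ENNReal.ofReal_lt_top
  have he : 0 ≤ (embConst 1).toReal := ENNReal.toReal_nonneg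
  have hD : wnorm (bw 2) (U - V : L2) ≤ ENNReal.ofReal (2 * S) := by
    refine (wnorm_sub_le (measurable_bw 2) U V).trans ((add_le_add hU hV).trans (le_of_eq ?_))
    rw [← ENNReal.ofReal_add hS hS]
    ring_nf
  have hD0 : ‖U - V‖ ≤ Real.sqrt (2 * S) * Real.sqrt ‖U - V‖ := by
    have h1 : ‖U - V‖ ≤ 2 * S := by
      have h2 := (enorm_le_wnorm_bw (by norm_num) (U - V)).trans hD
      rw [← ofReal_norm] at h2
      exact (ENNReal.ofReal_le_ofReal_iff (by positivity)).1 h2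
    calc ‖U - V‖ = Real.sqrt ‖U - V‖ * Real.sqrt ‖U - V‖ := (Real.mul_self_sqrt (norm_nonneg _)).symm
      _ ≤ _ := by gcongr
  rw [adv_self_sub hU2 hV2]
  have h1 := norm_adv_le_left hU2 (hU2.sub hV2) (by positivity) (by positivity)
    (lnorm_le_of_bw_two (measurable_coe U) hU) (wnorm_bw_one_le_sqrt hD)
  have h2 := norm_adv_le_right (hU2.sub hV2) hV2 (by positivity)
    (lnorm_le_of_bw_two (measurable_coe V) hV)
  have h3 := mul_le_mul_of_nonneg_left hD0 (by positivity : 0 ≤ (embConst 1).toReal * S)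
  refine (norm_add_le _ _).trans ?_
  linarith

lemma tendsto_adv {ι : Type*} {l : Filter ι} {S : ℝ} (hS : 0 ≤ S) {U : ι → L2} {V : L2}
    (h : Tendsto U l (𝓝 V)) (hU : ∀ᶠ i in l, wnorm (bw 2) (U i) ≤ ENNReal.ofReal S)
    (hV : wnorm (bw 2) V ≤ ENNReal.ofReal S) :
    Tendsto (fun i => adv (U i) (U i)) l (𝓝 (adv V V)) := by
  rw [tendsto_iff_norm_sub_tendsto_zero] at h ⊢
  have h1 : Tendsto (fun i => (2 * (embConst 1).toReal * S * Real.sqrt (2 * S)) *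
      Real.sqrt ‖U i - V‖) l (𝓝 0) := by
    have := ((Real.continuous_sqrt.tendsto 0).comp h).const_mul
      (2 * (embConst 1).toReal * S * Real.sqrt (2 * S))
    simpa using this
  refine squeeze_zero' (Eventually.of_forall fun _ => norm_nonneg _) ?_ h1
  filter_upwards [hU] with i hi
  exact norm_adv_sub_le hS hi hV

lemma continuousOn_adv {X : Type*} [TopologicalSpace X] {S : ℝ} (hS : 0 ≤ S) {U : X → L2}
    {s : Set X} (h : ContinuousOn U s) (hU : ∀ t ∈ s, wnorm (bw 2) (U t) ≤ ENNReal.ofReal S) :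
    ContinuousOn (fun t => adv (U t) (U t)) s := fun t ht =>
  tendsto_adv hS (h t ht) (eventually_nhdsWithin_of_forall hU) (hU t ht)

/-- A derivative in the open interval that extends continuously to the closed interval. -/
lemma hasDerivWithinAt_Icc_of_Ioo {E : Type*} [NormedAddCommGroup E] [NormedSpace ℝ E]
    {U U' : ℝ → E} {σ : ℝ} (hσ : 0 < σ) (hU : ContinuousOn U (Icc 0 σ))
    (hU' : ContinuousOn U' (Icc 0 σ)) (hd : ∀ t ∈ Ioo 0 σ, HasDerivAt U (U' t) t) {t : ℝ}
    (ht : t ∈ Icc 0 σ) : HasDerivWithinAt U (U' t) (Icc 0 σ) t := by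
  have hdiff : DifferentiableOn ℝ U (Ioo 0 σ) := fun t ht =>
    (hd t ht).differentiableAt.differentiableWithinAt
  rcases ht.1.eq_or_lt with h0 | h0
  · subst h0
    refine (hasDerivWithinAt_Ici_of_tendsto_deriv hdiff
      ((hU 0 ht).mono Ioo_subset_Icc_self) (Ioo_mem_nhdsGT hσ) ?_).mono Icc_subset_Ici_self
    have h1 : Tendsto U' (𝓝[Ioo 0 σ] 0) (𝓝 (U' 0)) := (hU' 0 ht).mono Ioo_subset_Icc_self
    rw [nhdsWithin_Ioo_eq_nhdsGT hσ] at h1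
    refine h1.congr' ?_
    filter_upwards [Ioo_mem_nhdsGT hσ] with x hx using (hd x hx).deriv.symm
  rcases ht.2.eq_or_lt with h1 | h1
  · subst h1
    refine (hasDerivWithinAt_Iic_of_tendsto_deriv hdiff
      ((hU t ht).mono Ioo_subset_Icc_self) (Ioo_mem_nhdsLT hσ) ?_).mono Icc_subset_Iic_self
    have h1 : Tendsto U' (𝓝[Ioo 0 t] t) (𝓝 (U' t)) := (hU' t ht).mono Ioo_subset_Icc_self
    rw [nhdsWithin_Ioo_eq_nhdsLT hσ] at h1
    refine h1.congr' ?_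
    filter_upwards [Ioo_mem_nhdsLT hσ] with x hx using (hd x hx).deriv.symm
  · exact (hd t ⟨h0, h1⟩).hasDerivWithinAt

lemma wnorm_bw_one_adv_le {S : ℝ} (hS : 0 ≤ S) {U : L2}
    (hU : wnorm (bw 2) U ≤ ENNReal.ofReal S) :
    wnorm (bw 1) (adv U U) ≤ ENNReal.ofReal (4 * (embConst 1).toReal * S ^ 2) := by
  have hU2 : IsH2 U := hU.trans_lt ENNReal.ofReal_lt_top
  have he : 0 ≤ (embConst 1).toReal := ENNReal.toReal_nonneg
  have hl := lnorm_le_of_bw_two (measurable_coe U) hU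
  have h1 : wnorm (bw 1) U ≤ ENNReal.ofReal S := (wnorm_bw_mono (by norm_num) U).trans hU
  have e2 : (fun ξ => bw 1 ξ * bw 1 ξ) = bw 2 := by ext ξ; rw [← bw_add]; norm_num
  refine (wnorm_adv_le (m := 1) (isWeight_bw (by norm_num) (by norm_num)) hU2 hU2).trans ?_
  rw [e2]
  calc _ ≤ 2 ^ 1 * (ENNReal.ofReal S * ENNReal.ofReal ((embConst 1).toReal * S) +
        ENNReal.ofReal ((embConst 1).toReal * S) * ENNReal.ofReal S) := by gcongr
    _ = ENNReal.ofReal (4 * (embConst 1).toReal * S ^ 2) := by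
        rw [← ENNReal.ofReal_mul hS, ← ENNReal.ofReal_mul (by positivity),
          ← ENNReal.ofReal_add (by positivity) (by positivity), pow_one,
          ← ENNReal.ofReal_ofNat 2, ← ENNReal.ofReal_mul (by norm_num)]
        congr 1
        ring

lemma norm_sub_cut_le_of_bw_one {R Q : ℝ} (hR : 0 < R) {U : L2} (hQ : 0 ≤ Q)
    (h : wnorm (bw 1) U ≤ ENNReal.ofReal Q) : ‖U - cut R U‖ ≤ Q * R⁻¹ := by
  have h1 := (norm_sub_cut_le hR U).trans (mul_le_mul' le_rfl h)
  rw [← ofReal_norm, ← ENNReal.ofReal_mul (by positivity), mul_comm] at h1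
  exact (ENNReal.ofReal_le_ofReal_iff (by positivity)).1 h1

/-- The distance of two Galerkin approximations. -/
lemma norm_galerkin_sub_le {σ b S R R' : ℝ} (hb : 0 ≤ b) (hS : 0 ≤ S)
    (hR : 0 < R) (hR' : 0 < R') {f : L2} {V W : ℝ → L2}
    (hV0 : V 0 = cut R f) (hW0 : W 0 = cut R' f)
    (hV : ∀ t ∈ Icc 0 σ, HasDerivAt V (-cut R (adv (V t) (V t))) t)
    (hW : ∀ t ∈ Icc 0 σ, HasDerivAt W (-cut R' (adv (W t) (W t))) t)
    (hVh : ∀ t ∈ Icc 0 σ, Herm (V t))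
    (hVb : ∀ t ∈ Icc 0 σ, lnorm (bw 1) (V t) ≤ ENNReal.ofReal b)
    (hWb : ∀ t ∈ Icc 0 σ, lnorm (bw 1) (W t) ≤ ENNReal.ofReal b)
    (hVS : ∀ t ∈ Icc 0 σ, wnorm (bw 2) (V t) ≤ ENNReal.ofReal S)
    (hWS : ∀ t ∈ Icc 0 σ, wnorm (bw 2) (W t) ≤ ENNReal.ofReal S)
    (hf : wnorm (bw 2) f ≤ ENNReal.ofReal S) {t : ℝ} (ht : t ∈ Icc 0 σ) :
    ‖V t - W t‖ ≤ Real.sqrt (Real.exp ((b + 2 * b + 1) * σ) *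
      (S ^ 2 + (4 * (embConst 1).toReal * S ^ 2) ^ 2 * σ)) * (R⁻¹ + R'⁻¹) := by
  have he : 0 ≤ (embConst 1).toReal := ENNReal.toReal_nonneg
  set Q := 4 * (embConst 1).toReal * S ^ 2 with hQ
  have hQ0 : 0 ≤ Q := by positivity
  have hσ : 0 ≤ σ := ht.1.trans ht.2
  have toH2 : ∀ {Z : L2}, wnorm (bw 2) Z ≤ ENNReal.ofReal S → IsH2 Z := fun h =>
    h.trans_lt ENNReal.ofReal_lt_top
  -- Both approximations are viewed as solutions of Burgers' equation itself; the forcing collects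
  -- the frequencies removed by the cut-offs, which are `O(R⁻¹)` in L² because the nonlinearity is
  -- bounded in H¹.
  have key := norm_sq_difference_le (σ := σ) (a := b) (b := b) (φ := Q * (R⁻¹ + R'⁻¹))
    (D := fun t => V t - W t) (X := fun _ => 0) (U := V) (V := W)
    (F := fun t => (adv (V t) (V t) - cut R (adv (V t) (V t))) -
      (adv (W t) (W t) - cut R' (adv (W t) (W t)))) hb hb
    (fun t ht => ((hV t ht).continuousAt.sub (hW t ht).continuousAt).continuousWithinAt)
    (fun t ht => by
      have ht' := Ioo_subset_Icc_self ht
      refine ((hV t ht').sub (hW t ht')).congr_deriv ?_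
      rw [← adv_self_sub (toH2 (hVS t ht')) (toH2 (hWS t ht'))]
      abel)
    (fun t ht => (toH2 (hVS t (Ioo_subset_Icc_self ht))).sub
      (toH2 (hWS t (Ioo_subset_Icc_self ht))))
    (fun t ht => toH2 (hVS t (Ioo_subset_Icc_self ht)))
    (fun t ht => toH2 (hWS t (Ioo_subset_Icc_self ht)))
    (fun t ht => hVh t (Ioo_subset_Icc_self ht))
    (fun t ht => hVb t (Ioo_subset_Icc_self ht))
    (fun t ht => hWb t (Ioo_subset_Icc_self ht))
    (fun t ht => by
      have ht' := Ioo_subset_Icc_self ht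
      refine (norm_sub_le _ _).trans ?_
      rw [mul_add]
      exact add_le_add (norm_sub_cut_le_of_bw_one hR hQ0 (wnorm_bw_one_adv_le hS (hVS t ht')))
        (norm_sub_cut_le_of_bw_one hR' hQ0 (wnorm_bw_one_adv_le hS (hWS t ht'))))
    (fun t _ => by
      rw [← BddWeight.one.inner_mulCLM, map_zero, inner_zero_right]) ht
  have h0 : ‖V 0 - W 0‖ ≤ S * (R⁻¹ + R'⁻¹) := by
    have hf1 : wnorm (bw 1) f ≤ ENNReal.ofReal S := (wnorm_bw_mono (by norm_num) f).trans hf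
    have e : V 0 - W 0 = (f - cut R' f) - (f - cut R f) := by rw [hV0, hW0]; abel
    rw [e, mul_add]
    refine (norm_sub_le _ _).trans ?_
    have h1 := norm_sub_cut_le_of_bw_one hR hS hf1
    have h2 := norm_sub_cut_le_of_bw_one hR' hS hf1
    linarith
  refine abs_le_of_sq_le_sq' ?_ (by positivity) |>.2
  rw [mul_pow, Real.sq_sqrt (by positivity)]
  refine key.trans ?_
  have h2 : ‖V 0 - W 0‖ ^ 2 ≤ (S * (R⁻¹ + R'⁻¹)) ^ 2 := pow_le_pow_left₀ (norm_nonneg _) h0 2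
  have h3 := ht.2
  calc _ ≤ Real.exp ((b + 2 * b + 1) * σ) *
        ((S * (R⁻¹ + R'⁻¹)) ^ 2 + (Q * (R⁻¹ + R'⁻¹)) ^ 2 * σ) := by
        have := ht.1
        gcongr
    _ = _ := by ring

/-- Local existence for Burgers' equation. -/
theorem exists_burgers {m : ℕ} {r a σ : ℝ} (hr : 3 / 2 < r) (hrm : r ≤ m) (hm : 2 ≤ m)
    (ha : 0 < a) (hσ : 0 < σ)
    (haσ : 8 * energyConst m * (embConst (r - 1)).toReal * a * σ < 1) {f : L2}
    (hf : Herm f) (hfr : wnorm (bw r) f ≤ ENNReal.ofReal a) (hf2 : IsH2 f) :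
    ∃ U : ℝ → L2, U 0 = f ∧ IsBurgers σ U ∧
      (∀ t ∈ Icc 0 σ, HasDerivWithinAt U (-adv (U t) (U t)) (Icc 0 σ) t) ∧
      ∀ t ∈ Icc 0 σ, wnorm (bw r) (U t) ≤ ENNReal.ofReal (2 * a) := by
  have hpos : ∀ n : ℕ, (0 : ℝ) < n + 1 := fun n => by positivity
  have hG := fun n : ℕ => exists_galerkin (R := n + 1) hr hrm
    (by linarith [(Nat.cast_nonneg n : (0 : ℝ) ≤ n)]) ha hσ haσ hf hfr
  choose V hV0 hV hVp using hG
  set e := (embConst (r - 1)).toReal with he'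
  have he : 0 ≤ e := ENNReal.toReal_nonneg
  set b := e * (2 * a) with hb'
  have hb : 0 ≤ b := by positivity
  have hVb : ∀ n, ∀ t ∈ Icc 0 σ, lnorm (bw 1) (V n t) ≤ ENNReal.ofReal b := fun n t ht =>
    lnorm_one_le hr (measurable_coe _) (hVp n t ht).2.2
  have hVH : ∀ n, ∀ t ∈ Icc 0 σ, IsH2 (V n t) := fun n t ht => by
    rw [← (hVp n t ht).1]; exact isH2_cut _ _
  have hC := energyConst_nonneg m
  have hw2 : IsWeight m (bw 2) := isWeight_bw (by norm_num) (by exact_mod_cast hm)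
  -- The H^r bound does not give H² when `r < 2`. Persistence of regularity supplies an H² bound,
  -- uniform in the cut-off, on the same time interval.
  set S := Real.exp (2 * energyConst m * b * σ) * (wnorm (bw 2) f).toReal with hS'
  have hS : 0 ≤ S := by positivity
  have hVS : ∀ n, ∀ t ∈ Icc 0 σ, wnorm (bw 2) (V n t) ≤ ENNReal.ofReal S := by
    intro n t ht
    have h1 := wnorm_le_of_energyIP (U := V n)
      (fun t ht => (hV n t ht).continuousAt.continuousWithinAt)
      (fun t ht => hV n t (Ioo_subset_Icc_self ht)) (fun t ht ω hω => by
        rw [hω.energyIP_neg, energyIP_cut, (hVp n t (Ioo_subset_Icc_self ht)).1])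
      (hVH n) (fun t ht => (hVp n t ht).2.1) hb (hVb n) hw2 ht
    refine h1.trans ?_
    rw [hV0, hS', ENNReal.ofReal_mul (Real.exp_pos _).le, ENNReal.ofReal_toReal hf2.ne]
    have h2 := ht.2
    gcongr
    exact wnorm_cut_le _ _
  have hfS : wnorm (bw 2) f ≤ ENNReal.ofReal S := by
    rw [hS', ENNReal.ofReal_mul (Real.exp_pos _).le, ENNReal.ofReal_toReal hf2.ne]
    refine le_mul_of_one_le_left' ?_
    rw [← ENNReal.ofReal_one]
    exact ENNReal.ofReal_le_ofReal (Real.one_le_exp (by positivity))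
  set Λ := Real.sqrt (Real.exp ((b + 2 * b + 1) * σ) *
      (S ^ 2 + (4 * (embConst 1).toReal * S ^ 2) ^ 2 * σ)) with hΛ
  have hΛ0 : 0 ≤ Λ := Real.sqrt_nonneg _
  have hdist : ∀ n k N : ℕ, N ≤ n → N ≤ k → ∀ t ∈ Icc 0 σ,
      ‖V n t - V k t‖ ≤ 2 * Λ * ((N : ℝ) + 1)⁻¹ := by
    intro n k N hn hk t ht
    have h1 := norm_galerkin_sub_le hb hS (hpos n) (hpos k) (hV0 n) (hV0 k) (hV n) (hV k)
      (fun t ht => (hVp n t ht).2.1) (hVb n) (hVb k) (hVS n) (hVS k) hfS ht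
    refine h1.trans ?_
    have h2 : ((n : ℝ) + 1)⁻¹ ≤ ((N : ℝ) + 1)⁻¹ := by gcongr
    have h3 : ((k : ℝ) + 1)⁻¹ ≤ ((N : ℝ) + 1)⁻¹ := by gcongr
    calc Λ * (((n : ℝ) + 1)⁻¹ + ((k : ℝ) + 1)⁻¹) ≤ Λ * (((N : ℝ) + 1)⁻¹ + ((N : ℝ) + 1)⁻¹) := by
          gcongr
      _ = _ := by ring
  have hlim0 : Tendsto (fun N : ℕ => 2 * Λ * ((N : ℝ) + 1)⁻¹) atTop (𝓝 0) := by
    have := (tendsto_one_div_add_atTop_nhds_zero_nat (𝕜 := ℝ)).const_mul (2 * Λ)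
    simpa using this
  have hex : ∀ t, ∃ u, t ∈ Icc 0 σ → Tendsto (fun n => V n t) atTop (𝓝 u) := by
    intro t
    by_cases ht : t ∈ Icc 0 σ
    · obtain ⟨u, hu⟩ := cauchySeq_tendsto_of_complete (cauchySeq_of_le_tendsto_0 (s := fun n => V n t) _
        (fun n k N hn hk => by rw [dist_eq_norm]; exact hdist n k N hn hk t ht) hlim0)
      exact ⟨u, fun _ => hu⟩
    · exact ⟨0, fun h => absurd h ht⟩
  choose U hU using hex
  have hUS : ∀ t ∈ Icc 0 σ, wnorm (bw 2) (U t) ≤ ENNReal.ofReal S := fun t ht =>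
    wnorm_le_of_tendsto hw2 (hU t ht) (Eventually.of_forall fun n => hVS n t ht)
  have hVU : ∀ n : ℕ, ∀ t ∈ Icc 0 σ, ‖V n t - U t‖ ≤ 2 * Λ * ((n : ℝ) + 1)⁻¹ := by
    intro n t ht
    have h1 : Tendsto (fun k => ‖V n t - V k t‖) atTop (𝓝 ‖V n t - U t‖) :=
      ((tendsto_const_nhds (x := V n t)).sub (hU t ht)).norm
    refine le_of_tendsto h1 ?_
    filter_upwards [eventually_ge_atTop n] with k hk
    exact hdist n k n le_rfl hk t ht
  have hunif : TendstoUniformlyOn V U atTop (Icc 0 σ) := by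
    rw [Metric.tendstoUniformlyOn_iff]
    intro ε hε
    filter_upwards [hlim0.eventually_lt_const hε] with n hn t ht
    rw [dist_comm, dist_eq_norm]
    exact (hVU n t ht).trans_lt hn
  have hcont : ContinuousOn U (Icc 0 σ) := hunif.continuousOn (Frequently.of_forall fun n t ht =>
    (hV n t ht).continuousAt.continuousWithinAt)
  have hcadv := continuousOn_adv hS hcont hUS
  have hderiv : ∀ t ∈ Ioo 0 σ, HasDerivAt U (-adv (U t) (U t)) t := by
    intro t ht
    -- The time derivatives converge uniformly: the nonlinearity is Hölder continuous on H²-bounded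
    -- sets and the cut-off error is `O(1/n)`. The endpoints follow later from continuity of the
    -- limiting derivative.
    refine hasDerivAt_of_tendstoUniformlyOn (f := V) (l := atTop) isOpen_Ioo (f' := fun n t =>
      -cut ((n : ℝ) + 1) (adv (V n t) (V n t))) (g' := fun t => -adv (U t) (U t)) ?_
      (Eventually.of_forall fun n t ht => hV n t (Ioo_subset_Icc_self ht))
      (fun t ht => hU t (Ioo_subset_Icc_self ht)) ht
    rw [Metric.tendstoUniformlyOn_iff]
    intro ε hε
    set H := 2 * (embConst 1).toReal * S * Real.sqrt (2 * S) with hH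
    set Q := 4 * (embConst 1).toReal * S ^ 2 with hQ
    have hl : Tendsto (fun n : ℕ => H * Real.sqrt (2 * Λ * ((n : ℝ) + 1)⁻¹) +
        Q * ((n : ℝ) + 1)⁻¹) atTop (𝓝 0) := by
      have h1 := ((Real.continuous_sqrt.tendsto 0).comp hlim0).const_mul H
      have h2 := (tendsto_one_div_add_atTop_nhds_zero_nat (𝕜 := ℝ)).const_mul Q
      simpa using h1.add h2
    filter_upwards [hl.eventually_lt_const hε] with n hn t ht
    have ht' := Ioo_subset_Icc_self ht
    refine lt_of_le_of_lt ?_ hn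
    rw [dist_eq_norm]
    have e1 : -adv (U t) (U t) - -cut ((n : ℝ) + 1) (adv (V n t) (V n t)) =
        (adv (V n t) (V n t) - adv (U t) (U t)) -
          (adv (V n t) (V n t) - cut ((n : ℝ) + 1) (adv (V n t) (V n t))) := by abel
    rw [e1]
    refine (norm_sub_le _ _).trans (add_le_add ?_ ?_)
    · refine (norm_adv_sub_le hS (hVS n t ht') (hUS t ht')).trans ?_
      gcongr
      exact hVU n t ht'
    · exact norm_sub_cut_le_of_bw_one (hpos n) (by positivity) (wnorm_bw_one_adv_le hS (hVS n t ht'))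
  have h00 : (0 : ℝ) ∈ Icc 0 σ := ⟨le_rfl, hσ.le⟩
  refine ⟨U, ?_, ⟨hcont, hderiv, fun t ht => (hUS t ht).trans_lt ENNReal.ofReal_lt_top,
    fun t ht => Herm.of_tendsto (hU t ht) fun n => (hVp n t ht).2.1⟩,
    fun t ht => hasDerivWithinAt_Icc_of_Ioo hσ hcont hcadv.neg hderiv ht, fun t ht =>
    wnorm_le_of_tendsto (isWeight_bw (by linarith) hrm) (hU t ht)
      (Eventually.of_forall fun n => (hVp n t ht).2.2)⟩
  refine tendsto_nhds_unique (hU 0 h00) ?_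
  rw [tendsto_iff_norm_sub_tendsto_zero]
  have h2 := (tendsto_one_div_add_atTop_nhds_zero_nat (𝕜 := ℝ)).const_mul S
  simp only [mul_zero, one_div] at h2
  refine squeeze_zero (fun _ => norm_nonneg _) (fun n => ?_) h2
  rw [hV0, norm_sub_rev]
  exact norm_sub_cut_le_of_bw_one (hpos n) hS ((wnorm_bw_mono (by norm_num) f).trans hfS)

end

/-! ### The linear flow generated by K -/

noncomputable section

/-- The derivative of exp has modulus at most 1 on the left half-plane, which is convex. Through
this bound the sign of `Re k` makes the estimates for the linear flow insensitive to the size of the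
symbol. -/
lemma norm_exp_sub_exp_le {z w : ℂ} (hz : z.re ≤ 0) (hw : w.re ≤ 0) :
    ‖Complex.exp z - Complex.exp w‖ ≤ ‖z - w‖ := by
  have h := Convex.norm_image_sub_le_of_norm_hasDerivWithin_le (f := Complex.exp)
    (f' := Complex.exp) (C := 1) (s := {z : ℂ | z.re ≤ 0}) (x := w) (y := z)
    (fun x _ => (Complex.hasDerivAt_exp x).hasDerivWithinAt)
    (fun x hx => by rw [Complex.norm_exp]; exact Real.exp_le_one_iff.2 hx)
    (convex_halfSpace_re_le 0) hw hz
  rwa [one_mul] at h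

/-- Dominated convergence in `L²`. -/
lemma tendsto_of_dominated {ι : Type*} {l : Filter ι} [l.IsCountablyGenerated] {F : ι → L2}
    {G : L2} {f : ι → ℝ → ℂ} {g : ℝ → ℂ} {B : ℝ → ℝ≥0∞} (hF : ∀ i, (F i : ℝ → ℂ) =ᵐ[volume] f i)
    (hG : (G : ℝ → ℂ) =ᵐ[volume] g) (hf : ∀ i, Measurable (f i)) (hg : Measurable g)
    (hB : norm2 B < ∞) (hle : ∀ᶠ i in l, ∀ ξ, ‖f i ξ - g ξ‖ₑ ≤ B ξ)
    (hlim : ∀ ξ, Tendsto (fun i => f i ξ) l (𝓝 (g ξ))) : Tendsto F l (𝓝 G) := by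
  rw [tendsto_iff_edist_tendsto_0]
  have e : ∀ i, edist (F i) G = (∫⁻ ξ, ‖f i ξ - g ξ‖ₑ ^ (2 : ℝ)) ^ (1 / 2 : ℝ) := by
    intro i
    rw [edist_eq_enorm_sub, Lp.enorm_def, ← norm2_eq_eLpNorm]
    unfold norm2
    congr 1
    refine lintegral_congr_ae ?_
    filter_upwards [Lp.coeFn_sub (F i) G, hF i, hG] with ξ h1 h2 h3
    rw [h1, Pi.sub_apply, h2, h3]
  simp only [e]
  have h0 : Tendsto (fun i => ∫⁻ ξ, ‖f i ξ - g ξ‖ₑ ^ (2 : ℝ)) l (𝓝 (∫⁻ _ : ℝ, 0)) := by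
    refine tendsto_lintegral_filter_of_dominated_convergence (fun ξ => B ξ ^ (2 : ℝ)) ?_ ?_ ?_ ?_
    · exact Eventually.of_forall fun i => ((hf i).sub hg).enorm.pow_const _
    · filter_upwards [hle] with i hi
      exact Eventually.of_forall fun ξ => ENNReal.rpow_le_rpow (hi ξ) (by norm_num)
    · rw [← norm2_sq]
      exact (ENNReal.rpow_lt_top_of_nonneg (by norm_num) hB.ne).ne
    · refine Eventually.of_forall fun ξ => ?_
      have h1 : Tendsto (fun i => ‖f i ξ - g ξ‖ₑ) l (𝓝 0) := by
        have := ((hlim ξ).sub_const (g ξ)).enorm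
        simpa using this
      have h2 := (ENNReal.continuous_rpow_const (y := 2)).tendsto 0 |>.comp h1
      simpa [Function.comp_def] using h2
  have h2 := (ENNReal.continuous_rpow_const (y := 1 / 2)).tendsto _ |>.comp h0
  simpa [Function.comp_def] using h2

/-- The product rule for a strongly differentiable family of contractions. -/
lemma hasDerivWithinAt_contraction_apply {E : ℝ → L2 →L[ℝ] L2} (hE : ∀ t U, ‖E t U‖ ≤ ‖U‖)
    {b : ℝ → L2} {b' y : L2} {S : Set ℝ} {t : ℝ} (hb : HasDerivWithinAt b b' S t)
    (hy : HasDerivWithinAt (fun r => E r (b t)) y S t)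
    (hc : Tendsto (fun r => E r b') (𝓝 t) (𝓝 (E t b'))) :
    HasDerivWithinAt (fun r => E r (b r)) (y + E t b') S t := by
  -- The family is only strongly continuous. Its contraction property lets `E r` be applied to a
  -- slope of `b` that varies with `r`, since the slope differs from `b'` by something that tends to
  -- 0 in norm.
  have h1 : HasDerivWithinAt (fun r => E r (b r - b t)) (E t b') S t := by
    rw [hasDerivWithinAt_iff_tendsto_slope] at hb ⊢
    have h2 : Tendsto (fun r => E r (slope b t r - b')) (𝓝[S \ {t}] t) (𝓝 0) := by
      refine squeeze_zero_norm (fun r => hE r _) ?_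
      have := (hb.sub_const b').norm
      simpa using this
    have h3 := h2.add (hc.mono_left (nhdsWithin_le_nhds (s := S \ {t})))
    rw [zero_add] at h3
    refine h3.congr fun r => ?_
    rw [← map_add, sub_add_cancel, slope_def_module, slope_def_module, sub_self, map_zero,
      sub_zero, map_smul]
  have h2 := hy.add h1
  refine h2.congr (fun r _ => ?_) ?_
  · simp
  · simp

/-- The symbol of `e^{tK}`, on the Fourier side and extended by `1` to `t < 0`. -/
def flowSymbol (k : ℝ → ℂ) (t ξ : ℝ) : ℂ :=
  Complex.exp (((max t 0 : ℝ) : ℂ) * k (2 * Real.pi * ξ))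

/-- The operator `K` on the Fourier side. -/
def kMul (k : ℝ → ℂ) (U : L2) : L2 := ofFun fun ξ => k (2 * Real.pi * ξ) * U ξ

variable {p A : ℝ} {k : ℝ → ℂ}

lemma re_flow_exponent (hk : IsAdmissibleSymbol p A k) (t ξ : ℝ) :
    (((max t 0 : ℝ) : ℂ) * k (2 * Real.pi * ξ)).re ≤ 0 := by
  rw [Complex.re_ofReal_mul]
  exact mul_nonpos_of_nonneg_of_nonpos (le_max_right _ _) (hk.re_nonpos _)

lemma norm_flowSymbol_le (hk : IsAdmissibleSymbol p A k) (t ξ : ℝ) : ‖flowSymbol k t ξ‖ ≤ 1 := by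
  unfold flowSymbol
  rw [Complex.norm_exp]
  exact Real.exp_le_one_iff.2 (re_flow_exponent hk t ξ)

lemma flowSymbol_bdd (hk : IsAdmissibleSymbol p A k) (t : ℝ) : BddSymbol (flowSymbol k t) := by
  refine ⟨?_, 1, norm_flowSymbol_le hk t⟩
  have := hk.measurable
  unfold flowSymbol
  fun_prop

/-- The flow `e^{tK}`, `t ≥ 0`, on the Fourier side. -/
def kFlow (hk : IsAdmissibleSymbol p A k) (t : ℝ) : L2 →L[ℝ] L2 := mulCLM (flowSymbol_bdd hk t)

lemma kFlow_coe (hk : IsAdmissibleSymbol p A k) (t : ℝ) (U : L2) :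
    (kFlow hk t U : ℝ → ℂ) =ᵐ[volume] fun ξ => flowSymbol k t ξ * U ξ := mulCLM_coe _ U

lemma wnorm_kFlow_le (hk : IsAdmissibleSymbol p A k) {ω : ℝ → ℝ} (t : ℝ) (U : L2) :
    wnorm ω (kFlow hk t U) ≤ wnorm ω U := wnorm_mulCLM_le _ (norm_flowSymbol_le hk t) U

lemma norm_kFlow_le (hk : IsAdmissibleSymbol p A k) (t : ℝ) (U : L2) : ‖kFlow hk t U‖ ≤ ‖U‖ := by
  have := wnorm_kFlow_le hk (ω := fun _ => 1) t U
  rw [wnorm_one, wnorm_one] at this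
  exact enorm_le_iff_norm_le.1 this

lemma kFlow_zero (hk : IsAdmissibleSymbol p A k) (U : L2) : kFlow hk 0 U = U := by
  apply Lp.ext
  filter_upwards [kFlow_coe hk 0 U] with ξ h
  rw [h]
  simp [flowSymbol]

lemma Herm.kFlow (hk : IsAdmissibleSymbol p A k) {U : L2} (h : Herm U) (t : ℝ) :
    Herm (kFlow hk t U) := by
  have h1 := kFlow_coe hk t U
  filter_upwards [h1, ae_neg h1, h] with ξ h1 h2 h3
  rw [h1, h2, h3, map_mul]
  congr 1
  unfold flowSymbol
  rw [← Complex.exp_conj, map_mul, ← hk.neg_eq_conj, Complex.conj_ofReal]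
  congr 3
  ring

lemma norm2_const_enorm_lt_top (U : L2) (c : ℝ≥0∞) (hc : c < ∞) :
    norm2 (fun ξ => c * ‖U ξ‖ₑ) < ∞ := by
  rw [norm2_const_mul (measurable_coe U).enorm, norm2_coe]
  exact ENNReal.mul_lt_top hc enorm_lt_top

lemma enorm_symbol_le (hk : IsAdmissibleSymbol p A k) (ξ : ℝ) :
    ‖k (2 * Real.pi * ξ)‖ₑ ≤ ENNReal.ofReal A * ENNReal.ofReal (bw p ξ) := by
  rw [← ENNReal.ofReal_mul' (bw_pos p ξ).le, ← ofReal_norm]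
  exact ENNReal.ofReal_le_ofReal (hk.growth _)

lemma norm2_symbol_lt_top (hk : IsAdmissibleSymbol p A k) {U : L2} (hU : wnorm (bw p) U < ∞) :
    norm2 (fun ξ => ‖k (2 * Real.pi * ξ) * U ξ‖ₑ) < ∞ := by
  have mU := measurable_coe U
  have mb := measurable_bw p
  have h1 : norm2 (fun ξ => ‖k (2 * Real.pi * ξ) * U ξ‖ₑ) ≤
      norm2 (fun ξ => ENNReal.ofReal A * (ENNReal.ofReal (bw p ξ) * ‖U ξ‖ₑ)) :=
    norm2_mono fun ξ => by
      rw [enorm_mul, ← mul_assoc]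
      gcongr
      exact enorm_symbol_le hk ξ
  refine h1.trans_lt ?_
  rw [norm2_const_mul (by fun_prop)]
  exact ENNReal.mul_lt_top ENNReal.ofReal_lt_top hU

lemma memLp_symbol (hk : IsAdmissibleSymbol p A k) {U : L2} (hU : wnorm (bw p) U < ∞) :
    MemLp (fun ξ => k (2 * Real.pi * ξ) * U ξ) 2 volume := by
  have mU := measurable_coe U
  have mk := hk.measurable
  exact memLp_two_of_norm2 (Measurable.aestronglyMeasurable (by fun_prop))
    (norm2_symbol_lt_top hk hU)

lemma kMul_coe (hk : IsAdmissibleSymbol p A k) {U : L2} (hU : wnorm (bw p) U < ∞) :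
    (kMul k U : ℝ → ℂ) =ᵐ[volume] fun ξ => k (2 * Real.pi * ξ) * U ξ :=
  ofFun_coe (memLp_symbol hk hU)

lemma kMul_sub (hk : IsAdmissibleSymbol p A k) {U V : L2} (hU : wnorm (bw p) U < ∞)
    (hV : wnorm (bw p) V < ∞) : kMul k (U - V) = kMul k U - kMul k V := by
  have hUV : wnorm (bw p) (U - V : L2) < ∞ :=
    (wnorm_sub_le (measurable_bw p) U V).trans_lt (ENNReal.add_lt_top.2 ⟨hU, hV⟩)
  apply Lp.ext
  filter_upwards [kMul_coe hk hU, kMul_coe hk hV, kMul_coe hk hUV, Lp.coeFn_sub U V,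
    Lp.coeFn_sub (kMul k U) (kMul k V)] with ξ h1 h2 h3 h4 h5
  rw [h3, h5, Pi.sub_apply, h1, h2, h4, Pi.sub_apply, mul_sub]

/-- The operator `K` is dissipative. -/
lemma energyIP_kMul_nonpos (hk : IsAdmissibleSymbol p A k) {U : L2} (hU : wnorm (bw p) U < ∞)
    (ω : ℝ → ℝ) : energyIP ω U (kMul k U) ≤ 0 := by
  refine integral_nonpos_of_ae ?_
  filter_upwards [kMul_coe hk hU] with ξ h
  rw [h]
  have e : conj (U ξ) * (k (2 * Real.pi * ξ) * U ξ) =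
      ((Complex.normSq (U ξ) : ℝ) : ℂ) * k (2 * Real.pi * ξ) := by
    rw [Complex.normSq_eq_conj_mul_self]; ring
  rw [e, Complex.re_ofReal_mul]
  refine mul_nonpos_of_nonneg_of_nonpos (sq_nonneg _) ?_
  exact mul_nonpos_of_nonneg_of_nonpos (Complex.normSq_nonneg _) (hk.re_nonpos _)

lemma measurable_flowSymbol_mul (hk : IsAdmissibleSymbol p A k) (t : ℝ) (U : L2) :
    Measurable fun ξ => flowSymbol k t ξ * U ξ :=
  (flowSymbol_bdd hk t).1.mul (measurable_coe U)

lemma tendsto_kFlow (hk : IsAdmissibleSymbol p A k) (U : L2) (t : ℝ) :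
    Tendsto (fun r => kFlow hk r U) (𝓝 t) (𝓝 (kFlow hk t U)) := by
  refine tendsto_of_dominated (B := fun ξ => 2 * ‖U ξ‖ₑ) (fun r => kFlow_coe hk r U)
    (kFlow_coe hk t U) (fun r => measurable_flowSymbol_mul hk r U)
    (measurable_flowSymbol_mul hk t U) (norm2_const_enorm_lt_top U 2 (by norm_num)) ?_ ?_
  · refine Eventually.of_forall fun r ξ => ?_
    rw [← sub_mul, enorm_mul]
    gcongr
    rw [← ofReal_norm, ← ENNReal.ofReal_ofNat]
    apply ENNReal.ofReal_le_ofReal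
    refine (norm_sub_le _ _).trans ?_
    linarith [norm_flowSymbol_le hk r ξ, norm_flowSymbol_le hk t ξ]
  · intro ξ
    have hc : Continuous fun r => flowSymbol k r ξ * U ξ := by
      unfold flowSymbol
      fun_prop
    exact hc.tendsto t

/-- Dominated convergence: by `norm_exp_sub_exp_le` the difference quotients of the symbol are at
most `|k|`, and `k U` is square integrable for `U` in H^p. -/
lemma hasDerivWithinAt_kFlow (hk : IsAdmissibleSymbol p A k) {U : L2} (hU : wnorm (bw p) U < ∞)
    {t : ℝ} (ht : 0 ≤ t) :
    HasDerivWithinAt (fun r => kFlow hk r U) (kMul k (kFlow hk t U)) (Ici 0) t := by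
  have mk := hk.measurable
  have mU := measurable_coe U
  rw [hasDerivWithinAt_iff_tendsto_slope]
  have hUt : wnorm (bw p) (kFlow hk t U) < ∞ := (wnorm_kFlow_le hk t U).trans_lt hU
  refine tendsto_of_dominated (B := fun ξ => 2 * ‖k (2 * Real.pi * ξ) * U ξ‖ₑ)
    (f := fun r ξ => ((r - t)⁻¹ : ℝ) • (flowSymbol k r ξ * U ξ - flowSymbol k t ξ * U ξ))
    (g := fun ξ => k (2 * Real.pi * ξ) * (flowSymbol k t ξ * U ξ)) ?_ ?_ ?_ ?_ ?_ ?_ ?_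
  · intro r
    rw [slope_def_module]
    filter_upwards [Lp.coeFn_smul ((r - t)⁻¹ : ℝ) (kFlow hk r U - kFlow hk t U),
      Lp.coeFn_sub (kFlow hk r U) (kFlow hk t U), kFlow_coe hk r U, kFlow_coe hk t U]
      with ξ h1 h2 h3 h4
    rw [h1, Pi.smul_apply, h2, Pi.sub_apply, h3, h4]
  · filter_upwards [kMul_coe hk hUt, kFlow_coe hk t U] with ξ h1 h2
    rw [h1, h2]
  · intro r
    have h1 := measurable_flowSymbol_mul hk r U
    have h2 := measurable_flowSymbol_mul hk t U
    exact (h1.sub h2).const_smul ((r - t)⁻¹ : ℝ)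
  · have h2 := measurable_flowSymbol_mul hk t U
    fun_prop
  · rw [norm2_const_mul (by fun_prop)]
    exact ENNReal.mul_lt_top (by norm_num) (norm2_symbol_lt_top hk hU)
  · filter_upwards [self_mem_nhdsWithin] with r hr ξ
    have hr0 : 0 ≤ r := hr.1
    have hne : r ≠ t := hr.2
    have e1 : ‖((r - t)⁻¹ : ℝ) • (flowSymbol k r ξ * U ξ - flowSymbol k t ξ * U ξ)‖ ≤
        ‖k (2 * Real.pi * ξ) * U ξ‖ := by
      rw [← sub_mul, norm_smul, norm_mul, norm_mul, ← mul_assoc]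
      gcongr
      have h3 := norm_exp_sub_exp_le (re_flow_exponent hk r ξ) (re_flow_exponent hk t ξ)
      rw [← sub_mul, norm_mul, max_eq_left hr0, max_eq_left ht, ← Complex.ofReal_sub,
        Complex.norm_real] at h3
      unfold flowSymbol
      rw [norm_inv, inv_mul_le_iff₀ (norm_pos_iff.2 (sub_ne_zero.2 hne)), max_eq_left hr0,
        max_eq_left ht]
      exact h3
    have e2 : ‖k (2 * Real.pi * ξ) * (flowSymbol k t ξ * U ξ)‖ ≤
        ‖k (2 * Real.pi * ξ) * U ξ‖ := by
      rw [norm_mul, norm_mul, norm_mul]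
      gcongr
      exact mul_le_of_le_one_left (norm_nonneg _) (norm_flowSymbol_le hk t ξ)
    rw [two_mul (‖_‖ₑ)]
    refine enorm_sub_le.trans (add_le_add ?_ ?_)
    · exact enorm_le_iff_norm_le.2 e1
    · exact enorm_le_iff_norm_le.2 e2
  · intro ξ
    have h1 : HasDerivAt (fun r : ℝ => Complex.exp ((r : ℂ) * k (2 * Real.pi * ξ)) * U ξ)
        (k (2 * Real.pi * ξ) * (flowSymbol k t ξ * U ξ)) t := by
      have h2 := ((((hasDerivAt_id t).ofReal_comp).mul_const (k (2 * Real.pi * ξ))).cexp).mul_const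
        (U ξ)
      refine h2.congr_deriv ?_
      simp only [flowSymbol, max_eq_left ht, id]
      push_cast
      ring
    have h2 := hasDerivWithinAt_iff_tendsto_slope.1 (h1.hasDerivWithinAt (s := Ici 0))
    refine h2.congr' ?_
    filter_upwards [self_mem_nhdsWithin] with r hr
    have hr0 : 0 ≤ r := hr.1
    simp only [slope_def_module, flowSymbol, max_eq_left ht, max_eq_left hr0]

/-- The time derivative of `e^{tK} b(t)`. -/
lemma hasDerivWithinAt_kFlow_apply (hk : IsAdmissibleSymbol p A k) {b : ℝ → L2} {b' : L2}
    {S : Set ℝ} {t : ℝ} (hS : S ⊆ Ici 0) (ht : 0 ≤ t) (hb : HasDerivWithinAt b b' S t)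
    (hbp : wnorm (bw p) (b t) < ∞) :
    HasDerivWithinAt (fun r => kFlow hk r (b r)) (kMul k (kFlow hk t (b t)) + kFlow hk t b') S t :=
  hasDerivWithinAt_contraction_apply (norm_kFlow_le hk) hb
    ((hasDerivWithinAt_kFlow hk hbp ht).mono hS) (tendsto_kFlow hk b' t)

end

/-! ### The commutator of the linear flow with the nonlinearity -/

noncomputable section

variable {p A : ℝ} {k : ℝ → ℂ}

lemma IsAdmissibleSymbol.const_nonneg (hk : IsAdmissibleSymbol p A k) : 0 ≤ A := by
  have h := (norm_nonneg _).trans (hk.growth 0)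
  simpa [japanese] using h

/-- The defect in additivity of `k`, multiplied by the total frequency. -/
lemma norm_mul_symbol_defect_le (hk : IsAdmissibleSymbol p A k) (x y : ℝ) :
    ‖((x + y : ℝ) : ℂ) * (k x + k y - k (x + y))‖ ≤
      2 * A * (|x| * japanese y ^ p + |y| * japanese x ^ p) := by
  have h := hk.commutator x y
  have e : ((x + y : ℝ) : ℂ) * (k x + k y - k (x + y)) =
      (x : ℂ) * k y + (y : ℂ) * k x -
        (((x + y : ℝ) : ℂ) * k (x + y) - (y : ℂ) * k y - (x : ℂ) * k x) := by
    push_cast; ring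
  rw [e]
  have h1 : ‖(x : ℂ) * k y‖ ≤ A * (|x| * japanese y ^ p) := by
    rw [norm_mul, Complex.norm_real, Real.norm_eq_abs]
    calc |x| * ‖k y‖ ≤ |x| * (A * japanese y ^ p) := by gcongr; exact hk.growth y
      _ = _ := by ring
  have h2 : ‖(y : ℂ) * k x‖ ≤ A * (|y| * japanese x ^ p) := by
    rw [norm_mul, Complex.norm_real, Real.norm_eq_abs]
    calc |y| * ‖k x‖ ≤ |y| * (A * japanese x ^ p) := by gcongr; exact hk.growth x
      _ = _ := by ring
  refine (norm_sub_le _ _).trans ((add_le_add (norm_add_le _ _) h).trans ?_)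
  linarith

/-- The symbol of the commutator between `e^{tK}` and a product. -/
def commSymbol (k : ℝ → ℂ) (t ξ η : ℝ) : ℂ :=
  flowSymbol k t ξ * flowSymbol k t η - flowSymbol k t (ξ + η)

/-- Both exponents lie in the left half-plane, so the difference of the exponentials is at most `t`
times the additivity defect of `k`. The defect is controlled only after multiplication by the total
frequency, through `norm_mul_symbol_defect_le`. -/
lemma norm_commSymbol_le (hk : IsAdmissibleSymbol p A k) {t : ℝ} (ht : 0 ≤ t) (ξ η : ℝ) :
    ‖((2 * Real.pi * (ξ + η) : ℝ) : ℂ) * commSymbol k t ξ η‖ ≤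
      t * (2 * A) * (bw 1 ξ * bw p η + bw 1 η * bw p ξ) := by
  have hA := hk.const_nonneg
  have e : commSymbol k t ξ η =
      Complex.exp ((t : ℂ) * (k (2 * Real.pi * ξ) + k (2 * Real.pi * η))) -
        Complex.exp ((t : ℂ) * k (2 * Real.pi * (ξ + η))) := by
    simp only [commSymbol, flowSymbol, max_eq_left ht, mul_add, Complex.exp_add]
  have h1 := norm_exp_sub_exp_le (z := (t : ℂ) * (k (2 * Real.pi * ξ) + k (2 * Real.pi * η)))
    (w := (t : ℂ) * k (2 * Real.pi * (ξ + η)))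
    (by
      rw [Complex.re_ofReal_mul, Complex.add_re]
      exact mul_nonpos_of_nonneg_of_nonpos ht (add_nonpos (hk.re_nonpos _) (hk.re_nonpos _)))
    (by
      rw [Complex.re_ofReal_mul]
      exact mul_nonpos_of_nonneg_of_nonpos ht (hk.re_nonpos _))
  rw [← mul_sub, norm_mul, Complex.norm_real, Real.norm_of_nonneg ht] at h1
  have h2 := norm_mul_symbol_defect_le hk (2 * Real.pi * ξ) (2 * Real.pi * η)
  rw [← mul_add, norm_mul] at h2
  rw [norm_mul, e]
  calc _ ≤ ‖((2 * Real.pi * (ξ + η) : ℝ) : ℂ)‖ *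
        (t * ‖k (2 * Real.pi * ξ) + k (2 * Real.pi * η) - k (2 * Real.pi * (ξ + η))‖) := by gcongr
    _ = t * (‖((2 * Real.pi * (ξ + η) : ℝ) : ℂ)‖ *
        ‖k (2 * Real.pi * ξ) + k (2 * Real.pi * η) - k (2 * Real.pi * (ξ + η))‖) := by ring
    _ ≤ t * (2 * A * (|2 * Real.pi * ξ| * bw p η + |2 * Real.pi * η| * bw p ξ)) := by
        exact mul_le_mul_of_nonneg_left h2 ht
    _ ≤ t * (2 * A * (bw 1 ξ * bw p η + bw 1 η * bw p ξ)) := by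
        have b1 := abs_le_bracket ξ
        have b2 := abs_le_bracket η
        have b3 := (bw_pos p ξ).le
        have b4 := (bw_pos p η).le
        rw [bw_one]
        gcongr
    _ = _ := by ring

/-- The commutator of `e^{tK}` with the nonlinearity. -/
def kComm (hk : IsAdmissibleSymbol p A k) (t : ℝ) (b : L2) : L2 :=
  adv (kFlow hk t b) (kFlow hk t b) - kFlow hk t (adv b b)

lemma IsH2.kFlow (hk : IsAdmissibleSymbol p A k) {b : L2} (hb : IsH2 b) (t : ℝ) :
    IsH2 (kFlow hk t b) := (wnorm_kFlow_le hk t b).trans_lt hb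

/-- The derivative contributes the frequency `η` of one factor only. Adding the integral with `η`
and `ζ - η` exchanged replaces it by the total frequency `ζ`, for which the symbol bound is
available; this is f f_x = (f²)_x / 2. -/
lemma two_mul_kComm_coe (hk : IsAdmissibleSymbol p A k) (t : ℝ) {b : L2} (hb : IsH2 b) :
    (fun ζ => 2 * kComm hk t b ζ) =ᵐ[volume] fun ζ => ∫ η, Complex.I *
      ((((2 * Real.pi * (ζ - η + η) : ℝ) : ℂ) * commSymbol k t (ζ - η) η) *
        (b (ζ - η) * b η)) := by
  have hd : dfun (kFlow hk t b) =ᵐ[volume] dfun (fun ξ => flowSymbol k t ξ * b ξ) := by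
    filter_upwards [kFlow_coe hk t b] with ξ hξ
    simp only [dfun, hξ]
  have hEb := hb.kFlow hk t
  have m1 : MemLp (fun ξ => flowSymbol k t ξ * b ξ) 2 volume := (flowSymbol_bdd hk t).memLp b
  have m2 : MemLp (dfun (fun ξ => flowSymbol k t ξ * b ξ)) 2 volume :=
    (memLp_congr_ae hd).1 hEb.memLp_dfun
  filter_upwards [Lp.coeFn_sub (adv (kFlow hk t b) (kFlow hk t b)) (kFlow hk t (adv b b)),
    adv_coe hEb hEb, kFlow_coe hk t (adv b b), adv_coe hb hb] with ζ h1 h2 h3 h4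
  have i1 := integrable_conv_integrand m1 m2 ζ
  have i2 := (integrable_conv_integrand (Lp.memLp b) hb.memLp_dfun ζ).const_mul (flowSymbol k t ζ)
  have e1 : kComm hk t b ζ = ∫ η, commSymbol k t (ζ - η) η * (b (ζ - η) * dfun b η) := by
    unfold kComm
    rw [h1, Pi.sub_apply, h2, h3, h4, conv_congr_left (kFlow_coe hk t b), conv_congr_right _ hd]
    unfold conv
    rw [← integral_const_mul, ← integral_sub i1 i2]
    congr 1
    ext η
    simp only [commSymbol, dfun, sub_add_cancel]
    ring
  have i3 : Integrable fun η => commSymbol k t (ζ - η) η * (b (ζ - η) * dfun b η) := by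
    refine (i1.sub i2).congr (Eventually.of_forall fun η => ?_)
    simp only [commSymbol, dfun, sub_add_cancel, Pi.sub_apply]
    ring
  have i4 := i3.comp_sub_left ζ
  have e2 : kComm hk t b ζ =
      ∫ η, commSymbol k t (ζ - (ζ - η)) (ζ - η) * (b (ζ - (ζ - η)) * dfun b (ζ - η)) := by
    rw [e1, ← integral_sub_left_eq_self _ volume ζ]
  rw [two_mul]
  nth_rewrite 1 [e1]
  rw [e2, ← integral_add i3 i4]
  congr 1
  ext η
  have e3 : commSymbol k t (ζ - (ζ - η)) (ζ - η) = commSymbol k t (ζ - η) η := by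
    unfold commSymbol
    rw [sub_sub_cancel, mul_comm, add_comm]
  rw [e3, sub_sub_cancel]
  simp only [dfun]
  push_cast
  ring

lemma enorm_kComm_le (hk : IsAdmissibleSymbol p A k) {t : ℝ} (ht : 0 ≤ t) {b : L2} (hb : IsH2 b) :
    ∀ᵐ ζ, ‖kComm hk t b ζ‖ₑ ≤ ENNReal.ofReal (t * (2 * A)) *
      lconv (fun ξ => ENNReal.ofReal (bw 1 ξ) * ‖b ξ‖ₑ)
        (fun ξ => ENNReal.ofReal (bw p ξ) * ‖b ξ‖ₑ) ζ := by
  have hA := hk.const_nonneg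
  have mb := measurable_coe b
  have mp := measurable_bw p
  have m1 := measurable_bw 1
  set f : ℝ → ℝ≥0∞ := fun ξ => ENNReal.ofReal (bw 1 ξ) * ‖b ξ‖ₑ with hf
  set g : ℝ → ℝ≥0∞ := fun ξ => ENNReal.ofReal (bw p ξ) * ‖b ξ‖ₑ with hg
  have mf : Measurable f := by fun_prop
  have mg : Measurable g := by fun_prop
  filter_upwards [two_mul_kComm_coe hk t hb] with ζ h
  have h1 : ‖2 * kComm hk t b ζ‖ₑ ≤
      ∫⁻ η, ENNReal.ofReal (t * (2 * A)) * (f (ζ - η) * g η + g (ζ - η) * f η) := by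
    rw [h]
    refine (enorm_integral_le_lintegral_enorm _).trans (lintegral_mono fun η => ?_)
    rw [enorm_mul, enorm_mul _ (b _ * b _), enorm_mul (b _), ← ofReal_norm Complex.I, Complex.norm_I,
      ENNReal.ofReal_one, one_mul]
    have h2 : ‖((2 * Real.pi * (ζ - η + η) : ℝ) : ℂ) * commSymbol k t (ζ - η) η‖ₑ ≤
        ENNReal.ofReal (t * (2 * A)) *
          (ENNReal.ofReal (bw 1 (ζ - η)) * ENNReal.ofReal (bw p η) +
            ENNReal.ofReal (bw 1 η) * ENNReal.ofReal (bw p (ζ - η))) := by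
      have b1 := (bw_pos 1 (ζ - η)).le
      have b2 := (bw_pos 1 η).le
      have b3 := (bw_pos p η).le
      have b4 := (bw_pos p (ζ - η)).le
      rw [← ENNReal.ofReal_mul b1, ← ENNReal.ofReal_mul b2, ← ENNReal.ofReal_add (by positivity)
        (by positivity), ← ENNReal.ofReal_mul (by positivity), ← ofReal_norm]
      exact ENNReal.ofReal_le_ofReal (norm_commSymbol_le hk ht _ _)
    refine (mul_le_mul' h2 le_rfl).trans (le_of_eq ?_)
    simp only [hf, hg]
    ring
  have mc1 : Measurable fun η => f (ζ - η) * g η := by fun_prop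
  have mc2 : Measurable fun η => g (ζ - η) * f η := by fun_prop
  rw [lintegral_const_mul _ (by fun_prop), lintegral_add_left mc1] at h1
  change _ ≤ _ * (lconv f g ζ + lconv g f ζ) at h1
  rw [lconv_comm g f, ← two_mul, enorm_mul, mul_left_comm] at h1
  have e2 : ‖(2 : ℂ)‖ₑ = 2 := by
    rw [← ofReal_norm]; norm_num
  rw [e2] at h1
  exact (ENNReal.mul_le_mul_iff_right (by norm_num) (by norm_num)).1 h1

/-- The constant in the commutator estimate. -/
def commConst (m : ℕ) (p s A : ℝ) : ℝ :=
  2 * A * (2 ^ m * ((embConst (s - p)).toReal + (embConst (s - 1)).toReal))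

/-- One factor carries 1 derivative and the other `p`. The weight of H^r falls on one of them, kept
in L², while the other goes into L¹; hence `r + 1 ≤ s` and `r + p ≤ s` suffice, rather than `r + 1 +
p ≤ s`. -/
lemma wnorm_kComm_le (hk : IsAdmissibleSymbol p A k) {m : ℕ} {r s M t : ℝ} (hr : 0 ≤ r)
    (hrm : r ≤ m) (h1 : r + 1 ≤ s) (hp : r + p ≤ s) (hr' : 1 / 2 < r) (hM : 0 ≤ M) (ht : 0 ≤ t)
    {b : L2} (hb2 : IsH2 b) (hb : wnorm (bw s) b ≤ ENNReal.ofReal M) :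
    wnorm (bw r) (kComm hk t b) ≤ ENNReal.ofReal (t * (commConst m p s A * M ^ 2)) := by
  have hA := hk.const_nonneg
  have mb := measurable_coe b
  have mp := measurable_bw p
  have m1 := measurable_bw 1
  have mr := measurable_bw r
  have mf : Measurable fun ξ => ENNReal.ofReal (bw 1 ξ) * ‖b ξ‖ₑ := by fun_prop
  have mg : Measurable fun ξ => ENNReal.ofReal (bw p ξ) * ‖b ξ‖ₑ := by fun_prop
  have e1 := (embConst_lt_top (d := s - 1) (by linarith)).ne
  have ep := (embConst_lt_top (d := s - p) (by linarith)).ne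
  have l1 : lnorm (bw 1) b ≤ ENNReal.ofReal ((embConst (s - 1)).toReal * M) := by
    rw [ENNReal.ofReal_mul ENNReal.toReal_nonneg, ENNReal.ofReal_toReal e1]
    exact (lnorm_bw_le 1 s mb).trans (mul_le_mul' le_rfl hb)
  have lp : lnorm (bw p) b ≤ ENNReal.ofReal ((embConst (s - p)).toReal * M) := by
    rw [ENNReal.ofReal_mul ENNReal.toReal_nonneg, ENNReal.ofReal_toReal ep]
    exact (lnorm_bw_le p s mb).trans (mul_le_mul' le_rfl hb)
  have w : ∀ q : ℝ, r + q ≤ s → norm2 (fun ξ => ENNReal.ofReal (bw r ξ) *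
      (ENNReal.ofReal (bw q ξ) * ‖b ξ‖ₑ)) ≤ ENNReal.ofReal M := by
    intro q hq
    refine le_trans (norm2_mono fun ξ => ?_) ((wnorm_bw_mono hq b).trans hb)
    rw [← mul_assoc, ← ENNReal.ofReal_mul (bw_pos r ξ).le, ← bw_add]
  have hmain : wnorm (bw r) (kComm hk t b) ≤ norm2 (fun ξ => ENNReal.ofReal (t * (2 * A)) *
      (ENNReal.ofReal (bw r ξ) * lconv (fun ξ => ENNReal.ofReal (bw 1 ξ) * ‖b ξ‖ₑ)
        (fun ξ => ENNReal.ofReal (bw p ξ) * ‖b ξ‖ₑ) ξ)) := by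
    refine norm2_mono_ae ?_
    filter_upwards [enorm_kComm_le hk ht hb2] with ξ h
    rw [mul_left_comm]
    gcongr
  refine hmain.trans ?_
  rw [norm2_const_mul (by have := measurable_lconv mf mg; fun_prop)]
  have h2 := (isWeight_bw hr hrm).norm2_mul_lconv_le mf mg
  calc _ ≤ ENNReal.ofReal (t * (2 * A)) * (2 ^ m *
        (ENNReal.ofReal M * ENNReal.ofReal ((embConst (s - p)).toReal * M) +
          ENNReal.ofReal ((embConst (s - 1)).toReal * M) * ENNReal.ofReal M)) := by
        refine mul_le_mul' le_rfl (h2.trans ?_)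
        refine mul_le_mul' le_rfl (add_le_add (mul_le_mul' (w 1 h1) lp) (mul_le_mul' l1 (w p hp)))
    _ = _ := by
        have h4 : (2 : ℝ≥0∞) ^ m = ENNReal.ofReal (2 ^ m) := by
          rw [ENNReal.ofReal_pow (by norm_num)]; norm_num
        rw [h4, ← ENNReal.ofReal_mul hM, ← ENNReal.ofReal_mul (by positivity),
          ← ENNReal.ofReal_add (by positivity) (by positivity),
          ← ENNReal.ofReal_mul (by positivity), ← ENNReal.ofReal_mul (by positivity)]
        congr 1
        unfold commConst
        ring

end

/-! ### The two substeps and the local error -/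

noncomputable section

/-- The relations between the indices: `H^s` data, errors measured in `H^r`, a symbol of order `p`,
and an integer `m` that bounds the growth of the weights in use. -/
structure Indices (p s r : ℝ) (m : ℕ) : Prop where
  error : 3 / 2 < r
  one : r + 1 ≤ s
  symbol : r + p ≤ s
  weight : s + 1 ≤ m

/-- Real-valued `H^s` data, on the Fourier side. -/
def hermSobolev (s : ℝ) : Set L2 := {f | Herm f ∧ wnorm (bw s) f < ∞}

/-- Real-valued `H^s` data that are at most `a` in `H^r`, on the Fourier side. -/
def boundedData (s r a : ℝ) : Set L2 :=
  {f | Herm f ∧ wnorm (bw s) f < ∞ ∧ wnorm (bw r) f ≤ ENNReal.ofReal a}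

/-- `Φ` is a flow of `f' = X f` on `[0, σ]` with data in `𝒟`, well behaved in all Sobolev spaces. -/
structure IsSubstep (m : ℕ) (σ : ℝ) (𝒟 : Set L2) (X : L2 → L2) (Φ : ℝ → L2 → L2) : Prop where
  zero : ∀ f ∈ 𝒟, Φ 0 f = f
  deriv : ∀ f ∈ 𝒟, ∀ t ∈ Icc 0 σ,
    HasDerivWithinAt (fun t => Φ t f) (X (Φ t f)) (Icc 0 σ) t
  lip : ∃ C, ∀ f ∈ 𝒟, ∀ g ∈ 𝒟, ∀ t ∈ Icc 0 σ, ‖Φ t f - Φ t g‖ ≤ C * ‖f - g‖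
  herm : ∀ f ∈ 𝒟, ∀ t ∈ Icc 0 σ, Herm (Φ t f)
  weight : ∃ C : ℝ, ∀ f ∈ 𝒟, ∀ t ∈ Icc 0 σ, ∀ ω, IsWeight m ω →
    wnorm ω (Φ t f) ≤ ENNReal.ofReal C * wnorm ω f

/-- A flow of Burgers' equation on `[0, σ]` for data bounded by `a` in `H^r`. -/
def IsBurgersFlow (r a σ : ℝ) (B : ℝ → L2 → L2) : Prop :=
  ∀ f : L2, Herm f → wnorm (bw r) f ≤ ENNReal.ofReal a → IsH2 f →
    B 0 f = f ∧ IsBurgers σ (fun t => B t f) ∧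
      (∀ t ∈ Icc 0 σ,
        HasDerivWithinAt (fun t => B t f) (-adv (B t f) (B t f)) (Icc 0 σ) t) ∧
      ∀ t ∈ Icc 0 σ, wnorm (bw r) (B t f) ≤ ENNReal.ofReal (2 * a)

/-- The growth rate of Sobolev norms under Burgers' flow. -/
def burgersRate (m : ℕ) (r a : ℝ) : ℝ :=
  2 * energyConst m * ((embConst (r - 1)).toReal * (2 * a))

lemma burgersRate_nonneg (m : ℕ) (r : ℝ) {a : ℝ} (ha : 0 ≤ a) : 0 ≤ burgersRate m r a := by
  have := energyConst_nonneg m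
  unfold burgersRate
  positivity

variable {p s r a σ A : ℝ} {m : ℕ} {k : ℝ → ℂ}

lemma exists_burgersFlow (I : Indices p s r m) (ha : 0 < a) (hσ : 0 < σ)
    (haσ : 8 * energyConst m * (embConst (r - 1)).toReal * a * σ < 1) :
    ∃ B, IsBurgersFlow r a σ B := by
  have h1 := I.error
  have h2 := I.one
  have h3 := I.weight
  have hm : 2 ≤ m := by
    have : (2 : ℝ) ≤ m := by linarith
    exact_mod_cast this
  have key : ∀ f : L2, ∃ U : ℝ → L2, Herm f → wnorm (bw r) f ≤ ENNReal.ofReal a → IsH2 f →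
      U 0 = f ∧ IsBurgers σ U ∧
        (∀ t ∈ Icc 0 σ, HasDerivWithinAt U (-adv (U t) (U t)) (Icc 0 σ) t) ∧
        ∀ t ∈ Icc 0 σ, wnorm (bw r) (U t) ≤ ENNReal.ofReal (2 * a) := by
    intro f
    by_cases h : Herm f ∧ wnorm (bw r) f ≤ ENNReal.ofReal a ∧ IsH2 f
    · obtain ⟨U, hU⟩ := exists_burgers I.error (by linarith) hm ha hσ haσ h.1 h.2.1 h.2.2
      exact ⟨U, fun _ _ _ => hU⟩
    · exact ⟨0, fun h1 h2 h3 => absurd ⟨h1, h2, h3⟩ h⟩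
  choose U hU using key
  exact ⟨fun t f => U f t, hU⟩

lemma Indices.isH2 (I : Indices p s r m) {f : ℝ → ℂ} (h : wnorm (bw s) f < ∞) : IsH2 f :=
  isH2_of_wnorm_bw (by linarith [I.error, I.one]) h

lemma Indices.isWeight (I : Indices p s r m) : IsWeight m (bw s) :=
  isWeight_bw (by linarith [I.error, I.one]) (by linarith [I.weight])

lemma IsBurgersFlow.lnorm_le (I : Indices p s r m) {B : ℝ → L2 → L2} (hB : IsBurgersFlow r a σ B)
    {f : L2} (hf : f ∈ boundedData s r a) {t : ℝ} (ht : t ∈ Icc 0 σ) :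
    lnorm (bw 1) (B t f) ≤ ENNReal.ofReal ((embConst (r - 1)).toReal * (2 * a)) :=
  lnorm_one_le I.error (measurable_coe _) ((hB f hf.1 hf.2.2 (I.isH2 hf.2.1)).2.2.2 t ht)

lemma IsBurgersFlow.wnorm_le (I : Indices p s r m) {B : ℝ → L2 → L2} (hB : IsBurgersFlow r a σ B)
    (ha : 0 ≤ a) {f : L2} (hf : f ∈ boundedData s r a) {t : ℝ} (ht : t ∈ Icc 0 σ) {ω : ℝ → ℝ}
    (hω : IsWeight m ω) :
    wnorm ω (B t f) ≤ ENNReal.ofReal (Real.exp (burgersRate m r a * t)) * wnorm ω f := by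
  have h := hB f hf.1 hf.2.2 (I.isH2 hf.2.1)
  have h1 := h.2.1.wnorm_le (by positivity) (fun t ht => hB.lnorm_le I hf ht) hω ht
  simp only [h.1] at h1
  exact h1

lemma hasDerivAt_burgers_sub {u v : L2} {U V : ℝ → L2} {t : ℝ} (hU : HasDerivAt U (u - adv (U t) (U t)) t)
    (hV : HasDerivAt V (v - adv (V t) (V t)) t) (h1 : IsH2 (U t)) (h2 : IsH2 (V t)) :
    HasDerivAt (fun t => U t - V t)
      (u - v - (adv (U t) (U t - V t) + adv (U t - V t) (V t))) t := by
  refine (hU.sub hV).congr_deriv ?_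
  rw [← adv_self_sub h1 h2]
  abel

/-- Continuous dependence of Burgers' flow on the data, in `L²`. -/
lemma IsBurgers.norm_sub_le {b : ℝ} {U V : ℝ → L2} (hU : IsBurgers σ U) (hV : IsBurgers σ V)
    (hb : 0 ≤ b) (hUb : ∀ t ∈ Icc 0 σ, lnorm (bw 1) (U t) ≤ ENNReal.ofReal b)
    (hVb : ∀ t ∈ Icc 0 σ, lnorm (bw 1) (V t) ≤ ENNReal.ofReal b) {t : ℝ} (ht : t ∈ Icc 0 σ) :
    ‖U t - V t‖ ≤ Real.exp ((b + 2 * b + 1) * σ) * ‖U 0 - V 0‖ := by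
  have key := norm_sq_difference_le (D := fun t => U t - V t) (X := fun _ => 0) (F := fun _ => 0)
    (φ := 0) hb hb (hU.cont.sub hV.cont) (fun t ht => by
      have ht' := Ioo_subset_Icc_self ht
      refine (hasDerivAt_burgers_sub (u := 0) (v := 0) (by simpa using hU.deriv t ht)
        (by simpa using hV.deriv t ht) (hU.h2 t ht') (hV.h2 t ht')).congr_deriv ?_
      simp)
    (fun t ht => (hU.h2 t (Ioo_subset_Icc_self ht)).sub (hV.h2 t (Ioo_subset_Icc_self ht)))
    (fun t ht => hU.h2 t (Ioo_subset_Icc_self ht)) (fun t ht => hV.h2 t (Ioo_subset_Icc_self ht))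
    (fun t ht => hU.herm t (Ioo_subset_Icc_self ht)) (fun t ht => hUb t (Ioo_subset_Icc_self ht))
    (fun t ht => hVb t (Ioo_subset_Icc_self ht)) (fun t ht => by simp)
    (fun t _ => by
      have := BddWeight.one.energyIP_sub (U t - V t) 0 0
      rw [sub_self, sub_self] at this
      exact this.le) ht
  refine abs_le_of_sq_le_sq' ?_ (by positivity) |>.2
  rw [mul_pow, ← Real.exp_nat_mul]
  refine key.trans ?_
  simp only [ne_eq, OfNat.ofNat_ne_zero, not_false_eq_true, zero_pow, zero_mul, add_zero]
  refine mul_le_mul_of_nonneg_right (Real.exp_le_exp.2 ?_) (sq_nonneg _)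
  have h1 : (b + 2 * b + 1) * t ≤ (b + 2 * b + 1) * σ := by gcongr; exact ht.2
  have h2 : 0 ≤ (b + 2 * b + 1) * σ := by
    have := ht.1.trans ht.2
    positivity
  push_cast
  linarith

lemma IsBurgersFlow.isSubstep (I : Indices p s r m) {B : ℝ → L2 → L2}
    (hB : IsBurgersFlow r a σ B) (ha : 0 ≤ a) :
    IsSubstep m σ (boundedData s r a) (fun f => -adv f f) B where
  zero f hf := (hB f hf.1 hf.2.2 (I.isH2 hf.2.1)).1
  deriv f hf := (hB f hf.1 hf.2.2 (I.isH2 hf.2.1)).2.2.1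
  lip := by
    set b := (embConst (r - 1)).toReal * (2 * a) with hb
    refine ⟨Real.exp ((b + 2 * b + 1) * σ), fun f hf g hg t ht => ?_⟩
    have h1 := hB f hf.1 hf.2.2 (I.isH2 hf.2.1)
    have h2 := hB g hg.1 hg.2.2 (I.isH2 hg.2.1)
    have h3 := h1.2.1.norm_sub_le h2.2.1 (by positivity) (fun t ht => hB.lnorm_le I hf ht)
      (fun t ht => hB.lnorm_le I hg ht) ht
    simp only [h1.1, h2.1] at h3
    exact h3
  herm f hf := (hB f hf.1 hf.2.2 (I.isH2 hf.2.1)).2.1.herm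
  weight := by
    refine ⟨Real.exp (burgersRate m r a * σ), fun f hf t ht ω hω => ?_⟩
    refine (hB.wnorm_le I ha hf ht hω).trans ?_
    have := burgersRate_nonneg m r ha
    gcongr
    exact ht.2

lemma Indices.wnorm_symbol_lt_top (I : Indices p s r m) {f : ℝ → ℂ} (h : wnorm (bw s) f < ∞) :
    wnorm (bw p) f < ∞ :=
  (wnorm_bw_mono (by linarith [I.error, I.symbol]) f).trans_lt h

lemma isSubstep_kFlow (I : Indices p s r m) (hk : IsAdmissibleSymbol p A k) :
    IsSubstep m σ (hermSobolev s) (kMul k) (fun t f => kFlow hk t f) where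
  zero f _ := kFlow_zero hk f
  deriv f hf t ht := (hasDerivWithinAt_kFlow hk (I.wnorm_symbol_lt_top hf.2) ht.1).mono
    fun _ h => h.1
  lip := by
    refine ⟨1, fun f _ g _ t _ => ?_⟩
    rw [one_mul, ← map_sub]
    exact norm_kFlow_le hk t _
  herm f hf t _ := hf.1.kFlow hk t
  weight := by
    refine ⟨1, fun f _ t _ ω _ => ?_⟩
    rw [ENNReal.ofReal_one, one_mul]
    exact wnorm_kFlow_le hk t f

/-- The local error of the splitting that ends with `e^{tK}`. -/
lemma wnorm_kFlow_burgers_sub_le (I : Indices p s r m) (hk : IsAdmissibleSymbol p A k)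
    {B : ℝ → L2 → L2} (hB : IsBurgersFlow r a σ B) (ha : 0 ≤ a) {f : L2}
    (hf : f ∈ boundedData s r a) {M y₀ : ℝ} (hM : 0 ≤ M) (hy : 0 ≤ y₀)
    (hBM : ∀ t ∈ Icc 0 σ, wnorm (bw s) (B t f) ≤ ENNReal.ofReal M) {U : ℝ → L2}
    (hUc : ContinuousOn U (Icc 0 σ))
    (hU : ∀ t ∈ Ioo 0 σ, HasDerivAt U (kMul k (U t) - adv (U t) (U t)) t)
    (hUM : ∀ t ∈ Icc 0 σ, wnorm (bw s) (U t) ≤ ENNReal.ofReal M)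
    (hσ : 4 * σ * diffConst m r (2 * a) M ≤ 1)
    (hy₀ : wnorm (bw r) (f - U 0 : L2) ≤ ENNReal.ofReal y₀) {t : ℝ} (ht : t ∈ Icc 0 σ) :
    wnorm (bw r) (kFlow hk t (B t f) - U t : L2) ≤ ENNReal.ofReal
      ((1 + 4 * σ * diffConst m r (2 * a) M) *
        (y₀ + 2 * σ * (σ * (commConst m p s A * M ^ 2)))) := by
  have i1 := I.error
  have i2 := I.one
  have i3 := I.weight
  have hσ0 := ht.1.trans ht.2
  have hA := hk.const_nonneg
  have hK : 0 ≤ commConst m p s A := by unfold commConst; positivity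
  obtain ⟨hB0, hBb, hBd, hBr⟩ := hB f hf.1 hf.2.2 (I.isH2 hf.2.1)
  have hBs : ∀ t ∈ Icc 0 σ, wnorm (bw s) (B t f) < ∞ := fun t ht =>
    (hBM t ht).trans_lt ENNReal.ofReal_lt_top
  have hUs : ∀ t ∈ Icc 0 σ, wnorm (bw s) (U t) < ∞ := fun t ht =>
    (hUM t ht).trans_lt ENNReal.ofReal_lt_top
  have hzs : ∀ t ∈ Icc 0 σ, wnorm (bw s) (kFlow hk t (B t f)) < ∞ := fun t ht =>
    (wnorm_kFlow_le hk t _).trans_lt (hBs t ht)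
  have hzd : ∀ t ∈ Icc 0 σ, HasDerivWithinAt (fun t => kFlow hk t (B t f))
      (kMul k (kFlow hk t (B t f)) + kFlow hk t (-adv (B t f) (B t f))) (Icc 0 σ) t :=
    fun t ht => hasDerivWithinAt_kFlow_apply hk (fun _ h => h.1) ht.1 (hBd t ht)
      (I.wnorm_symbol_lt_top (hBs t ht))
  -- The numerical solution transports and the exact one is differentiated, so `r + 1` derivatives
  -- are asked of `U` while the numerical solution enters through its H^r norm `2 * a`. Its H^s norm
  -- enters only through the commutator.
  refine wnorm_difference_le (D := fun t => kFlow hk t (B t f) - U t)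
    (X := fun t => kMul k (kFlow hk t (B t f) - U t)) (F := fun t => kComm hk t (B t f))
    (U := fun t => kFlow hk t (B t f)) (V := U) (B₀ := 2 * a + M) I.error (by linarith)
    (by positivity) hM (by positivity) hy ?_ ?_ ?_ ?_ ?_ ?_ ?_ ?_ ?_ ?_ ?_ ?_ hσ ht
  · exact ContinuousOn.sub (fun t ht => (hzd t ht).continuousWithinAt) hUc
  · intro t ht
    have ht' := Ioo_subset_Icc_self ht
    have h1 := (hzd t ht').hasDerivAt (Icc_mem_nhds ht.1 ht.2)
    have h2 := hasDerivAt_burgers_sub (u := kMul k (kFlow hk t (B t f)) + kComm hk t (B t f))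
      (v := kMul k (U t)) (U := fun t => kFlow hk t (B t f)) (h1.congr_deriv ?_) (hU t ht)
      (I.isH2 (hzs t ht')) (I.isH2 (hUs t ht'))
    · refine h2.congr_deriv ?_
      rw [kMul_sub hk (I.wnorm_symbol_lt_top (hzs t ht')) (I.wnorm_symbol_lt_top (hUs t ht'))]
      abel
    · unfold kComm
      rw [map_neg]
      abel
  · exact fun t ht => (I.isH2 (hzs t (Ioo_subset_Icc_self ht))).sub
      (I.isH2 (hUs t (Ioo_subset_Icc_self ht)))
  · exact fun t ht => I.isH2 (hzs t (Ioo_subset_Icc_self ht))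
  · exact fun t ht => I.isH2 (hUs t (Ioo_subset_Icc_self ht))
  · exact fun t ht => (hBb.herm t (Ioo_subset_Icc_self ht)).kFlow hk t
  · exact fun t ht => (wnorm_kFlow_le hk t _).trans (hBr t (Ioo_subset_Icc_self ht))
  · exact fun t ht => (wnorm_bw_mono i2 _).trans (hUM t (Ioo_subset_Icc_self ht))
  · intro t ht
    have ht' := Ioo_subset_Icc_self ht
    refine (wnorm_kComm_le hk (by linarith) (by linarith) I.one I.symbol (by linarith) hM ht'.1
      (I.isH2 (hBs t ht')) (hBM t ht')).trans ?_
    have := ht'.2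
    gcongr
  · intro t ht ω _
    have ht' := Ioo_subset_Icc_self ht
    exact energyIP_kMul_nonpos hk ((wnorm_sub_le (measurable_bw p) _ _).trans_lt
      (ENNReal.add_lt_top.2 ⟨I.wnorm_symbol_lt_top (hzs t ht'),
        I.wnorm_symbol_lt_top (hUs t ht')⟩)) ω
  · intro t ht
    rw [ENNReal.ofReal_add (by positivity) hM]
    refine (wnorm_sub_le (measurable_bw r) _ _).trans (add_le_add ?_ ?_)
    · exact (wnorm_kFlow_le hk t _).trans (hBr t ht)
    · exact (wnorm_bw_mono (by linarith) _).trans (hUM t ht)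
  · simpa only [hB0, kFlow_zero] using hy₀

/-- The two orders of the substeps differ by `O(σ²)`. -/
lemma wnorm_burgers_kFlow_sub_le (I : Indices p s r m) (hk : IsAdmissibleSymbol p A k)
    {B : ℝ → L2 → L2} (hB : IsBurgersFlow r a σ B) (ha : 0 ≤ a) {f : L2}
    (hf : f ∈ boundedData s r a) {M : ℝ} (hM : 0 ≤ M)
    (hBM : ∀ t ∈ Icc 0 σ, ∀ g ∈ boundedData s r a, wnorm (bw s) g ≤ wnorm (bw s) f →
      wnorm (bw s) (B t g) ≤ ENNReal.ofReal M)
    (hσ : 4 * σ * diffConst m r (2 * a) M ≤ 1) {θ : ℝ} (hθ : θ ∈ Icc 0 σ) :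
    wnorm (bw r) (kFlow hk θ (B θ f) - B θ (kFlow hk θ f) : L2) ≤ ENNReal.ofReal
      ((1 + 4 * σ * diffConst m r (2 * a) M) *
        (2 * σ * (σ * (commConst m p s A * M ^ 2)))) := by
  have i1 := I.error
  have i2 := I.one
  have i3 := I.weight
  have hσ0 := hθ.1.trans hθ.2
  have hA := hk.const_nonneg
  have hK : 0 ≤ commConst m p s A := by unfold commConst; positivity
  have hg : kFlow hk θ f ∈ boundedData s r a :=
    ⟨hf.1.kFlow hk θ, (wnorm_kFlow_le hk θ f).trans_lt hf.2.1, (wnorm_kFlow_le hk θ f).trans hf.2.2⟩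
  have hfM := fun t ht => hBM t ht f hf le_rfl
  have hgM := fun t ht => hBM t ht _ hg (wnorm_kFlow_le hk θ f)
  obtain ⟨hB0, hBb, -, hBr⟩ := hB f hf.1 hf.2.2 (I.isH2 hf.2.1)
  obtain ⟨hG0, hGb, -, hGr⟩ := hB _ hg.1 hg.2.2 (I.isH2 hg.2.1)
  rw [show (2 : ℝ) * σ * (σ * (commConst m p s A * M ^ 2)) =
    0 + 2 * σ * (σ * (commConst m p s A * M ^ 2)) by ring]
  -- The linear time is frozen at `θ` and only Burgers' time `t` runs. The dissipative term is
  -- absent, the commutator at time `θ` is the forcing, and the initial difference is 0.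
  refine wnorm_difference_le (D := fun t => kFlow hk θ (B t f) - B t (kFlow hk θ f))
    (X := fun _ => 0) (F := fun t => kComm hk θ (B t f))
    (U := fun t => kFlow hk θ (B t f)) (V := fun t => B t (kFlow hk θ f)) (B₀ := 2 * a + 2 * a)
    I.error (by linarith) (by positivity) hM (by positivity) le_rfl
    ?_ ?_ ?_ ?_ ?_ ?_ ?_ ?_ ?_ ?_ ?_ ?_ hσ hθ
  · exact ((kFlow hk θ).continuous.comp_continuousOn hBb.cont).sub hGb.cont
  · intro t ht
    have ht' := Ioo_subset_Icc_self ht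
    have h1 := (kFlow hk θ).hasFDerivAt.comp_hasDerivAt t (hBb.deriv t ht)
    have h2 := hasDerivAt_burgers_sub (u := kComm hk θ (B t f)) (v := 0)
      (U := fun t => kFlow hk θ (B t f)) (h1.congr_deriv ?_)
      ((hGb.deriv t ht).congr_deriv (by rw [zero_sub]))
      ((hBb.h2 t ht').kFlow hk θ) (hGb.h2 t ht')
    · refine h2.congr_deriv ?_
      abel
    · unfold kComm
      rw [map_neg]
      abel
  · exact fun t ht => ((hBb.h2 t (Ioo_subset_Icc_self ht)).kFlow hk θ).sub
      (hGb.h2 t (Ioo_subset_Icc_self ht))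
  · exact fun t ht => (hBb.h2 t (Ioo_subset_Icc_self ht)).kFlow hk θ
  · exact fun t ht => hGb.h2 t (Ioo_subset_Icc_self ht)
  · exact fun t ht => (hBb.herm t (Ioo_subset_Icc_self ht)).kFlow hk θ
  · exact fun t ht => (wnorm_kFlow_le hk θ _).trans (hBr t (Ioo_subset_Icc_self ht))
  · exact fun t ht => (wnorm_bw_mono i2 _).trans (hgM t (Ioo_subset_Icc_self ht))
  · intro t ht
    have ht' := Ioo_subset_Icc_self ht
    refine (wnorm_kComm_le hk (by linarith) (by linarith) I.one I.symbol (by linarith) hM hθ.1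
      (hBb.h2 t ht') (hfM t ht')).trans ?_
    have := hθ.2
    gcongr
  · intro t _ ω hω
    have := hω.energyIP_sub (kFlow hk θ (B t f) - B t (kFlow hk θ f)) 0 0
    rw [sub_self, sub_self] at this
    exact this.le
  · intro t ht
    rw [ENNReal.ofReal_add (by positivity) (by positivity)]
    exact (wnorm_sub_le (measurable_bw r) _ _).trans (add_le_add
      ((wnorm_kFlow_le hk θ _).trans (hBr t ht)) (hGr t ht))
  · simp only [hB0, hG0, sub_self]
    rw [wnorm_congr (Lp.coeFn_zero ℂ 2 volume)]
    simp [wnorm, norm2]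

end

/-! ### Continuity in H^s by tightness, and uniqueness for the substeps -/

noncomputable section

/-- The weight of `H^s`, damped at frequencies below `R`. -/
def tailWeight (s R ξ : ℝ) : ℝ := bw s ξ * min (|ξ| / R) 1

variable {p s r a σ A R : ℝ} {m : ℕ} {k : ℝ → ℂ}

/-- A product of a weight of order `m - 1` and one of order 1, which is why the indices demand `s +
1 ≤ m`. The energy estimate in this weight prevents H^s mass from escaping to high frequencies. -/
lemma Indices.isWeight_tailWeight (I : Indices p s r m) (hR : 0 < R) :
    IsWeight m (tailWeight s R) := by
  have h1 := I.error
  have h2 := I.one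
  have h3 := I.weight
  obtain ⟨n, rfl⟩ : ∃ n, m = n + 1 := by
    refine Nat.exists_eq_succ_of_ne_zero ?_
    rintro rfl
    norm_num at h3
    linarith
  push_cast at h3
  exact (isWeight_bw (m := n) (by linarith) (by linarith)).mul (IsWeight.min_one_abs_div hR)

lemma measurable_tailWeight (s R : ℝ) : Measurable (tailWeight s R) := by
  have := measurable_bw s
  unfold tailWeight
  fun_prop

lemma tailWeight_le (s R ξ : ℝ) : tailWeight s R ξ ≤ bw s ξ :=
  mul_le_of_le_one_right (bw_pos s ξ).le (min_le_right _ _)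

lemma bw_le_tailWeight (hs : 0 ≤ s) (hR : 0 < R) (ξ : ℝ) :
    bw s ξ ≤ bw s R + tailWeight s R ξ := by
  unfold tailWeight
  rcases le_total |ξ| R with h | h
  · have h1 : bw s ξ ≤ bw s R := bracket_rpow_mono hs (h.trans (le_abs_self R))
    have h2 : 0 ≤ bw s ξ * min (|ξ| / R) 1 := mul_nonneg (bw_pos s ξ).le (by positivity)
    linarith
  · rw [min_eq_right ((one_le_div hR).2 h), mul_one]
    linarith [bw_pos s R]

lemma wnorm_bw_le_tailWeight (hs : 0 ≤ s) (hR : 0 < R) (U : L2) :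
    wnorm (bw s) U ≤ ENNReal.ofReal (bw s R) * ‖U‖ₑ + wnorm (tailWeight s R) U := by
  have mU := measurable_coe U
  have mt := measurable_tailWeight s R
  rw [← wnorm_const]
  refine le_trans ?_ (norm2_add_le (by fun_prop) (by fun_prop))
  refine norm2_mono fun ξ => ?_
  have h1 : 0 ≤ tailWeight s R ξ := mul_nonneg (bw_pos s ξ).le (by positivity)
  rw [← add_mul, ← ENNReal.ofReal_add (bw_pos s R).le h1]
  gcongr
  exact bw_le_tailWeight hs hR ξ

lemma tendsto_wnorm_tailWeight {U : L2} (hU : wnorm (bw s) U < ∞) :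
    Tendsto (fun n : ℕ => wnorm (tailWeight s (n + 1)) U) atTop (𝓝 0) := by
  have mU := measurable_coe U
  have h0 : Tendsto (fun n : ℕ => ∫⁻ ξ, (ENNReal.ofReal (tailWeight s (n + 1) ξ) * ‖U ξ‖ₑ) ^ (2 : ℝ))
      atTop (𝓝 (∫⁻ _ : ℝ, 0)) := by
    refine tendsto_lintegral_of_dominated_convergence
      (fun ξ => (ENNReal.ofReal (bw s ξ) * ‖U ξ‖ₑ) ^ (2 : ℝ)) ?_ ?_ ?_ ?_
    · intro n
      have := measurable_tailWeight s (n + 1)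
      fun_prop
    · intro n
      refine Eventually.of_forall fun ξ => ?_
      have := tailWeight_le s (n + 1) ξ
      dsimp only
      gcongr
    · rw [← norm2_sq]
      exact (ENNReal.rpow_lt_top_of_nonneg (by norm_num) hU.ne).ne
    · refine Eventually.of_forall fun ξ => ?_
      have h1 : Tendsto (fun n : ℕ => tailWeight s (n + 1) ξ) atTop (𝓝 0) := by
        have h2 : Tendsto (fun n : ℕ => min (|ξ| / ((n : ℝ) + 1)) 1) atTop (𝓝 0) := by
          have h3 := (tendsto_one_div_add_atTop_nhds_zero_nat (𝕜 := ℝ)).const_mul |ξ|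
          rw [mul_zero] at h3
          refine squeeze_zero (fun n => by positivity) (fun n => (min_le_left _ _).trans ?_) h3
          rw [mul_one_div]
        simpa [tailWeight] using h2.const_mul (bw s ξ)
      have h4 := ENNReal.tendsto_ofReal h1
      rw [ENNReal.ofReal_zero] at h4
      have h5 := ENNReal.Tendsto.mul_const (b := ‖U ξ‖ₑ) h4 (Or.inr enorm_ne_top)
      rw [zero_mul] at h5
      have h6 := (ENNReal.continuous_rpow_const (y := 2)).tendsto 0 |>.comp h5
      simpa [Function.comp_def] using h6
  have h2 := (ENNReal.continuous_rpow_const (y := 1 / 2)).tendsto _ |>.comp h0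
  simpa [Function.comp_def, wnorm, norm2] using h2

/-- Continuity in `L²` and tightness in `H^s` give continuity in `H^s`. -/
lemma tendsto_wnorm_sub_of_tight {X : Type*} [TopologicalSpace X] {D : Set X} {w : X → L2} {P : X}
    (hs : 0 ≤ s) (hP : P ∈ D) (hc : ContinuousWithinAt w D P) {C : ℝ} {f : L2}
    (hf : wnorm (bw s) f < ∞)
    (h : ∀ Q ∈ D, ∀ R, 0 < R → wnorm (tailWeight s R) (w Q) ≤
      ENNReal.ofReal C * wnorm (tailWeight s R) f) :
    Tendsto (fun Q => wnorm (bw s) (w Q - w P : L2)) (𝓝[D] P) (𝓝 0) := by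
  rw [ENNReal.tendsto_nhds_zero]
  intro ε hε
  have hε2 : 0 < ε / 2 := ENNReal.half_pos hε.ne'
  have h1 := ENNReal.Tendsto.const_mul (a := ENNReal.ofReal C + ENNReal.ofReal C)
    (tendsto_wnorm_tailWeight hf) (Or.inr (by finiteness))
  rw [mul_zero] at h1
  -- The threshold depends only on the tail of `f`, hence is uniform in `Q`; frequencies below it
  -- are then handled by convergence in L².
  obtain ⟨n, hn⟩ := (h1.eventually_le_const hε2).exists
  set R : ℝ := (n : ℝ) + 1 with hR
  have hR0 : 0 < R := by positivity
  have h2 : Tendsto (fun Q => ‖w Q - w P‖ₑ) (𝓝[D] P) (𝓝 0) := by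
    have h3 : Tendsto w (𝓝[D] P) (𝓝 (w P)) := hc
    rw [tendsto_iff_edist_tendsto_0] at h3
    simpa only [edist_eq_enorm_sub] using h3
  have h3 := ENNReal.Tendsto.const_mul (a := ENNReal.ofReal (bw s R)) h2 (Or.inr (by finiteness))
  rw [mul_zero] at h3
  filter_upwards [h3.eventually_le_const hε2, self_mem_nhdsWithin] with Q hQ hQD
  refine (wnorm_bw_le_tailWeight hs hR0 _).trans ?_
  rw [← ENNReal.add_halves ε]
  refine add_le_add hQ ?_
  refine (wnorm_sub_le (measurable_tailWeight s R) _ _).trans (le_trans ?_ hn)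
  rw [add_mul]
  exact add_le_add (h Q hQD R hR0) (h P hP R hR0)

/-- Two successive substeps depend continuously on both times. -/
lemma IsSubstep.continuousOn_comp {𝒟 𝒟' : Set L2} {X Y : L2 → L2} {Φ Ψ : ℝ → L2 → L2}
    (hΦ : IsSubstep m σ 𝒟 X Φ) (hΨ : IsSubstep m σ 𝒟' Y Ψ)
    (hmap : ∀ f ∈ 𝒟, ∀ t ∈ Icc 0 σ, Φ t f ∈ 𝒟') {f : L2} (hf : f ∈ 𝒟) :
    ContinuousOn (fun P : ℝ × ℝ => Ψ P.2 (Φ P.1 f)) (Icc 0 σ ×ˢ Icc 0 σ) := by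
  obtain ⟨C, hC⟩ := hΨ.lip
  have c1 : ContinuousOn (fun t => Φ t f) (Icc 0 σ) :=
    fun t ht => (hΦ.deriv f hf t ht).continuousWithinAt
  intro P hP
  have c2 : ContinuousOn (fun t => Ψ t (Φ P.1 f)) (Icc 0 σ) :=
    fun t ht => (hΨ.deriv _ (hmap f hf _ hP.1) t ht).continuousWithinAt
  have h1 := (c1.comp continuousOn_fst fun Q (hQ : Q ∈ Icc 0 σ ×ˢ Icc 0 σ) => hQ.1) P hP
  have h2 := (c2.comp continuousOn_snd fun Q (hQ : Q ∈ Icc 0 σ ×ˢ Icc 0 σ) => hQ.2) P hP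
  unfold ContinuousWithinAt at h1 h2 ⊢
  rw [tendsto_iff_norm_sub_tendsto_zero] at h1 h2 ⊢
  have h3 := (h1.const_mul C).add h2
  rw [mul_zero, add_zero] at h3
  refine squeeze_zero' (Eventually.of_forall fun _ => norm_nonneg _) ?_ h3
  filter_upwards [self_mem_nhdsWithin] with Q hQ
  have h4 := hC _ (hmap f hf _ hQ.1) _ (hmap f hf _ hP.1) _ hQ.2
  refine (norm_sub_le_norm_sub_add_norm_sub _ (Ψ Q.2 (Φ P.1 f)) _).trans ?_
  exact add_le_add h4 le_rfl

/-- Uniqueness for the initial value problem of `f' = X f` among continuous functions that are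
bounded in `H^s`. -/
def HasUniqueSolutions (s : ℝ) (X : L2 → L2) : Prop :=
  ∀ (c d M : ℝ) (y z : ℝ → L2), ContinuousOn y (Icc c d) → ContinuousOn z (Icc c d) →
    (∀ t ∈ Icc c d, Herm (y t)) → (∀ t ∈ Icc c d, Herm (z t)) →
    (∀ t ∈ Icc c d, wnorm (bw s) (y t) ≤ ENNReal.ofReal M) →
    (∀ t ∈ Icc c d, wnorm (bw s) (z t) ≤ ENNReal.ofReal M) →
    (∀ t ∈ Ioo c d, HasDerivAt y (X (y t)) t) → (∀ t ∈ Ioo c d, HasDerivAt z (X (z t)) t) →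
    y c = z c → EqOn y z (Icc c d)

lemma hasUniqueSolutions_burgers (I : Indices p s r m) :
    HasUniqueSolutions s fun f => -adv f f := by
  intro c d M y z hy hz hyh hzh hyM hzM hyd hzd h0 t ht
  have i1 := I.error
  have i2 := I.one
  have hmaps : MapsTo (fun t => c + t) (Icc 0 (d - c)) (Icc c d) := fun t ht =>
    ⟨by linarith [ht.1], by linarith [ht.2]⟩
  have hmaps' : MapsTo (fun t => c + t) (Ioo 0 (d - c)) (Ioo c d) := fun t ht =>
    ⟨by linarith [ht.1], by linarith [ht.2]⟩
  have hB : ∀ y : ℝ → L2, ContinuousOn y (Icc c d) → (∀ t ∈ Icc c d, Herm (y t)) →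
      (∀ t ∈ Icc c d, wnorm (bw s) (y t) ≤ ENNReal.ofReal M) →
      (∀ t ∈ Ioo c d, HasDerivAt y (-adv (y t) (y t)) t) →
      IsBurgers (d - c) (fun t => y (c + t)) := fun y hy hyh hyM hyd =>
    { cont := hy.comp (by fun_prop) hmaps
      deriv := fun t ht => (hyd _ (hmaps' ht)).comp_const_add c t
      h2 := fun t ht => I.isH2 ((hyM _ (hmaps ht)).trans_lt ENNReal.ofReal_lt_top)
      herm := fun t ht => hyh _ (hmaps ht) }
  have hl : ∀ y : ℝ → L2, (∀ t ∈ Icc c d, wnorm (bw s) (y t) ≤ ENNReal.ofReal M) →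
      ∀ t ∈ Icc 0 (d - c), lnorm (bw 1) (y (c + t)) ≤
        ENNReal.ofReal ((embConst (s - 1)).toReal * max M 0) := fun y hyM t ht =>
    lnorm_one_le (by linarith) (measurable_coe _) ((hyM _ (hmaps ht)).trans
      (ENNReal.ofReal_le_ofReal (le_max_left _ _)))
  have key := (hB y hy hyh hyM hyd).norm_sub_le (hB z hz hzh hzM hzd) (by positivity) (hl y hyM)
    (hl z hzM) (t := t - c) ⟨by linarith [ht.1], by linarith [ht.2]⟩
  simp only [add_zero, h0, sub_self, norm_zero, mul_zero, add_sub_cancel] at key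
  exact sub_eq_zero.1 (norm_le_zero_iff.1 key)

lemma hasUniqueSolutions_kMul (I : Indices p s r m) (hk : IsAdmissibleSymbol p A k) :
    HasUniqueSolutions s (kMul k) := by
  intro c d M y z hy hz hyh hzh hyM hzM hyd hzd h0 t ht
  have hmaps : MapsTo (fun t => c + t) (Icc 0 (d - c)) (Icc c d) := fun t ht =>
    ⟨by linarith [ht.1], by linarith [ht.2]⟩
  have hmaps' : ∀ t ∈ Ioo 0 (d - c), c + t ∈ Ioo c d := fun t ht =>
    ⟨by linarith [ht.1], by linarith [ht.2]⟩
  have hfin : ∀ t ∈ Ioo c d, wnorm (bw p) (y t) < ∞ ∧ wnorm (bw p) (z t) < ∞ := fun t ht =>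
    ⟨I.wnorm_symbol_lt_top ((hyM _ (Ioo_subset_Icc_self ht)).trans_lt ENNReal.ofReal_lt_top),
      I.wnorm_symbol_lt_top ((hzM _ (Ioo_subset_Icc_self ht)).trans_lt ENNReal.ofReal_lt_top)⟩
  have key := le_add_mul_of_interior (y := fun t => wr (fun _ => 1) (y (c + t) - z (c + t) : L2) ^ 2)
    (c := 0) (σ := d - c) le_rfl
    ((BddWeight.one.continuousOn_wr ((hy.sub hz).comp (by fun_prop) hmaps)).pow 2)
    (fun t ht => BddWeight.one.hasDerivAt_sq (((hyd _ (hmaps' t ht)).comp_const_add c t).sub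
      ((hzd _ (hmaps' t ht)).comp_const_add c t)))
    (fun t ht => by
      obtain ⟨h1, h2⟩ := hfin _ (hmaps' t ht)
      rw [← kMul_sub hk h1 h2]
      have := energyIP_kMul_nonpos hk ((wnorm_sub_le (measurable_bw p) _ _).trans_lt
        (ENNReal.add_lt_top.2 ⟨h1, h2⟩)) (fun _ => 1)
      linarith) (t := t - c) ⟨by linarith [ht.1], by linarith [ht.2]⟩
  simp only [wr_one, add_zero, h0, sub_self, norm_zero, zero_mul, add_sub_cancel] at key
  have h3 : ‖y t - z t‖ ^ 2 ≤ 0 := by simpa using key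
  exact sub_eq_zero.1 (norm_eq_zero.1 (pow_eq_zero_iff two_ne_zero |>.1
    (le_antisymm h3 (sq_nonneg _))))

/-! ### The domain as a chain of squares, and uniqueness for the splitting -/

/-- The closed square `[t_j, t_{j+1}]²`. -/
def square (Δt : ℝ) (j : ℕ) : Set (ℝ × ℝ) :=
  Icc (j * Δt) ((j + 1) * Δt) ×ˢ Icc (j * Δt) ((j + 1) * Δt)

/-- Solutions of the splitting problem, on the Fourier side. -/
structure IsFourierSplitting (X Y : L2 → L2) (s Δt : ℝ) (n : ℕ) (f : L2) (V : ℝ × ℝ → L2) :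
    Prop where
  mem : ∀ P ∈ Domain Δt n, V P ∈ hermSobolev s
  tendsto : ∀ P ∈ Domain Δt n,
    Tendsto (fun Q => wnorm (bw s) (V Q - V P : L2)) (𝓝[Domain Δt n] P) (𝓝 0)
  first : ∀ t τ, (t, τ) ∈ Sigma1 Δt n →
    HasDerivWithinAt (fun t' => V (t', τ)) (X (V (t, τ))) {t' | (t', τ) ∈ Domain Δt n} t
  second : ∀ t τ, (t, τ) ∈ Sigma2 Δt n →
    HasDerivWithinAt (fun τ' => V (t, τ')) (Y (V (t, τ))) {τ' | (t, τ') ∈ Domain Δt n} τ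
  initial : V (0, 0) = f

/-- Steps are renumbered from 0, with `l = j + 1`. -/
lemma mem_Sigma1_iff {Δt : ℝ} {n : ℕ} {P : ℝ × ℝ} : P ∈ Sigma1 Δt n ↔
    ∃ j < n, P.1 ∈ Ioc (j * Δt) ((j + 1) * Δt) ∧ P.2 = j * Δt := by
  simp only [Sigma1, Omega1, mem_iUnion, mem_prod, mem_singleton_iff, exists_prop]
  constructor
  · rintro ⟨l, ⟨hl1, hln⟩, h1, h2⟩
    obtain ⟨j, rfl⟩ := Nat.exists_eq_succ_of_ne_zero (by omega : l ≠ 0)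
    refine ⟨j, by omega, ?_⟩
    push_cast at h1 h2
    rw [add_sub_cancel_right] at h1 h2
    exact ⟨h1, h2⟩
  · rintro ⟨j, hj, h1, h2⟩
    refine ⟨j + 1, ⟨by omega, by omega⟩, ?_⟩
    push_cast
    rw [add_sub_cancel_right]
    exact ⟨h1, h2⟩

lemma mem_Sigma2_iff {Δt : ℝ} {n : ℕ} {P : ℝ × ℝ} : P ∈ Sigma2 Δt n ↔
    ∃ j < n, P.1 ∈ Icc (j * Δt) ((j + 1) * Δt) ∧ P.2 ∈ Ioc (j * Δt) ((j + 1) * Δt) := by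
  simp only [Sigma2, Omega2, mem_iUnion, mem_prod, exists_prop]
  constructor
  · rintro ⟨l, ⟨hl1, hln⟩, h1, h2⟩
    obtain ⟨j, rfl⟩ := Nat.exists_eq_succ_of_ne_zero (by omega : l ≠ 0)
    refine ⟨j, by omega, ?_⟩
    push_cast at h1 h2
    rw [add_sub_cancel_right] at h1 h2
    exact ⟨h1, h2⟩
  · rintro ⟨j, hj, h1, h2⟩
    refine ⟨j + 1, ⟨by omega, by omega⟩, ?_⟩
    push_cast
    rw [add_sub_cancel_right]
    exact ⟨h1, h2⟩

lemma corner_mem_Domain (Δt : ℝ) {n j : ℕ} (hΔ : 0 < Δt) (hj : j ≤ n) :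
    ((j * Δt, j * Δt) : ℝ × ℝ) ∈ Domain Δt n := by
  rcases Nat.eq_zero_or_pos j with rfl | h
  · left; simp
  · right; right
    obtain ⟨i, rfl⟩ := Nat.exists_eq_succ_of_ne_zero h.ne'
    refine mem_Sigma2_iff.2 ⟨i, hj, ?_⟩
    push_cast
    exact ⟨⟨by nlinarith, le_rfl⟩, ⟨by nlinarith, le_rfl⟩⟩

lemma square_subset_Domain {Δt : ℝ} {n j : ℕ} (hΔ : 0 < Δt) (hj : j < n) :
    square Δt j ⊆ Domain Δt n := by
  rintro ⟨t, τ⟩ ⟨h1, h2⟩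
  rcases h2.1.eq_or_lt with h3 | h3
  · rcases h1.1.eq_or_lt with h4 | h4
    · have := corner_mem_Domain Δt hΔ hj.le
      dsimp only at h3 h4
      rwa [← h4, ← h3]
    · exact Or.inr (Or.inl (mem_Sigma1_iff.2 ⟨j, hj, ⟨h4, h1.2⟩, h3.symm⟩))
  · exact Or.inr (Or.inr (mem_Sigma2_iff.2 ⟨j, hj, h1, ⟨h3, h2.2⟩⟩))

lemma exists_mem_square {Δt : ℝ} {n : ℕ} (hΔ : 0 < Δt) (hn : 0 < n) {P : ℝ × ℝ}
    (hP : P ∈ Domain Δt n) : ∃ j < n, P ∈ square Δt j := by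
  rcases hP with h | h | h
  · rw [mem_singleton_iff] at h
    subst h
    refine ⟨0, hn, ?_⟩
    simp [square, hΔ.le]
  · obtain ⟨j, hj, h1, h2⟩ := mem_Sigma1_iff.1 h
    refine ⟨j, hj, Ioc_subset_Icc_self h1, ?_⟩
    rw [h2]
    exact ⟨le_rfl, by nlinarith⟩
  · obtain ⟨j, hj, h1, h2⟩ := mem_Sigma2_iff.1 h
    exact ⟨j, hj, h1, Ioc_subset_Icc_self h2⟩

lemma Domain_zero (Δt : ℝ) : Domain Δt 0 = {(0, 0)} := by
  ext P
  simp [Domain, Sigma1, Sigma2]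

/-- A solution is only assumed continuous in H^s; compactness of the squares provides the uniform
bound that the uniqueness statements for the substeps require. -/
lemma exists_wnorm_le_of_isCompact {X : Type*} [TopologicalSpace X] {D K : Set X} {w : X → L2}
    (hK : IsCompact K) (hKD : K ⊆ D) (hfin : ∀ P ∈ D, wnorm (bw s) (w P) < ∞)
    (hc : ∀ P ∈ D, Tendsto (fun Q => wnorm (bw s) (w Q - w P : L2)) (𝓝[D] P) (𝓝 0)) :
    ∃ M : ℝ, ∀ P ∈ K, wnorm (bw s) (w P) ≤ ENNReal.ofReal M := by
  refine hK.induction_on (p := fun S => ∃ M : ℝ, ∀ P ∈ S, wnorm (bw s) (w P) ≤ ENNReal.ofReal M)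
    ⟨0, fun P hP => absurd hP (notMem_empty P)⟩ ?_ ?_ ?_
  · rintro S T hST ⟨M, hM⟩
    exact ⟨M, fun P hP => hM P (hST hP)⟩
  · rintro S T ⟨M, hM⟩ ⟨M', hM'⟩
    refine ⟨max M M', fun P hP => ?_⟩
    rcases hP with hP | hP
    · exact (hM P hP).trans (ENNReal.ofReal_le_ofReal (le_max_left _ _))
    · exact (hM' P hP).trans (ENNReal.ofReal_le_ofReal (le_max_right _ _))
  · intro P hP
    have hfP := hfin P (hKD hP)
    refine ⟨{Q | wnorm (bw s) (w Q - w P : L2) ≤ 1}, ?_, (1 + wnorm (bw s) (w P)).toReal, ?_⟩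
    · exact nhdsWithin_mono P hKD ((hc P (hKD hP)).eventually_le_const zero_lt_one)
    · intro Q hQ
      rw [ENNReal.ofReal_toReal (by finiteness)]
      have h1 := wnorm_add_le (measurable_bw s) (w Q - w P) (w P)
      rw [sub_add_cancel] at h1
      exact h1.trans (add_le_add hQ le_rfl)

lemma continuousWithinAt_of_wnorm {X : Type*} [TopologicalSpace X] {D : Set X} {w : X → L2} {P : X}
    (hs : 0 ≤ s) (hc : Tendsto (fun Q => wnorm (bw s) (w Q - w P : L2)) (𝓝[D] P) (𝓝 0)) :
    ContinuousWithinAt w D P := by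
  unfold ContinuousWithinAt
  rw [tendsto_iff_edist_tendsto_0]
  refine tendsto_of_tendsto_of_tendsto_of_le_of_le tendsto_const_nhds hc (fun _ => zero_le)
    fun Q => ?_
  dsimp only
  rw [edist_eq_enorm_sub]
  exact enorm_le_wnorm_bw hs _

variable {X Y : L2 → L2} {Δt : ℝ} {n : ℕ} {f : L2} {V W : ℝ × ℝ → L2}

lemma IsFourierSplitting.continuousOn (hV : IsFourierSplitting X Y s Δt n f V) (hs : 0 ≤ s) :
    ContinuousOn V (Domain Δt n) := fun P hP => continuousWithinAt_of_wnorm hs (hV.tendsto P hP)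

lemma isCompact_square (Δt : ℝ) (j : ℕ) : IsCompact (square Δt j) := isCompact_Icc.prod isCompact_Icc

/-- Equality spreads from the corner along the bottom edge by uniqueness for the first substep, and
from there up every vertical segment by uniqueness for the second. -/
lemma IsFourierSplitting.eqOn_square (hV : IsFourierSplitting X Y s Δt n f V)
    (hW : IsFourierSplitting X Y s Δt n f W) (hX : HasUniqueSolutions s X)
    (hY : HasUniqueSolutions s Y) (hs : 0 ≤ s) (hΔ : 0 < Δt) {j : ℕ} (hj : j < n)
    (h0 : V (j * Δt, j * Δt) = W (j * Δt, j * Δt)) : EqOn V W (square Δt j) := by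
  have hsub := square_subset_Domain hΔ hj
  obtain ⟨M, hM⟩ := exists_wnorm_le_of_isCompact (isCompact_square Δt j) hsub
    (fun P hP => (hV.mem P hP).2) hV.tendsto
  obtain ⟨M', hM'⟩ := exists_wnorm_le_of_isCompact (isCompact_square Δt j) hsub
    (fun P hP => (hW.mem P hP).2) hW.tendsto
  have hVM : ∀ P ∈ square Δt j, wnorm (bw s) (V P) ≤ ENNReal.ofReal (max M M') := fun P hP =>
    (hM P hP).trans (ENNReal.ofReal_le_ofReal (le_max_left _ _))
  have hWM : ∀ P ∈ square Δt j, wnorm (bw s) (W P) ≤ ENNReal.ofReal (max M M') := fun P hP =>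
    (hM' P hP).trans (ENNReal.ofReal_le_ofReal (le_max_right _ _))
  have cV := (hV.continuousOn hs).mono hsub
  have cW := (hW.continuousOn hs).mono hsub
  have hle : (j : ℝ) * Δt ≤ (j + 1) * Δt := by nlinarith
  have line1 : ∀ t ∈ Icc (j * Δt) ((j + 1) * Δt), V (t, j * Δt) = W (t, j * Δt) := by
    have hm : MapsTo (fun t => ((t, j * Δt) : ℝ × ℝ)) (Icc (j * Δt) ((j + 1) * Δt))
        (square Δt j) := fun t ht => ⟨ht, le_rfl, hle⟩
    have hd : ∀ t ∈ Ioo (j * Δt) ((j + 1) * Δt), {t' | ((t', j * Δt) : ℝ × ℝ) ∈ Domain Δt n} ∈ 𝓝 t :=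
      fun t ht => mem_of_superset (Icc_mem_nhds ht.1 ht.2) fun t' ht' => hsub (hm ht')
    have hS : ∀ t ∈ Ioo (j * Δt) ((j + 1) * Δt), ((t, j * Δt) : ℝ × ℝ) ∈ Sigma1 Δt n :=
      fun t ht => mem_Sigma1_iff.2 ⟨j, hj, Ioo_subset_Ioc_self ht, rfl⟩
    exact hX _ _ (max M M') (fun t => V (t, j * Δt)) (fun t => W (t, j * Δt))
      (cV.comp (by fun_prop) hm) (cW.comp (by fun_prop) hm)
      (fun t ht => (hV.mem _ (hsub (hm ht))).1) (fun t ht => (hW.mem _ (hsub (hm ht))).1)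
      (fun t ht => hVM _ (hm ht)) (fun t ht => hWM _ (hm ht))
      (fun t ht => (hV.first t _ (hS t ht)).hasDerivAt (hd t ht))
      (fun t ht => (hW.first t _ (hS t ht)).hasDerivAt (hd t ht)) h0
  rintro ⟨t, τ⟩ ⟨ht, hτ⟩
  have hm : MapsTo (fun τ => ((t, τ) : ℝ × ℝ)) (Icc (j * Δt) ((j + 1) * Δt))
      (square Δt j) := fun τ hτ => ⟨ht, hτ⟩
  have hd : ∀ τ ∈ Ioo (j * Δt) ((j + 1) * Δt), {τ' | ((t, τ') : ℝ × ℝ) ∈ Domain Δt n} ∈ 𝓝 τ :=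
    fun τ hτ => mem_of_superset (Icc_mem_nhds hτ.1 hτ.2) fun t' ht' => hsub (hm ht')
  have hS : ∀ τ ∈ Ioo (j * Δt) ((j + 1) * Δt), ((t, τ) : ℝ × ℝ) ∈ Sigma2 Δt n :=
    fun τ hτ => mem_Sigma2_iff.2 ⟨j, hj, ht, Ioo_subset_Ioc_self hτ⟩
  exact hY _ _ (max M M') (fun τ => V (t, τ)) (fun τ => W (t, τ))
    (cV.comp (by fun_prop) hm) (cW.comp (by fun_prop) hm)
    (fun t ht => (hV.mem _ (hsub (hm ht))).1) (fun t ht => (hW.mem _ (hsub (hm ht))).1)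
    (fun t ht => hVM _ (hm ht)) (fun t ht => hWM _ (hm ht))
    (fun τ hτ => (hV.second t τ (hS τ hτ)).hasDerivAt (hd τ hτ))
    (fun τ hτ => (hW.second t τ (hS τ hτ)).hasDerivAt (hd τ hτ)) (line1 t ht) hτ

/-- Uniqueness for the splitting problem. -/
lemma IsFourierSplitting.eqOn (hV : IsFourierSplitting X Y s Δt n f V)
    (hW : IsFourierSplitting X Y s Δt n f W) (hX : HasUniqueSolutions s X)
    (hY : HasUniqueSolutions s Y) (hs : 0 ≤ s) (hΔ : 0 < Δt) : EqOn V W (Domain Δt n) := by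
  have key : ∀ j < n, EqOn V W (square Δt j) := by
    intro j
    induction j with
    | zero =>
      intro hj
      refine hV.eqOn_square hW hX hY hs hΔ hj ?_
      simp only [Nat.cast_zero, zero_mul, hV.initial, hW.initial]
    | succ i ih =>
      intro hj
      -- The lower left corner of each square is the upper right corner of the preceding one.
      refine hV.eqOn_square hW hX hY hs hΔ hj (ih (by omega) ?_)
      have : (i : ℝ) * Δt ≤ (i + 1) * Δt := by nlinarith
      push_cast
      exact ⟨⟨this, le_rfl⟩, ⟨this, le_rfl⟩⟩
  intro P hP
  rcases Nat.eq_zero_or_pos n with rfl | hn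
  · rw [Domain_zero, mem_singleton_iff] at hP
    rw [hP, hV.initial, hW.initial]
  · obtain ⟨j, hj, hPj⟩ := exists_mem_square hΔ hn hP
    exact key j hj hPj

end

/-! ### Gluing the flows into a splitting solution -/

noncomputable section

variable {p s r a σ A Δt : ℝ} {m n : ℕ} {k : ℝ → ℂ} {X Y : L2 → L2}

/-- The solution of the splitting problem: on the square `[t_j, t_{j+1}]²` both flows start from
the value `g j` at the corner. -/
def glue (Φ Ψ : ℝ → L2 → L2) (Δt : ℝ) (g : ℕ → L2) (P : ℝ × ℝ) : L2 :=
  Ψ (P.2 - ⌊(P.1 + P.2) / (2 * Δt)⌋₊ * Δt)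
    (Φ (P.1 - ⌊(P.1 + P.2) / (2 * Δt)⌋₊ * Δt) (g ⌊(P.1 + P.2) / (2 * Δt)⌋₊))

/-- On the square with index `j` the floor in `glue` equals `j`, except at the upper right corner,
where it jumps to `j + 1`. There both formulas give `g (j + 1)`, because the flows are the identity
at time 0. -/
lemma glue_eq {𝒟 𝒟' : Set L2} {Φ Ψ : ℝ → L2 → L2} (hΦ : IsSubstep m Δt 𝒟 X Φ)
    (hΨ : IsSubstep m Δt 𝒟' Y Ψ) (hmap : ∀ f ∈ 𝒟, ∀ t ∈ Icc 0 Δt, Φ t f ∈ 𝒟') {g : ℕ → L2}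
    (hΔ : 0 < Δt) {j : ℕ} (hg : g (j + 1) ∈ 𝒟) (hsucc : g (j + 1) = Ψ Δt (Φ Δt (g j)))
    {P : ℝ × ℝ} (hP : P ∈ square Δt j) :
    glue Φ Ψ Δt g P = Ψ (P.2 - j * Δt) (Φ (P.1 - j * Δt) (g j)) := by
  obtain ⟨⟨h1, h2⟩, h3, h4⟩ := hP
  have hlow : (j : ℝ) ≤ (P.1 + P.2) / (2 * Δt) := by
    rw [le_div_iff₀ (by positivity)]; linarith
  rcases (show P.1 + P.2 ≤ 2 * ((j + 1) * Δt) by linarith).eq_or_lt with h | h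
  · have e1 : P.1 = (j + 1) * Δt := by linarith
    have e2 : P.2 = (j + 1) * Δt := by linarith
    have e3 : ⌊(P.1 + P.2) / (2 * Δt)⌋₊ = j + 1 := by
      have : (P.1 + P.2) / (2 * Δt) = ((j + 1 : ℕ) : ℝ) := by
        rw [h]; push_cast; field_simp
      rw [this, Nat.floor_natCast]
    have e0 := hmap _ hg 0 ⟨le_rfl, hΔ.le⟩
    have z1 := hΦ.zero _ hg
    rw [z1] at e0
    unfold glue
    rw [e3, e1, e2]
    push_cast
    rw [sub_self, z1, hΨ.zero _ e0, hsucc]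
    congr 2
    all_goals ring
  · have e3 : ⌊(P.1 + P.2) / (2 * Δt)⌋₊ = j := by
      rw [Nat.floor_eq_iff (by linarith [Nat.cast_nonneg (α := ℝ) j])]
      refine ⟨hlow, ?_⟩
      rw [div_lt_iff₀ (by positivity)]
      linarith
    unfold glue
    rw [e3]

/-- Pieces that do not contain `x` have it outside their closure and impose nothing, so one-sided
derivatives with a common value on the adjacent squares combine. -/
lemma hasDerivWithinAt_biUnion {E : Type*} [NormedAddCommGroup E] [NormedSpace ℝ E] {n : ℕ}
    {S : ℕ → Set ℝ} {f : ℝ → E} {f' : E} {x : ℝ} (hS : ∀ j, IsClosed (S j))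
    (h : ∀ j < n, x ∈ S j → HasDerivWithinAt f f' (S j) x) :
    HasDerivWithinAt f f' (⋃ j < n, S j) x := by
  induction n with
  | zero => exact HasFDerivWithinAt.of_notMem_closure (by simp)
  | succ n ih =>
    rw [biUnion_lt_succ]
    refine (ih fun j hj => h j (by omega)).union ?_
    by_cases hx : x ∈ S n
    · exact h n (by omega) hx
    · exact HasFDerivWithinAt.of_notMem_closure (by rwa [(hS n).closure_eq])

lemma tendsto_nhdsWithin_biUnion {n : ℕ} {S : ℕ → Set (ℝ × ℝ)} {f : ℝ × ℝ → ℝ≥0∞} {x : ℝ × ℝ}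
    (hS : ∀ j, IsClosed (S j)) (h : ∀ j < n, x ∈ S j → Tendsto f (𝓝[S j] x) (𝓝 0)) :
    Tendsto f (𝓝[⋃ j < n, S j] x) (𝓝 0) := by
  induction n with
  | zero => simp
  | succ n ih =>
    rw [biUnion_lt_succ, nhdsWithin_union]
    refine Tendsto.sup (ih fun j hj => h j (by omega)) ?_
    by_cases hx : x ∈ S n
    · exact h n (by omega) hx
    · rw [notMem_closure_iff_nhdsWithin_eq_bot.1 (by rwa [(hS n).closure_eq])]
      exact tendsto_bot

lemma isClosed_square (Δt : ℝ) (j : ℕ) : IsClosed (square Δt j) := isClosed_Icc.prod isClosed_Icc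

lemma Domain_eq_biUnion (hΔ : 0 < Δt) (hn : 0 < n) : Domain Δt n = ⋃ j < n, square Δt j := by
  ext P
  simp only [mem_iUnion, exists_prop]
  exact ⟨exists_mem_square hΔ hn, fun ⟨j, hj, h⟩ => square_subset_Domain hΔ hj h⟩

/-- Existence for the splitting problem. -/
lemma isFourierSplitting_glue {𝒟 𝒟' : Set L2} {Φ Ψ : ℝ → L2 → L2} (I : Indices p s r m)
    (hΦ : IsSubstep m Δt 𝒟 X Φ) (hΨ : IsSubstep m Δt 𝒟' Y Ψ)
    (hmap : ∀ f ∈ 𝒟, ∀ t ∈ Icc 0 Δt, Φ t f ∈ 𝒟') (hfin : ∀ f ∈ 𝒟, wnorm (bw s) f < ∞)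
    {g : ℕ → L2} (hΔ : 0 < Δt) (hg : ∀ j ≤ n, g j ∈ 𝒟)
    (hsucc : ∀ j < n, g (j + 1) = Ψ Δt (Φ Δt (g j))) :
    IsFourierSplitting X Y s Δt n (g 0) (glue Φ Ψ Δt g) := by
  obtain ⟨C₁, hC₁⟩ := hΦ.weight
  obtain ⟨C₂, hC₂⟩ := hΨ.weight
  have hs : 0 ≤ s := by linarith [I.error, I.one]
  have hgl : ∀ j < n, ∀ P ∈ square Δt j, glue Φ Ψ Δt g P =
      Ψ (P.2 - j * Δt) (Φ (P.1 - j * Δt) (g j)) := fun j hj P hP =>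
    glue_eq hΦ hΨ hmap hΔ (hg (j + 1) hj) (hsucc j hj) hP
  have hsh : ∀ (j : ℕ) (t : ℝ), t ∈ Icc (j * Δt) ((j + 1) * Δt) → t - j * Δt ∈ Icc 0 Δt :=
    fun j t ht => ⟨by linarith [ht.1], by linarith [ht.2]⟩
  -- The constant does not depend on the weight: the weight of H^s yields membership, and the tail
  -- weights yield tightness.
  have hwt : ∀ j < n, ∀ P ∈ square Δt j, ∀ ω, IsWeight m ω → wnorm ω (glue Φ Ψ Δt g P) ≤
      ENNReal.ofReal (max C₂ 0 * C₁) * wnorm ω (g j) := by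
    intro j hj P hP ω hω
    rw [hgl j hj P hP, ENNReal.ofReal_mul (le_max_right _ _), mul_assoc]
    refine (hC₂ _ (hmap _ (hg j hj.le) _ (hsh j _ hP.1)) _ (hsh j _ hP.2) ω hω).trans ?_
    gcongr
    · exact le_max_left _ _
    · exact hC₁ _ (hg j hj.le) _ (hsh j _ hP.1) ω hω
  have h00 : glue Φ Ψ Δt g (0, 0) = g 0 := by
    have h0 := hg 0 (Nat.zero_le n)
    have h1 := hmap _ h0 0 ⟨le_rfl, hΔ.le⟩
    have z1 := hΦ.zero _ h0
    rw [z1] at h1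
    simp only [glue, add_zero, zero_div, Nat.floor_zero, Nat.cast_zero, zero_mul, sub_self]
    rw [z1, hΨ.zero _ h1]
  have hmem : ∀ j < n, ∀ P ∈ square Δt j, glue Φ Ψ Δt g P ∈ hermSobolev s := by
    intro j hj P hP
    refine ⟨?_, (hwt j hj P hP _ I.isWeight).trans_lt (ENNReal.mul_lt_top ENNReal.ofReal_lt_top
      (hfin _ (hg j hj.le)))⟩
    rw [hgl j hj P hP]
    exact hΨ.herm _ (hmap _ (hg j hj.le) _ (hsh j _ hP.1)) _ (hsh j _ hP.2)
  refine ⟨?_, ?_, ?_, ?_, h00⟩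
  · intro P hP
    -- Without a step, which happens when `Δt` exceeds the time horizon, the domain is the single
    -- point `(0, 0)`.
    rcases Nat.eq_zero_or_pos n with rfl | hn
    · rw [Domain_zero, mem_singleton_iff] at hP
      have h0 := hg 0 le_rfl
      rw [hP, h00]
      refine ⟨?_, hfin _ h0⟩
      have := hΦ.herm _ h0 0 ⟨le_rfl, hΔ.le⟩
      rwa [hΦ.zero _ h0] at this
    · obtain ⟨j, hj, hPj⟩ := exists_mem_square hΔ hn hP
      exact hmem j hj P hPj
  · intro P hP
    rcases Nat.eq_zero_or_pos n with rfl | hn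
    · rw [Domain_zero, mem_singleton_iff] at hP
      rw [Domain_zero, ← hP, nhdsWithin_singleton, tendsto_pure_left]
      intro S hS
      have : wnorm (bw s) (glue Φ Ψ Δt g P - glue Φ Ψ Δt g P : L2) = 0 := by
        rw [sub_self, wnorm_congr (Lp.coeFn_zero ℂ 2 volume)]
        simp [wnorm, norm2]
      rw [this]
      exact mem_of_mem_nhds hS
    · rw [Domain_eq_biUnion hΔ hn]
      refine tendsto_nhdsWithin_biUnion (isClosed_square Δt) fun j hj hPj => ?_
      have hc : ContinuousOn (glue Φ Ψ Δt g) (square Δt j) := by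
        have h1 := hΦ.continuousOn_comp hΨ hmap (hg j hj.le)
        have h2 : ContinuousOn (fun P : ℝ × ℝ => Ψ (P.2 - j * Δt) (Φ (P.1 - j * Δt) (g j)))
            (square Δt j) :=
          h1.comp (f := fun P : ℝ × ℝ => (P.1 - j * Δt, P.2 - j * Δt)) (by fun_prop)
            fun P hP => ⟨hsh j _ hP.1, hsh j _ hP.2⟩
        exact h2.congr (hgl j hj)
      exact tendsto_wnorm_sub_of_tight hs hPj (hc P hPj) (hfin _ (hg j hj.le))
        fun Q hQ R hR => hwt j hj Q hQ _ (I.isWeight_tailWeight hR)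
  · intro t τ hS
    obtain ⟨j, hj, ht, hτ⟩ := mem_Sigma1_iff.1 hS
    dsimp only at ht hτ
    have hn : 0 < n := by omega
    have hsl : {t' | ((t', τ) : ℝ × ℝ) ∈ Domain Δt n} =
        ⋃ i < n, {t' | ((t', τ) : ℝ × ℝ) ∈ square Δt i} := by
      rw [Domain_eq_biUnion hΔ hn]
      ext t'
      simp
    rw [hsl]
    refine hasDerivWithinAt_biUnion (fun i => (isClosed_square Δt i).preimage (by fun_prop))
      fun i hi hti => ?_
    -- The horizontal line at height `t_j` also meets the top edge of the previous square, but the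
    -- left endpoint is excluded from `Sigma1`, so only the square `j` contains the point.
    have hij : i = j := by
      obtain ⟨⟨-, h2⟩, h3, -⟩ := hti
      dsimp only at h2 h3
      have a1 : (j : ℝ) < i + 1 := by
        have := ht.1.trans_le h2
        exact lt_of_mul_lt_mul_right this hΔ.le
      have a2 : (i : ℝ) ≤ j := by
        rw [hτ] at h3
        exact le_of_mul_le_mul_right h3 hΔ
      have a1' : j < i + 1 := by exact_mod_cast a1
      have a2' : i ≤ j := by exact_mod_cast a2
      omega
    subst hij
    have hgj := hg i hj.le
    have hform : ∀ t' : ℝ, ((t', τ) : ℝ × ℝ) ∈ square Δt i →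
        glue Φ Ψ Δt g (t', τ) = Φ (t' - i * Δt) (g i) := by
      intro t' ht'
      rw [hgl i hi _ ht']
      dsimp only
      rw [hτ, sub_self, hΨ.zero _ (hmap _ hgj _ (hsh i _ ht'.1))]
    have hd := hΦ.deriv _ hgj _ (hsh i t (Ioc_subset_Icc_self ht))
    have hd2 := hd.scomp t ((hasDerivWithinAt_id t _).sub_const (i * Δt))
      (fun t' (ht' : t' ∈ {t' | ((t', τ) : ℝ × ℝ) ∈ square Δt i}) => hsh i t' ht'.1)
    rw [one_smul] at hd2
    rw [hform t hti]
    exact hd2.congr (fun t' ht' => hform t' ht') (hform t hti)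
  · intro t τ hS
    obtain ⟨j, hj, ht, hτ⟩ := mem_Sigma2_iff.1 hS
    have hn : 0 < n := by omega
    have hsl : {τ' | ((t, τ') : ℝ × ℝ) ∈ Domain Δt n} =
        ⋃ i < n, {τ' | ((t, τ') : ℝ × ℝ) ∈ square Δt i} := by
      rw [Domain_eq_biUnion hΔ hn]
      ext t'
      simp
    rw [hsl]
    refine hasDerivWithinAt_biUnion (fun i => (isClosed_square Δt i).preimage (by fun_prop))
      fun i hi hti => ?_
    -- The second equation holds on every closed square including its lower edge, so a corner shared
    -- by two squares needs no distinction: both sides give the same derivative.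
    have hd := hΨ.deriv _ (hmap _ (hg i hi.le) _ (hsh i _ hti.1)) _ (hsh i τ hti.2)
    have hd2 := hd.scomp τ ((hasDerivWithinAt_id τ _).sub_const (i * Δt))
      (fun τ' (hτ' : τ' ∈ {τ' | ((t, τ') : ℝ × ℝ) ∈ square Δt i}) => hsh i τ' hτ'.2)
    rw [one_smul] at hd2
    rw [hgl i hi _ hti]
    exact hd2.congr (fun τ' hτ' => hgl i hi _ hτ') (hgl i hi _ hti)

/-! ### Translation between the physical and the Fourier side -/

/-- Membership in the real Sobolev space, on the Fourier side. -/
lemma mem_realSobolev_iff (hs : 2 ≤ s) (f : L2) :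
    f ∈ realSobolev s ↔ (𝓕 f : L2) ∈ hermSobolev s := by
  unfold realSobolev hermSobolev
  rw [mem_ofPred_eq, mem_ofPred_eq, sobolevNorm_eq, and_comm]
  refine and_congr_left fun h => ?_
  exact im_eq_zero_iff_herm f (isH2_of_wnorm_bw hs h).integrable

lemma fourier_sub (f g : L2) : (𝓕 (f - g) : L2) = 𝓕 f - 𝓕 g :=
  map_sub (Lp.fourierTransformₗᵢ ℝ ℂ) f g

lemma fourier_neg (f : L2) : (𝓕 (-f) : L2) = -𝓕 f := map_neg (Lp.fourierTransformₗᵢ ℝ ℂ) f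

lemma hasDerivWithinAt_fourier_iff {y : ℝ → L2} {y' : L2} {S : Set ℝ} {t : ℝ} :
    HasDerivWithinAt (fun t => (𝓕 (y t) : L2)) (𝓕 y') S t ↔ HasDerivWithinAt y y' S t := by
  have key : ∀ (L : L2 ≃ₗᵢ[ℂ] L2) (y : ℝ → L2) (y' : L2), HasDerivWithinAt y y' S t →
      HasDerivWithinAt (fun t => L (y t)) (L y') S t := fun L y y' h =>
    ((L.toContinuousLinearEquiv : L2 →L[ℂ] L2).restrictScalars
      ℝ).hasFDerivAt.comp_hasDerivWithinAt t h
  constructor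
  · intro h
    have h1 := key (Lp.fourierTransformₗᵢ ℝ ℂ).symm _ _ h
    have e : ∀ f : L2, (Lp.fourierTransformₗᵢ ℝ ℂ).symm (𝓕 f : L2) = f := fun f =>
      (Lp.fourierTransformₗᵢ ℝ ℂ).symm_apply_apply f
    simpa only [e] using h1
  · exact key (Lp.fourierTransformₗᵢ ℝ ℂ) y y'

/-- The splitting problem and its Fourier side. -/
lemma isSplittingSolution_iff {A B : L2 → L2} (hs : 2 ≤ s)
    (hA : ∀ f : L2, (𝓕 f : L2) ∈ hermSobolev s → (𝓕 (A f) : L2) = X (𝓕 f))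
    (hB : ∀ f : L2, (𝓕 f : L2) ∈ hermSobolev s → (𝓕 (B f) : L2) = Y (𝓕 f))
    (u₀ : L2) (v : ℝ × ℝ → L2) :
    IsSplittingSolution A B s Δt n u₀ v ↔
      IsFourierSplitting X Y s Δt n (𝓕 u₀) (fun P => 𝓕 (v P)) := by
  have hS1 : ∀ P ∈ Sigma1 Δt n, P ∈ Domain Δt n := fun P h => Or.inr (Or.inl h)
  have hS2 : ∀ P ∈ Sigma2 Δt n, P ∈ Domain Δt n := fun P h => Or.inr (Or.inr h)
  have hinj : ∀ f g : L2, (𝓕 f : L2) = 𝓕 g ↔ f = g := fun f g =>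
    (Lp.fourierTransformₗᵢ ℝ ℂ).injective.eq_iff
  constructor
  · rintro ⟨⟨h1, h2⟩, h3, h4, h5⟩
    have hm : ∀ P ∈ Domain Δt n, (𝓕 (v P) : L2) ∈ hermSobolev s := fun P hP =>
      (mem_realSobolev_iff hs _).1 (h1 P hP)
    refine ⟨hm, fun P hP => ?_, fun t τ h => ?_, fun t τ h => ?_, by rw [h5]⟩
    · simpa only [sobolevNorm_eq, fourier_sub] using h2 P hP
    · rw [← hA _ (hm _ (hS1 _ h))]
      exact hasDerivWithinAt_fourier_iff.2 (h3 t τ h)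
    · rw [← hB _ (hm _ (hS2 _ h))]
      exact hasDerivWithinAt_fourier_iff.2 (h4 t τ h)
  · rintro ⟨hm, h2, h3, h4, h5⟩
    refine ⟨⟨fun P hP => (mem_realSobolev_iff hs _).2 (hm P hP), fun P hP => ?_⟩,
      fun t τ h => ?_, fun t τ h => ?_, (hinj _ _).1 h5⟩
    · simpa only [sobolevNorm_eq, fourier_sub] using h2 P hP
    · have := h3 t τ h
      rw [← hA _ (hm _ (hS1 _ h))] at this
      exact hasDerivWithinAt_fourier_iff.1 this
    · have := h4 t τ h
      rw [← hB _ (hm _ (hS2 _ h))] at this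
      exact hasDerivWithinAt_fourier_iff.1 this

end

/-! ### Stability and consistency imply convergence -/

noncomputable section

variable {p s r a A Δt : ℝ} {m n : ℕ} {k : ℝ → ℂ} {X Y : L2 → L2}

lemma IsSubstep.mono {σ : ℝ} {𝒟 𝒟' : Set L2} {Φ : ℝ → L2 → L2} (h : IsSubstep m σ 𝒟 X Φ)
    (hsub : 𝒟' ⊆ 𝒟) : IsSubstep m σ 𝒟' X Φ where
  zero f hf := h.zero f (hsub hf)
  deriv f hf := h.deriv f (hsub hf)
  lip := let ⟨C, hC⟩ := h.lip; ⟨C, fun f hf g hg => hC f (hsub hf) g (hsub hg)⟩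
  herm f hf := h.herm f (hsub hf)
  weight := let ⟨C, hC⟩ := h.weight; ⟨C, fun f hf => hC f (hsub hf)⟩

/-- `S` is a one-step method on `n` steps: `ρ` controls the growth in `H^s`, and the error against
`U` obeys a recursion with constants `κ` and `Q`. -/
structure IsOneStepMethod (s r C₀ ρ κ Q Δt : ℝ) (n : ℕ) (U : ℝ → L2) (S : ℝ → L2 → L2) : Prop where
  herm : ∀ f ∈ boundedData s r (2 * C₀), Herm (S Δt f)
  growth : ∀ f ∈ boundedData s r (2 * C₀),
    wnorm (bw s) (S Δt f) ≤ ENNReal.ofReal (Real.exp (ρ * Δt)) * wnorm (bw s) f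
  error : ∀ j < n, ∀ f ∈ boundedData s r (2 * C₀),
    wnorm (bw s) f ≤ ENNReal.ofReal (Real.exp (ρ * (j * Δt)) * C₀) → ∀ y, 0 ≤ y →
      wnorm (bw r) (f - U (j * Δt) : L2) ≤ ENNReal.ofReal y → ∀ θ ∈ Icc 0 Δt,
        wnorm (bw r) (S θ f - U (j * Δt + θ) : L2) ≤
          ENNReal.ofReal ((1 + κ * Δt) * (y + Q * Δt ^ 2))

/-- The iterates of a one-step method. -/
def iterates (S : ℝ → L2 → L2) (Δt : ℝ) (f : L2) : ℕ → L2
  | 0 => f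
  | j + 1 => S Δt (iterates S Δt f j)

/-- The bound `exp (κ t_j) * Q * t_j * Δt` reproduces itself, since `1 + κ Δt ≤ exp (κ Δt)` and the
new defect `Q Δt²` may be enlarged by `exp (κ t_j) ≥ 1`. -/
lemma error_recursion_le {κ Q Δt : ℝ} (hQ : 0 ≤ Q) (hκ : 0 ≤ κ) (hΔ : 0 < Δt) (j : ℕ) :
    (1 + κ * Δt) * (Real.exp (κ * (j * Δt)) * Q * (j * Δt) * Δt + Q * Δt ^ 2) ≤
      Real.exp (κ * ((j + 1 : ℕ) * Δt)) * Q * ((j + 1 : ℕ) * Δt) * Δt := by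
  have h1 : 1 + κ * Δt ≤ Real.exp (κ * Δt) := by linarith [Real.add_one_le_exp (κ * Δt)]
  have h2 : 1 ≤ Real.exp (κ * (j * Δt)) := Real.one_le_exp (by positivity)
  have h3 : Real.exp (κ * ((j + 1 : ℕ) * Δt)) = Real.exp (κ * Δt) * Real.exp (κ * (j * Δt)) := by
    rw [← Real.exp_add]; congr 1; push_cast; ring
  have h4 : Q * Δt ^ 2 ≤ Real.exp (κ * (j * Δt)) * (Q * Δt ^ 2) :=
    le_mul_of_one_le_left (by positivity) h2
  rw [h3]
  calc _ ≤ Real.exp (κ * Δt) * (Real.exp (κ * (j * Δt)) * Q * (j * Δt) * Δt +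
        Real.exp (κ * (j * Δt)) * (Q * Δt ^ 2)) := by gcongr
    _ = _ := by push_cast; ring

lemma error_bound_le {κ Q Δt T : ℝ} (hQ : 0 ≤ Q) (hκ : 0 ≤ κ) (hΔ : 0 < Δt) {j : ℕ}
    (hj : j * Δt ≤ T) :
    Real.exp (κ * (j * Δt)) * Q * (j * Δt) * Δt ≤ Real.exp (κ * T) * Q * T * Δt := by
  gcongr

/-- Stability and consistency give convergence. -/
lemma IsOneStepMethod.iterates_bound {C₀ ρ κ Q T : ℝ} {U : ℝ → L2} {S : ℝ → L2 → L2}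
    (h : IsOneStepMethod s r C₀ ρ κ Q Δt n U S) (hC₀ : 0 < C₀) (hrs : r ≤ s) (hκ : 0 ≤ κ)
    (hQ : 0 ≤ Q) (hΔ : 0 < Δt) (hnT : n * Δt ≤ T)
    (hU : ∀ t ∈ Icc 0 T, wnorm (bw s) (U t) ≤ ENNReal.ofReal C₀) (hU0 : Herm (U 0))
    (hsmall : Real.exp (κ * T) * Q * T * Δt ≤ C₀) :
    ∀ j ≤ n, iterates S Δt (U 0) j ∈ boundedData s r (2 * C₀) ∧
      wnorm (bw s) (iterates S Δt (U 0) j) ≤ ENNReal.ofReal (Real.exp (ρ * (j * Δt)) * C₀) ∧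
      wnorm (bw r) (iterates S Δt (U 0) j - U (j * Δt) : L2) ≤
        ENNReal.ofReal (Real.exp (κ * (j * Δt)) * Q * (j * Δt) * Δt) := by
  have hjT : ∀ j ≤ n, (j : ℝ) * Δt ≤ T := fun j hj =>
    (mul_le_mul_of_nonneg_right (by exact_mod_cast hj) hΔ.le).trans hnT
  -- The closing of the bootstrap: an error of at most `C₀` added to an exact solution of size at
  -- most `C₀` keeps the iterate within `2 * C₀` in H^r, where the next step is defined and its
  -- estimates hold.
  have hr : ∀ j ≤ n, wnorm (bw r) (iterates S Δt (U 0) j - U (j * Δt) : L2) ≤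
      ENNReal.ofReal (Real.exp (κ * (j * Δt)) * Q * (j * Δt) * Δt) →
      wnorm (bw r) (iterates S Δt (U 0) j) ≤ ENNReal.ofReal (2 * C₀) := by
    intro j hj he
    have h1 := wnorm_add_le (measurable_bw r) (iterates S Δt (U 0) j - U (j * Δt)) (U (j * Δt))
    rw [sub_add_cancel] at h1
    have h2 := (wnorm_bw_mono hrs _).trans (hU (j * Δt) ⟨by positivity, hjT j hj⟩)
    rw [two_mul, ENNReal.ofReal_add hC₀.le hC₀.le]
    exact h1.trans (add_le_add (he.trans (ENNReal.ofReal_le_ofReal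
      ((error_bound_le hQ hκ hΔ (hjT j hj)).trans hsmall))) h2)
  intro j
  induction j with
  | zero =>
    intro _
    have e0 : wnorm (bw r) (iterates S Δt (U 0) 0 - U ((0 : ℕ) * Δt) : L2) ≤
        ENNReal.ofReal (Real.exp (κ * ((0 : ℕ) * Δt)) * Q * ((0 : ℕ) * Δt) * Δt) := by
      simp only [iterates, Nat.cast_zero, zero_mul, sub_self]
      rw [wnorm_congr (Lp.coeFn_zero ℂ 2 volume)]
      simp [wnorm, norm2]
    have h1 := hU 0 ⟨le_rfl, (by positivity : (0 : ℝ) ≤ n * Δt).trans hnT⟩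
    refine ⟨⟨hU0, h1.trans_lt ENNReal.ofReal_lt_top, hr 0 (Nat.zero_le n) e0⟩, ?_, e0⟩
    simpa [iterates] using h1
  | succ i ih =>
    intro hi
    obtain ⟨h1, h2, h3⟩ := ih (by omega)
    have e0 : wnorm (bw r) (iterates S Δt (U 0) (i + 1) - U ((i + 1 : ℕ) * Δt) : L2) ≤
        ENNReal.ofReal (Real.exp (κ * ((i + 1 : ℕ) * Δt)) * Q * ((i + 1 : ℕ) * Δt) * Δt) := by
      have h4 := h.error i hi _ h1 h2 _ (by positivity) h3 Δt ⟨hΔ.le, le_rfl⟩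
      have h5 : (i : ℝ) * Δt + Δt = (i + 1 : ℕ) * Δt := by push_cast; ring
      rw [h5] at h4
      exact h4.trans (ENNReal.ofReal_le_ofReal (error_recursion_le hQ hκ hΔ i))
    have e1 : wnorm (bw s) (iterates S Δt (U 0) (i + 1)) ≤
        ENNReal.ofReal (Real.exp (ρ * ((i + 1 : ℕ) * Δt)) * C₀) := by
      refine (h.growth _ h1).trans ((mul_le_mul' le_rfl h2).trans (le_of_eq ?_))
      rw [← ENNReal.ofReal_mul (Real.exp_pos _).le, ← mul_assoc, ← Real.exp_add]
      congr 3
      push_cast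
      ring
    exact ⟨⟨h.herm _ h1, e1.trans_lt ENNReal.ofReal_lt_top, hr _ hi e0⟩, e1, e0⟩

lemma exists_mem_Icc_step {t : ℝ} (hn : 0 < n) (ht : t ∈ Icc 0 (n * Δt)) :
    ∃ j < n, t ∈ Icc (j * Δt) ((j + 1) * Δt) := by
  induction n with
  | zero => omega
  | succ n ih =>
    by_cases h : (n : ℝ) * Δt ≤ t
    · exact ⟨n, by omega, h, by simpa using ht.2⟩
    · rcases Nat.eq_zero_or_pos n with rfl | h0
      · simp only [Nat.cast_zero, zero_mul] at h
        exact absurd ht.1 h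
      · obtain ⟨j, hj, hjt⟩ := ih h0 ⟨ht.1, (not_le.1 h).le⟩
        exact ⟨j, by omega, hjt⟩

/-- Convergence of a splitting method whose composed substeps form a one-step method. -/
lemma uniquelySolvableWithError_of_isOneStepMethod {A B : L2 → L2} {C₀ ρ κ Q T C : ℝ}
    {u₀ : L2} {u : ℝ → L2} {𝒟' : Set L2} {Φ Ψ : ℝ → L2 → L2} (I : Indices p s r m)
    (hA : ∀ f : L2, (𝓕 f : L2) ∈ hermSobolev s → (𝓕 (A f) : L2) = X (𝓕 f))
    (hB : ∀ f : L2, (𝓕 f : L2) ∈ hermSobolev s → (𝓕 (B f) : L2) = Y (𝓕 f))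
    (hX : HasUniqueSolutions s X) (hY : HasUniqueSolutions s Y)
    (hΦ : IsSubstep m Δt (boundedData s r (2 * C₀)) X Φ) (hΨ : IsSubstep m Δt 𝒟' Y Ψ)
    (hmap : ∀ f ∈ boundedData s r (2 * C₀), ∀ t ∈ Icc 0 Δt, Φ t f ∈ 𝒟')
    (h : IsOneStepMethod s r C₀ ρ κ Q Δt n (fun t => 𝓕 (u t)) fun t f => Ψ t (Φ t f))
    (hC₀ : 0 < C₀) (hκ : 0 ≤ κ) (hQ : 0 ≤ Q) (hΔ : 0 < Δt) (hnT : n * Δt ≤ T)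
    (hu₀ : u 0 = u₀) (hU : ∀ t ∈ Icc 0 T, wnorm (bw s) (𝓕 (u t) : L2) ≤ ENNReal.ofReal C₀)
    (hU0 : Herm (𝓕 (u 0) : L2)) (hC : Real.exp (κ * T) * Q * T ≤ C) (hsmall : C * Δt ≤ C₀) :
    UniquelySolvableWithError A B s r Δt n u₀ u (C * Δt) := by
  have hs : 2 ≤ s := by linarith [I.error, I.one]
  have hCΔ : Real.exp (κ * T) * Q * T * Δt ≤ C * Δt := mul_le_mul_of_nonneg_right hC hΔ.le
  have hT : 0 ≤ T := (by positivity : (0 : ℝ) ≤ n * Δt).trans hnT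
  have hC0 : 0 ≤ C := le_trans (by positivity) hC
  have hit := h.iterates_bound hC₀ (by linarith [I.one]) hκ hQ hΔ hnT hU hU0 (hCΔ.trans hsmall)
  set S : ℝ → L2 → L2 := fun t f => Ψ t (Φ t f) with hS
  set g := iterates S Δt (𝓕 (u 0)) with hg
  have hsol : IsFourierSplitting X Y s Δt n (𝓕 u₀) (glue Φ Ψ Δt g) := by
    have := isFourierSplitting_glue I hΦ hΨ hmap (fun f hf => hf.2.1) hΔ
      (fun j hj => (hit j hj).1) (fun j _ => rfl)
    rwa [show g 0 = 𝓕 u₀ by rw [← hu₀]; rfl] at this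
  have hF : ∀ P, (𝓕 (𝓕⁻ (glue Φ Ψ Δt g P) : L2) : L2) = glue Φ Ψ Δt g P := fun P =>
    FourierTransform.fourier_fourierInv_eq _
  have hiff := isSplittingSolution_iff (n := n) (Δt := Δt) hs hA hB u₀
  refine ⟨fun P => 𝓕⁻ (glue Φ Ψ Δt g P), ?_, ?_, ?_⟩
  · rw [hiff]
    simpa only [hF] using hsol
  · intro w hw P hP
    have h1 := ((hiff w).1 hw).eqOn hsol hX hY (by linarith) hΔ hP
    have h2 : (𝓕 (w P) : L2) = 𝓕 (𝓕⁻ (glue Φ Ψ Δt g P) : L2) := by rw [hF]; exact h1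
    exact (Lp.fourierTransformₗᵢ ℝ ℂ).injective h2
  · refine iSup₂_le fun t ht => ?_
    rw [sobolevNorm_eq, fourier_sub, hF]
    rcases Nat.eq_zero_or_pos n with rfl | hn
    · simp only [Nat.cast_zero, zero_mul, Icc_self, mem_singleton_iff] at ht
      rw [ht, hsol.initial, hu₀, sub_self, wnorm_congr (Lp.coeFn_zero ℂ 2 volume)]
      simp [wnorm, norm2]
    · obtain ⟨j, hj, hjt⟩ := exists_mem_Icc_step hn ht
      obtain ⟨h1, h2, h3⟩ := hit j hj.le
      have hgt : glue Φ Ψ Δt g (t, t) = S (t - j * Δt) (g j) :=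
        glue_eq hΦ hΨ hmap hΔ (hit (j + 1) hj).1 rfl ⟨hjt, hjt⟩
      -- The local estimate holds at every time within the step, so diagonal points inside a square
      -- obey the same recursion bound as its end.
      have h4 := h.error j hj _ h1 h2 _ (by positivity) h3 (t - j * Δt)
        ⟨by linarith [hjt.1], by linarith [hjt.2]⟩
      rw [add_sub_cancel] at h4
      rw [hgt]
      refine h4.trans (ENNReal.ofReal_le_ofReal ?_)
      refine (error_recursion_le hQ hκ hΔ j).trans ((error_bound_le hQ hκ hΔ ?_).trans hCΔ)
      exact (mul_le_mul_of_nonneg_right (by exact_mod_cast hj) hΔ.le).trans hnT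

/-- The growth bound for Burgers' flow along a step. -/
lemma IsBurgersFlow.wnorm_le_of_step (I : Indices p s r m) {B : ℝ → L2 → L2} {C₀ T : ℝ}
    (hB : IsBurgersFlow r (2 * C₀) Δt B) (hC₀ : 0 < C₀) {j : ℕ} (hj : (j + 1) * Δt ≤ T)
    {f : L2} (hf : f ∈ boundedData s r (2 * C₀))
    (hfs : wnorm (bw s) f ≤
      ENNReal.ofReal (Real.exp (burgersRate m r (2 * C₀) * (j * Δt)) * C₀))
    {t : ℝ} (ht : t ∈ Icc 0 Δt) : wnorm (bw s) (B t f) ≤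
      ENNReal.ofReal (Real.exp (burgersRate m r (2 * C₀) * T) * C₀) := by
  have hρ := burgersRate_nonneg m r (a := 2 * C₀) (by positivity)
  refine (hB.wnorm_le I (by positivity) hf ht I.isWeight).trans
    ((mul_le_mul' le_rfl hfs).trans ?_)
  rw [← ENNReal.ofReal_mul (Real.exp_pos _).le, ← mul_assoc, ← Real.exp_add, ← mul_add]
  gcongr
  linarith [ht.2]

section steps

variable {C₀ T M κ Q : ℝ} {B : ℝ → L2 → L2} {U : ℝ → L2}

/-- The growth in H^s is that of Burgers' flow, because the linear flow contracts. The bound `M`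
over the whole time interval depends on the numerical solution only through its H^r bound `2 * C₀`;
the argument `2 * (2 * C₀)` of `diffConst` allows for the doubling of that norm during a Burgers
substep. -/
lemma isOneStepMethod_kFlow_burgers (I : Indices p s r m) (hk : IsAdmissibleSymbol p A k)
    (hB : IsBurgersFlow r (2 * C₀) Δt B) (hC₀ : 0 < C₀) (hΔ : 0 < Δt) (hnT : n * Δt ≤ T)
    (hU : ∀ t ∈ Icc 0 T, wnorm (bw s) (U t) ≤ ENNReal.ofReal C₀)
    (hUd : ∀ t ∈ Icc 0 T, HasDerivWithinAt U (kMul k (U t) - adv (U t) (U t)) (Icc 0 T) t)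
    (hM : M = Real.exp (burgersRate m r (2 * C₀) * T) * C₀)
    (hκ : κ = 4 * diffConst m r (2 * (2 * C₀)) M) (hQ : 2 * (commConst m p s A * M ^ 2) ≤ Q)
    (hκΔ : κ * Δt ≤ 1) :
    IsOneStepMethod s r C₀ (burgersRate m r (2 * C₀)) κ Q Δt n U
      fun t f => kFlow hk t (B t f) where
  herm f hf := (((hB.isSubstep I (by positivity)).herm f hf) Δt ⟨hΔ.le, le_rfl⟩).kFlow hk Δt
  growth f hf := (wnorm_kFlow_le hk Δt _).trans
    (hB.wnorm_le I (by positivity) hf ⟨hΔ.le, le_rfl⟩ I.isWeight)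
  error j hj f hf hfs y hy hfy θ hθ := by
    have hA := hk.const_nonneg
    have hjT : ((j : ℝ) + 1) * Δt ≤ T :=
      (mul_le_mul_of_nonneg_right (by exact_mod_cast hj) hΔ.le).trans hnT
    have hT : 0 ≤ T := (by positivity : (0 : ℝ) ≤ (j + 1) * Δt).trans hjT
    have hM0 : 0 ≤ M := by rw [hM]; positivity
    have hρ := burgersRate_nonneg m r (a := 2 * C₀) (by positivity)
    have hC₀M : C₀ ≤ M := by
      rw [hM]
      exact le_mul_of_one_le_left hC₀.le (Real.one_le_exp (by positivity))
    have hmaps : ∀ t ∈ Icc 0 Δt, j * Δt + t ∈ Icc 0 T := fun t ht => by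
      have h1 := ht.1
      have h2 := ht.2
      exact ⟨by positivity, by linarith⟩
    have key := wnorm_kFlow_burgers_sub_le I hk hB (by positivity) hf hM0 hy
      (fun t ht => by rw [hM]; exact hB.wnorm_le_of_step I hC₀ hjT hf hfs ht)
      (U := fun t => U (j * Δt + t))
      (ContinuousOn.comp (t := Icc 0 T) (fun t ht => (hUd t ht).continuousWithinAt) (by fun_prop)
        hmaps)
      (fun t ht => by
        have h1 := hmaps t (Ioo_subset_Icc_self ht)
        have h2 := ht.1
        have h3 := ht.2
        have h4 : 0 < j * Δt + t := by positivity
        exact ((hUd _ h1).hasDerivAt (Icc_mem_nhds h4 (by linarith))).comp_const_add _ _)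
      (fun t ht => (hU _ (hmaps t ht)).trans (ENNReal.ofReal_le_ofReal hC₀M))
      (by rw [hκ] at hκΔ; linarith) (by simpa using hfy) hθ
    refine key.trans (ENNReal.ofReal_le_ofReal ?_)
    have hL := diffConst_nonneg m r (M₁ := 2 * (2 * C₀)) (M₂ := M) (by positivity) hM0
    have hK : 0 ≤ commConst m p s A := by unfold commConst; positivity
    have e : 1 + 4 * Δt * diffConst m r (2 * (2 * C₀)) M = 1 + κ * Δt := by rw [hκ]; ring
    rw [e]
    have hκ0 : 0 ≤ κ := by rw [hκ]; positivity
    have h5 : 2 * Δt * (Δt * (commConst m p s A * M ^ 2)) ≤ Q * Δt ^ 2 := by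
      calc _ = 2 * (commConst m p s A * M ^ 2) * Δt ^ 2 := by ring
        _ ≤ _ := by gcongr
    gcongr

/-- Triangle inequality through the other order of the substeps. Each of the two comparisons
contributes a defect with coefficient 2, hence the 4. -/
lemma isOneStepMethod_burgers_kFlow (I : Indices p s r m) (hk : IsAdmissibleSymbol p A k)
    (hB : IsBurgersFlow r (2 * C₀) Δt B) (hC₀ : 0 < C₀) (hΔ : 0 < Δt) (hnT : n * Δt ≤ T)
    (hU : ∀ t ∈ Icc 0 T, wnorm (bw s) (U t) ≤ ENNReal.ofReal C₀)
    (hUd : ∀ t ∈ Icc 0 T, HasDerivWithinAt U (kMul k (U t) - adv (U t) (U t)) (Icc 0 T) t)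
    (hM : M = Real.exp (burgersRate m r (2 * C₀) * T) * C₀)
    (hκ : κ = 4 * diffConst m r (2 * (2 * C₀)) M) (hQ : 4 * (commConst m p s A * M ^ 2) ≤ Q)
    (hκΔ : κ * Δt ≤ 1) :
    IsOneStepMethod s r C₀ (burgersRate m r (2 * C₀)) κ Q Δt n U
      fun t f => B t (kFlow hk t f) := by
  have hmap : ∀ f ∈ boundedData s r (2 * C₀), ∀ t, kFlow hk t f ∈ boundedData s r (2 * C₀) :=
    fun f hf t => ⟨hf.1.kFlow hk t, (wnorm_kFlow_le hk t f).trans_lt hf.2.1,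
      (wnorm_kFlow_le hk t f).trans hf.2.2⟩
  have hG := isOneStepMethod_kFlow_burgers I hk hB hC₀ hΔ hnT hU hUd hM hκ le_rfl hκΔ
  refine ⟨fun f hf => (hB.isSubstep I (by positivity)).herm _ (hmap f hf Δt) Δt ⟨hΔ.le, le_rfl⟩,
    fun f hf => ?_, fun j hj f hf hfs y hy hfy θ hθ => ?_⟩
  · refine (hB.wnorm_le I (by positivity) (hmap f hf Δt) ⟨hΔ.le, le_rfl⟩ I.isWeight).trans ?_
    gcongr
    exact wnorm_kFlow_le hk Δt f
  · have hA := hk.const_nonneg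
    have hjT : ((j : ℝ) + 1) * Δt ≤ T :=
      (mul_le_mul_of_nonneg_right (by exact_mod_cast hj) hΔ.le).trans hnT
    have hM0 : 0 ≤ M := by rw [hM]; positivity
    have hL := diffConst_nonneg m r (M₁ := 2 * (2 * C₀)) (M₂ := M) (by positivity) hM0
    have hK : 0 ≤ commConst m p s A := by unfold commConst; positivity
    have h1 := wnorm_burgers_kFlow_sub_le I hk hB (by positivity) hf hM0
      (fun t ht g hg hgf => by
        rw [hM]; exact hB.wnorm_le_of_step I hC₀ hjT hg (hgf.trans hfs) ht)
      (by rw [hκ] at hκΔ; linarith) hθ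
    have h2 := hG.error j hj f hf hfs y hy hfy θ hθ
    have hκ0 : 0 ≤ κ := by rw [hκ]; positivity
    have e : B θ (kFlow hk θ f) - U (j * Δt + θ) = (kFlow hk θ (B θ f) - U (j * Δt + θ)) -
        (kFlow hk θ (B θ f) - B θ (kFlow hk θ f)) := by abel
    rw [e]
    refine (wnorm_sub_le (measurable_bw r) _ _).trans ((add_le_add h2 h1).trans ?_)
    rw [← ENNReal.ofReal_add (by positivity) (by positivity)]
    apply ENNReal.ofReal_le_ofReal
    have e2 : 1 + 4 * Δt * diffConst m r (2 * (2 * C₀)) M = 1 + κ * Δt := by rw [hκ]; ring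
    rw [e2, ← mul_add]
    have h5 : 4 * (commConst m p s A * M ^ 2) * Δt ^ 2 ≤ Q * Δt ^ 2 := by gcongr
    have h6 : y + 2 * (commConst m p s A * M ^ 2) * Δt ^ 2 +
        2 * Δt * (Δt * (commConst m p s A * M ^ 2)) ≤ y + Q * Δt ^ 2 := by linarith
    gcongr

end steps

end

/-! ### Both orders of the substeps for an exact solution -/

noncomputable section

variable {p s r T A C₀ C Δt κ Q M : ℝ} {m n : ℕ} {k : ℝ → ℂ} {u₀ : L2} {u : ℝ → L2}

lemma fourier_neg_advection (hs : 2 ≤ s) (f : L2) (hf : (𝓕 f : L2) ∈ hermSobolev s) :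
    (𝓕 (-advection f) : L2) = -adv (𝓕 f) (𝓕 f) := by
  rw [fourier_neg, fourier_advection (isH2_of_wnorm_bw hs hf.2)]

/-- An exact solution, on the Fourier side. -/
lemma IsExactSolution.fourier (h : IsExactSolution k s T u₀ u) (hs : 2 ≤ s) :
    (∀ t ∈ Icc 0 T, (𝓕 (u t) : L2) ∈ hermSobolev s) ∧
      ∀ t ∈ Icc 0 T, HasDerivWithinAt (fun t => (𝓕 (u t) : L2))
        (kMul k (𝓕 (u t)) - adv (𝓕 (u t)) (𝓕 (u t))) (Icc 0 T) t := by
  have hm : ∀ t ∈ Icc 0 T, (𝓕 (u t) : L2) ∈ hermSobolev s := fun t ht =>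
    (mem_realSobolev_iff hs _).1 (h.continuous.1 t ht)
  refine ⟨hm, fun t ht => ?_⟩
  have h1 := hasDerivWithinAt_fourier_iff.2 (h.equation t ht)
  rwa [fourier_sub, fourier_advection (isH2_of_wnorm_bw hs (hm t ht).2),
    fourier_fourierMultiplier] at h1

/-- Convergence of both splittings for sufficiently small steps. -/
lemma uniquelySolvableWithError_both (I : Indices p s r m) (hk : IsAdmissibleSymbol p A k)
    (hu : IsExactSolution k s T u₀ u)
    (hb : (⨆ t ∈ Icc 0 T, sobolevNorm s (u t)) ≤ ENNReal.ofReal C₀) (hT : 0 ≤ T) (hC₀ : 0 < C₀)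
    (hΔ : 0 < Δt) (hnT : n * Δt ≤ T)
    (hM : M = Real.exp (burgersRate m r (2 * C₀) * T) * C₀)
    (hκ : κ = 4 * diffConst m r (2 * (2 * C₀)) M) (hQ : Q = 4 * (commConst m p s A * M ^ 2))
    (hC : Real.exp (κ * T) * Q * T ≤ C) (hκΔ : κ * Δt ≤ 1) (hCΔ : C * Δt ≤ C₀)
    (hBΔ : 8 * energyConst m * (embConst (r - 1)).toReal * (2 * C₀) * Δt < 1) :
    UniquelySolvableWithError (fun f => -advection f) (fourierMultiplier k) s r Δt n u₀ u (C * Δt) ∧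
      UniquelySolvableWithError (fourierMultiplier k) (fun f => -advection f) s r Δt n u₀ u
        (C * Δt) := by
  have hs : 2 ≤ s := by linarith [I.error, I.one]
  obtain ⟨hmem, hd⟩ := hu.fourier hs
  have hU : ∀ t ∈ Icc 0 T, wnorm (bw s) (𝓕 (u t) : L2) ≤ ENNReal.ofReal C₀ := fun t ht => by
    rw [← sobolevNorm_eq]
    exact (le_iSup₂ (f := fun t (_ : t ∈ Icc 0 T) => sobolevNorm s (u t)) t ht).trans hb
  obtain ⟨B, hB⟩ := exists_burgersFlow I (a := 2 * C₀) (by positivity) hΔ hBΔ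
  have hA := hk.const_nonneg
  have hM0 : 0 ≤ M := by rw [hM]; positivity
  have hK : 0 ≤ commConst m p s A := by unfold commConst; positivity
  have hQ0 : 0 ≤ Q := by rw [hQ]; positivity
  have hκ0 : 0 ≤ κ := by
    have := diffConst_nonneg m r (M₁ := 2 * (2 * C₀)) (M₂ := M) (by positivity) hM0
    rw [hκ]; positivity
  have hsub : boundedData s r (2 * C₀) ⊆ hermSobolev s := fun f hf => ⟨hf.1, hf.2.1⟩
  have hBs := hB.isSubstep I (by positivity)
  have hKs := isSubstep_kFlow (σ := Δt) I hk
  have hadv := fourier_neg_advection hs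
  have hmul : ∀ f : L2, (𝓕 f : L2) ∈ hermSobolev s → (𝓕 (fourierMultiplier k f) : L2) =
      kMul k (𝓕 f) := fun f _ => fourier_fourierMultiplier k f
  have huB := hasUniqueSolutions_burgers I
  have huK := hasUniqueSolutions_kMul I hk
  have hU0 := (hmem 0 ⟨le_rfl, hT⟩).1
  constructor
  · refine uniquelySolvableWithError_of_isOneStepMethod I hadv hmul huB huK hBs hKs ?_
      (isOneStepMethod_kFlow_burgers I hk hB hC₀ hΔ hnT hU hd hM hκ ?_ hκΔ)
      hC₀ hκ0 hQ0 hΔ hnT hu.initial hU hU0 hC hCΔ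
    · intro f hf t ht
      obtain ⟨c, hc⟩ := hBs.weight
      exact ⟨hBs.herm f hf t ht, (hc f hf t ht _ I.isWeight).trans_lt
        (ENNReal.mul_lt_top ENNReal.ofReal_lt_top hf.2.1)⟩
    · rw [hQ]
      have : 0 ≤ commConst m p s A * M ^ 2 := by positivity
      linarith
  · refine uniquelySolvableWithError_of_isOneStepMethod I hmul hadv huK huB (hKs.mono hsub) hBs ?_
      (isOneStepMethod_burgers_kFlow I hk hB hC₀ hΔ hnT hU hd hM hκ hQ.ge hκΔ)
      hC₀ hκ0 hQ0 hΔ hnT hu.initial hU hU0 hC hCΔ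
    exact fun f hf t _ => ⟨hf.1.kFlow hk t, (wnorm_kFlow_le hk t f).trans_lt hf.2.1,
      (wnorm_kFlow_le hk t f).trans hf.2.2⟩

end

end GodunovSplitting

/-! ### Choice of the constants -/

theorem theorem1p1 (p s T C₀ A : ℝ) (hp : 0 ≤ p) (hs : 3 / 2 + max 1 p < s) (hT : 0 < T)
    (hC₀ : 0 < C₀) :
    ∃ Δtbar > 0, ∃ C > 0,
      ∀ (k : ℝ → ℂ) (u₀ : GodunovSplitting.L2) (u : ℝ → GodunovSplitting.L2),
        GodunovSplitting.IsAdmissibleSymbol p A k →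
        GodunovSplitting.IsExactSolution k s T u₀ u →
        (⨆ t ∈ Set.Icc 0 T, GodunovSplitting.sobolevNorm s (u t)) ≤ ENNReal.ofReal C₀ →
        ∀ Δt ∈ Set.Ioc 0 Δtbar,
          GodunovSplitting.UniquelySolvableWithError
            (fun f => -GodunovSplitting.advection f) (GodunovSplitting.fourierMultiplier k)
            s (s - max 1 p) Δt (GodunovSplitting.numSteps Δt T) u₀ u (C * Δt) ∧
          GodunovSplitting.UniquelySolvableWithError
            (GodunovSplitting.fourierMultiplier k) (fun f => -GodunovSplitting.advection f)
            s (s - max 1 p) Δt (GodunovSplitting.numSteps Δt T) u₀ u (C * Δt) := by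
  -- For negative `A` there is no admissible symbol, and any constants serve.
  by_cases hA : 0 ≤ A
  swap
  · exact ⟨1, one_pos, 1, one_pos, fun k _ _ hk => absurd hk.const_nonneg hA⟩
  obtain ⟨m, hm⟩ := exists_nat_ge (s + 1)
  set r := s - max 1 p with hr
  have I : GodunovSplitting.Indices p s r m :=
    ⟨by linarith, by linarith [le_max_left 1 p], by linarith [le_max_right 1 p], hm⟩
  obtain ⟨M, hM⟩ : ∃ M, M = Real.exp (GodunovSplitting.burgersRate m r (2 * C₀) * T) * C₀ :=
    ⟨_, rfl⟩
  obtain ⟨κ, hκ⟩ : ∃ κ, κ = 4 * GodunovSplitting.diffConst m r (2 * (2 * C₀)) M := ⟨_, rfl⟩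
  obtain ⟨Q, hQ⟩ : ∃ Q, Q = 4 * (GodunovSplitting.commConst m p s A * M ^ 2) := ⟨_, rfl⟩
  set β := 8 * GodunovSplitting.energyConst m *
    (GodunovSplitting.embConst (r - 1)).toReal * (2 * C₀) with hβ
  -- The added 1 ensures `C > 0` when the commutator constant vanishes, as it does for `A = 0`.
  set C := Real.exp (κ * T) * Q * T + 1 with hC
  have hβ0 : 0 ≤ β := by
    have := GodunovSplitting.energyConst_nonneg m
    positivity
  have hM0 : 0 ≤ M := by rw [hM]; positivity
  have hκ0 : 0 ≤ κ := by
    have := GodunovSplitting.diffConst_nonneg m r (M₁ := 2 * (2 * C₀)) (M₂ := M) (by positivity) hM0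
    rw [hκ]; positivity
  have hQ0 : 0 ≤ Q := by
    rw [hQ]
    unfold GodunovSplitting.commConst
    positivity
  have hC0 : 0 < C := by positivity
  -- One threshold enforces all smallness conditions: `β Δt < 1` for solvability of a Burgers
  -- substep, `κ Δt ≤ 1` for the difference estimate and `C Δt ≤ C₀` for the bootstrap. The summand
  -- 1 makes the first inequality strict.
  refine ⟨1 / (1 + β + κ + C / C₀), by positivity, C, hC0, fun k u₀ u hk hu hb Δt hΔ => ?_⟩
  have hΔ0 := hΔ.1
  have hsum := (le_div_iff₀ (by positivity)).1 hΔ.2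
  have h1 : 0 ≤ Δt * β := by positivity
  have h2 : 0 ≤ Δt * κ := by positivity
  have h3 : 0 ≤ Δt * (C / C₀) := by positivity
  refine GodunovSplitting.uniquelySolvableWithError_both I hk hu hb hT.le hC₀ hΔ0 ?_ hM hκ hQ
    (by linarith) (by linarith) ?_ (by linarith)
  · rw [← le_div_iff₀ hΔ0]
    exact Nat.floor_le (by positivity)
  · have h4 : Δt * (C / C₀) ≤ 1 := by linarith
    rw [← mul_div_assoc, div_le_one hC₀] at h4
    linarith
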